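/- **Setting.** Let $V=\mathbb C^N$. For $X\in\mathrm{End}(V^{\otimes 2})$ let $X_m$ denote $X$ acting in the tensor factors $m,m+1$ of $V^{\otimes n}$, and let $P$ be the permutation operator on $V^{\otimes 2}$. An *R-matrix* is an invertible $R\in\mathrm{End}(V^{\otimes 2})$ with $R_1R_2R_1=R_2R_1R_2$. A pair $\{R,F\}$ of R-matrices is *compatible* if $R_1F_2F_1=F_2F_1R_2$ and $R_2F_1F_2=F_1F_2R_1$. $X$ is *skew invertible* if there is $\Psi_X$ with $\mathrm{Tr}_{(2)}X_{12}(\Psi_X)_{23}=\mathrm{Tr}_{(2)}(\Psi_X)_{12}X_{23}=P_{13}$; put $C_X=\mathrm{Tr}_{(1)}(\Psi_X)_{12}$ and $D_X=\mathrm{Tr}_{(2)}(\Psi_X)_{12}$. It is *strict* skew invertible if moreover $C_X$ or $D_X$ is invertible. Let $q\in\mathbb C\setminus\{0,\pm1\}$ and $\mu\in\mathbb C\setminus\{0,q,-q^{-1}\}$. $R$ is *of BMW type* with parameters $q,\mu$ if it is an R-matrix with minimal polynomial $(x-q)(x+q^{-1})(x-\mu)$ and $K=\mu^{-1}(q-q^{-1})^{-1}(q-R)(q^{-1}+R)$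 satisfies $K_2K_1=R_1^{\pm1}R_2^{\pm1}K_1$ (both signs) and $K_1K_2K_1=K_1$. The *BMW algebra* $\mathcal W_n(q,\mu)$ is the quotient of the group algebra $\mathbb C\mathcal B_n$ of the braid group, with Artin generators $\sigma_1,\dots,\sigma_{n-1}$, by $\sigma_i\kappa_i=\kappa_i\sigma_i=\mu\kappa_i$ and $\kappa_i\sigma_{i+1}^{\pm1}\kappa_i=\mu^{\mp1}\kappa_i$, where $\kappa_i=\frac{(q-\sigma_i)(q^{-1}+\sigma_i)}{\mu(q-q^{-1})}$. An R-matrix $R$ of BMW type defines the representation $\rho_R:\mathcal W_n(q,\mu)\to\mathrm{End}(V^{\otimes n})$, $\sigma_i\mapsto R_i$. Put $j_q=\frac{q^j-q^{-j}}{q-q^{-1}}$, $\eta=\frac{(q-\mu)(q^{-1}+\mu)}{\mu(q-q^{-1})}$, $\alpha_\varepsilon=-\varepsilon q^{-\varepsilon}\mu^{-1}$ and $\sigma_i^{\varepsilon}(x)=1+\frac{x-1}{q-q^{-1}}\sigma_i+\frac{x-1}{\alpha_\varepsilon x+1}\kappa_i$ for $\varepsilon=\pm1$. The antisymmetrizers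 and symmetrizers are given by $a^{(1)}=s^{(1)}=1$ and $$a^{(i+1)}=\tfrac{q^i}{(i+1)_q}\,a^{(i)}\sigma_i^{-}(q^{-2i})\,a^{(i)},\qquad s^{(i+1)}=\tfrac{q^{-i}}{(i+1)_q}\,s^{(i)}\sigma_i^{+}(q^{2i})\,s^{(i)} .$$ They are defined for $i\le n$ under the respective conditions $$(\mathrm A_n)\ \ j_q\ne0,\ \mu\ne-q^{3-2j}\quad\text{and}\quad(\mathrm S_n)\ \ j_q\neq0,\ \mu\ne q^{2j-3}\qquad\text{for all } j=2,\dots,n .$$ Let $\{R,F\}$ be a compatible pair of R-matrices, $R$ skew invertible of BMW type with parameters $q,\mu$, and $F$ strict skew invertible. The *quantum matrix algebra* $\mathcal M(R,F)$ is the unital associative $\mathbb C$-algebra generated by the entries of an $N\times N$ matrix $M$ subject to $R_1M_{\overline1}M_{\overline2}=M_{\overline1}M_{\overline2}R_1$, where $M_{\overline1}=M_1$ is $M$ acting in the first tensor factor and $M_{\overline{i+1}}=F_iM_{\overline i}F_i^{-1}$. For $\alpha$ in $\mathcal B_n$ or $\mathcal W_n(q,\mu)$, $n\ge1$, put $$ch(\alpha)=\mathrm{Tr}_{(1,\dots,n)}\bigl((D_R)_1\cdots(D_R)_n\,M_{\overline1}\cdots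 M_{\overline n}\,\rho_R(\alpha)\bigr)\in\mathcal M(R,F),$$ and let $\mathcal C(R,F)$ (the characteristic subalgebra) be the linear span of $1$ and all $ch(\beta)$, $\beta\in\mathcal B_n$, $n\ge1$. Put $p_0=\mathrm{Tr}\,D_R$, $p_1=ch(1)$ with $1\in\mathcal B_1$, $p_i=ch(\sigma_{i-1}\cdots\sigma_2\sigma_1)$ for $i\ge2$, $g=\eta^{-1}ch(\kappa_1)$ with $\kappa_1\in\mathcal W_2(q,\mu)$, $a_0=s_0=1$, and $a_i=ch(a^{(i)})$, $s_i=ch(s^{(i)})$ with $a^{(i)},s^{(i)}\in\mathcal W_i(q,\mu)$, $i\ge1$. **Theorem.** In the above setting let $n\ge0$. All $p_i$ and $g$ lie in $\mathcal C(R,F)$, and the following holds. 1. If $(\mathrm A_n)$ holds, then $a_0,\dots,a_n\in\mathcal C(R,F)$ and $$\sum_{i=0}^{n-1}(-q)^i a_i\,p_{n-i}=(-1)^{n-1}n_q\,a_n+(-1)^n\sum_{i=1}^{\lfloor n/2\rfloor}\bigl(\mu q^{n-2i}-q^{1-n+2i}\bigr)a_{n-2i}\,g^i .$$ 2. If $(\mathrm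 S_n)$ holds, then $s_0,\dots,s_n\in\mathcal C(R,F)$ and $$\sum_{i=0}^{n-1}q^{-i}s_i\,p_{n-i}=n_q\,s_n+\sum_{i=1}^{\lfloor n/2\rfloor}\bigl(\mu q^{2i-n}+q^{n-2i-1}\bigr)s_{n-2i}\,g^i .$$ 3. If both $(\mathrm A_n)$ and $(\mathrm S_n)$ hold, then $$\sum_{i=0}^n(-1)^i a_i\,s_{n-i}=\delta_{n,0}-\delta_{n,2}\,g .$$ -/

import Mathlib

/-!
Operators on `V^{⊗ n}`, `V = ℂ^N`, are matrices indexed by multi-indices `Fin n → Fin N`;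
tensor factors and braid generators are numbered from `0`.
-/

namespace QuantumMatrix

/-! ### Operators on tensor powers -/

/-- `Op N n A` is `Mat_N(A)^{⊗ n}`: operators on `V^{⊗ n}` with coefficients in `A`. -/
abbrev Op (N n : ℕ) (A : Type*) := Matrix (Fin n → Fin N) (Fin n → Fin N) A

/-- The operator on `V^{⊗ n}` which acts by `X` on the tensor factors `e 0, …, e (k - 1)` and
trivially on all the other ones. -/
def place {N k n : ℕ} {A : Type*} [Zero A] (e : Fin k → Fin n) (X : Op N k A) : Op N n A :=
  Matrix.of fun a b =>
    if ∀ j, (∀ i, e i ≠ j) → a j = b j then X (a ∘ e) (b ∘ e) else 0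

theorem place_apply {N k n : ℕ} {A : Type*} [Zero A] (e : Fin k → Fin n) (X : Op N k A)
    (a b : Fin n → Fin N) :
    place e X a b = if ∀ j, (∀ i, e i ≠ j) → a j = b j then X (a ∘ e) (b ∘ e) else 0 := rfl

theorem place_one {N k n : ℕ} {A : Type*} [Zero A] [One A] (e : Fin k → Fin n) :
    place e (1 : Op N k A) = 1 := by
  ext a b
  rw [place_apply, Matrix.one_apply, Matrix.one_apply]
  by_cases hab : a = b
  · subst hab; simp
  · rw [if_neg hab]
    split_ifs with h1 h2
    · exfalso; apply hab; funext j
      by_cases hj : ∀ i, e i ≠ j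
      · exact h1 j hj
      · push Not at hj
        obtain ⟨i, rfl⟩ := hj
        exact congrFun h2 i
    · rfl
    · rfl

theorem place_mul {N k n : ℕ} {A : Type*} [NonUnitalNonAssocSemiring A] (e : Fin k → Fin n)
    (he : Function.Injective e) (X Y : Op N k A) :
    place e (X * Y) = place e X * place e Y := by
  classical
  ext a b
  rw [place_apply, Matrix.mul_apply]
  split_ifs with h
  · rw [Matrix.mul_apply]
    symm
    have key : ∀ c : Fin n → Fin N, place e X a c * place e Y c b =
        if ∀ j, (∀ i, e i ≠ j) → a j = c j then X (a ∘ e) (c ∘ e) * Y (c ∘ e) (b ∘ e) else 0 := by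
      intro c
      rw [place_apply, place_apply]
      by_cases h1 : ∀ j, (∀ i, e i ≠ j) → a j = c j
      · have h2 : ∀ j, (∀ i, e i ≠ j) → c j = b j := fun j hj => (h1 j hj).symm.trans (h j hj)
        rw [if_pos h1, if_pos h1, if_pos h2]
      · rw [if_neg h1, if_neg h1, zero_mul]
    rw [Finset.sum_congr rfl fun c _ => key c, ← Finset.sum_filter]
    refine Finset.sum_nbij' (fun c => c ∘ e) (fun d => Function.extend e d a) ?_ ?_ ?_ ?_ ?_
    · intro c _; simp
    · intro d _
      simp only [Finset.mem_filter, Finset.mem_univ, true_and]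
      intro j hj
      rw [Function.extend_apply' _ _ _ (by rintro ⟨i, hi⟩; exact hj i hi)]
    · intro c hc
      simp only [Finset.mem_filter, Finset.mem_univ, true_and] at hc
      funext j
      by_cases hj : ∃ i, e i = j
      · obtain ⟨i, rfl⟩ := hj
        rw [he.extend_apply]; rfl
      · rw [Function.extend_apply' _ _ _ hj]
        exact hc j (fun i hi => hj ⟨i, hi⟩)
    · intro d _
      funext i
      exact he.extend_apply d a i
    · intro c _; rfl
  · symm
    apply Finset.sum_eq_zero
    intro c _
    change place e X a c * place e Y c b = 0
    rw [place_apply, place_apply]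
    split_ifs with h1 h2
    · exact absurd (fun j hj => (h1 j hj).trans (h2 j hj)) h
    · rw [mul_zero]
    · rw [zero_mul]
    · rw [zero_mul]

theorem place_place {N l k n : ℕ} {A : Type*} [Zero A] (e : Fin k → Fin n)
    (he : Function.Injective e) (f : Fin l → Fin k) (X : Op N l A) :
    place e (place f X) = place (e ∘ f) X := by
  ext a b
  rw [place_apply, place_apply, place_apply]
  by_cases h : ∀ j, (∀ i, (e ∘ f) i ≠ j) → a j = b j
  · rw [if_pos h, if_pos, if_pos]
    · rfl
    · intro j hj
      exact h (e j) (fun i hi => hj i (he hi))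
    · intro j hj
      exact h j (fun i => hj (f i))
  · rw [if_neg h]
    split_ifs with h1 h2
    · exfalso; apply h
      intro j hj
      by_cases hj' : ∀ i, e i ≠ j
      · exact h1 j hj'
      · push Not at hj'
        obtain ⟨i, rfl⟩ := hj'
        exact h2 i (fun l hl => hj l (congrArg e hl))
    · rfl
    · rfl

/-- Operators acting on disjoint sets of tensor factors: the entries of the product. -/
theorem place_mul_disjoint {N k l n : ℕ} {A : Type*} [NonUnitalNonAssocSemiring A]
    (e : Fin k → Fin n) (f : Fin l → Fin n) (hef : ∀ i j, e i ≠ f j) (X : Op N k A) (Y : Op N l A)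
    (a b : Fin n → Fin N) :
    (place e X * place f Y) a b =
      if ∀ j, (∀ i, e i ≠ j) → (∀ i, f i ≠ j) → a j = b j then
        X (a ∘ e) (b ∘ e) * Y (a ∘ f) (b ∘ f) else 0 := by
  classical
  rw [Matrix.mul_apply]
  set c0 : Fin n → Fin N := fun j => if ∃ i, e i = j then b j else a j with hc0
  have hce : c0 ∘ e = b ∘ e := by
    funext i; simp [hc0]
  have hcf : c0 ∘ f = a ∘ f := by
    funext i
    have : ¬ ∃ i', e i' = f i := by rintro ⟨i', h⟩; exact hef _ _ h
    simp only [hc0, Function.comp_apply, if_neg this]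
  rw [Finset.sum_eq_single c0]
  · rw [place_apply, place_apply, hce, hcf]
    have h1 : ∀ j, (∀ i, e i ≠ j) → a j = c0 j := by
      intro j hj
      have : ¬ ∃ i', e i' = j := by rintro ⟨i', h⟩; exact hj _ h
      simp only [hc0, if_neg this]
    rw [if_pos h1]
    by_cases h : ∀ j, (∀ i, e i ≠ j) → (∀ i, f i ≠ j) → a j = b j
    · rw [if_pos h, if_pos]
      intro j hj
      by_cases hj' : ∃ i, e i = j
      · simp only [hc0, if_pos hj']
      · simp only [hc0, if_neg hj']
        exact h j (fun i hi => hj' ⟨i, hi⟩) hj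
    · rw [if_neg h, if_neg, mul_zero]
      intro h2
      apply h
      intro j hj hj'
      exact (h1 j hj).trans (h2 j hj')
  · intro c _ hc
    rw [place_apply, place_apply]
    split_ifs with h1 h2
    · exfalso; apply hc
      funext j
      by_cases hj : ∃ i, e i = j
      · simp only [hc0, if_pos hj]
        obtain ⟨i, rfl⟩ := hj
        exact h2 _ (fun i' h => hef _ _ h.symm)
      · simp only [hc0, if_neg hj]
        exact (h1 j (fun i hi => hj ⟨i, hi⟩)).symm
    · rw [mul_zero]
    · rw [zero_mul]
    · rw [zero_mul]
  · simp

theorem place_commute {N k l n : ℕ} {A : Type*} [CommSemiring A] (e : Fin k → Fin n)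
    (f : Fin l → Fin n) (hef : ∀ i j, e i ≠ f j) (X : Op N k A) (Y : Op N l A) :
    place e X * place f Y = place f Y * place e X := by
  ext a b
  rw [place_mul_disjoint e f hef, place_mul_disjoint f e (fun i j => (hef j i).symm), mul_comm]
  refine if_congr ⟨fun h j h1 h2 => h j h2 h1, fun h j h1 h2 => h j h2 h1⟩ rfl rfl

/-- `place e` as an algebra homomorphism. -/
def placeHom {N k n : ℕ} (e : Fin k → Fin n) (he : Function.Injective e) :
    Op N k ℂ →ₐ[ℂ] Op N n ℂ :=
  AlgHom.ofLinearMap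
    { toFun := place e
      map_add' := fun X Y => by
        ext a b
        simp only [place_apply, Matrix.add_apply]
        split_ifs <;> simp
      map_smul' := fun c X => by
        ext a b
        simp only [place_apply, Matrix.smul_apply, RingHom.id_apply]
        split_ifs <;> simp }
    (place_one e) (place_mul e he)

@[simp] theorem placeHom_apply {N k n : ℕ} (e : Fin k → Fin n) (he : Function.Injective e)
    (X : Op N k ℂ) : placeHom e he X = place e X := rfl

/-- `X_m` on `V^{⊗ n}`: the two-site operator `X` acting on the tensor factors `m`, `m + 1`
(the identity if there are no such factors). -/
def site {N : ℕ} (n m : ℕ) (X : Op N 2 ℂ) : Op N n ℂ :=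
  if h : m + 1 < n then place ![⟨m, by omega⟩, ⟨m + 1, h⟩] X else 1

/-- `M_1` on `V^{⊗ n}`: the matrix `M` acting on the initial tensor factor. -/
def siteOne {N : ℕ} {A : Type*} [Semiring A] (n : ℕ) (M : Matrix (Fin N) (Fin N) A) : Op N n A :=
  if h : 0 < n then place ![⟨0, h⟩] (Matrix.of fun a b : Fin 1 → Fin N => M (a 0) (b 0)) else 1

/-- The operator with coefficients in a `ℂ`-algebra defined by an operator with coefficients
in `ℂ`. -/
def scal {N n : ℕ} (A : Type*) [Semiring A] [Algebra ℂ A] (X : Op N n ℂ) : Op N n A :=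
  X.map (algebraMap ℂ A)

/-! ### R-matrices -/

/-- R-matrices: invertible solutions of the Yang-Baxter equation. -/
structure IsRMatrix {N : ℕ} (R : Op N 2 ℂ) : Prop where
  isUnit : IsUnit R
  ybe : site 3 0 R * site 3 1 R * site 3 0 R = site 3 1 R * site 3 0 R * site 3 1 R

/-- Compatible pairs `{R, F}`: the twist relations. -/
structure IsCompatible {N : ℕ} (R F : Op N 2 ℂ) : Prop where
  left : site 3 0 R * site 3 1 F * site 3 0 F = site 3 1 F * site 3 0 F * site 3 1 R
  right : site 3 1 R * site 3 0 F * site 3 1 F = site 3 0 F * site 3 1 F * site 3 0 R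

/-- `Tr_(2) (X_12 Y_23)`, an operator on the tensor factors `1` and `3`. -/
def middleTrace {N : ℕ} (X Y : Op N 2 ℂ) : Op N 2 ℂ :=
  Matrix.of fun a b => ∑ s, ∑ t, X ![a 0, s] ![b 0, t] * Y ![t, a 1] ![s, b 1]

/-- The permutation operator `P (u ⊗ v) = v ⊗ u`. -/
def perm (N : ℕ) : Op N 2 ℂ :=
  Matrix.of fun a b => if a 0 = b 1 ∧ a 1 = b 0 then 1 else 0

/-- `Ψ` is a skew inverse of `X`: `Tr_(2) X_12 Ψ_23 = Tr_(2) Ψ_12 X_23 = P_13`. -/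
def IsSkewInverse {N : ℕ} (X Ψ : Op N 2 ℂ) : Prop :=
  middleTrace X Ψ = perm N ∧ middleTrace Ψ X = perm N

/-- Skew invertible operators. -/
def SkewInvertible {N : ℕ} (X : Op N 2 ℂ) : Prop := ∃ Ψ, IsSkewInverse X Ψ

open Classical in
/-- The (unique) skew inverse `Ψ_X` of a skew invertible operator `X`. -/
noncomputable def skewInverse {N : ℕ} (X : Op N 2 ℂ) : Op N 2 ℂ :=
  if h : SkewInvertible X then h.choose else 0

theorem skewInverse_spec {N : ℕ} {X : Op N 2 ℂ} (h : SkewInvertible X) :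
    IsSkewInverse X (skewInverse X) := by
  rw [skewInverse, dif_pos h]
  exact h.choose_spec

/-- `C_X = Tr_(1) (Ψ_X)_12`. -/
noncomputable def matC {N : ℕ} (X : Op N 2 ℂ) : Matrix (Fin N) (Fin N) ℂ :=
  Matrix.of fun i j => ∑ s, skewInverse X ![s, i] ![s, j]

/-- `D_X = Tr_(2) (Ψ_X)_12`. -/
noncomputable def matD {N : ℕ} (X : Op N 2 ℂ) : Matrix (Fin N) (Fin N) ℂ :=
  Matrix.of fun i j => ∑ s, skewInverse X ![i, s] ![j, s]

/-- Strict skew invertible operators. -/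
def StrictSkewInvertible {N : ℕ} (X : Op N 2 ℂ) : Prop :=
  SkewInvertible X ∧ (IsUnit (matC X) ∨ IsUnit (matD X))

/-- The element `κ = (q - σ)(q⁻¹ + σ) / (μ (q - q⁻¹))` made from an element `σ` of an algebra. -/
noncomputable def kappaOf {A : Type*} [Ring A] [Algebra ℂ A] (q μ : ℂ) (σ : A) : A :=
  (μ * (q - q⁻¹))⁻¹ • ((q • 1 - σ) * (q⁻¹ • 1 + σ))

theorem map_kappaOf {A B : Type*} [Ring A] [Algebra ℂ A] [Ring B] [Algebra ℂ B] (f : A →ₐ[ℂ] B)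
    (q μ : ℂ) (σ : A) : f (kappaOf q μ σ) = kappaOf q μ (f σ) := by
  simp [kappaOf]

/-- The domain of the parameters `q`, `μ` of the BMW algebras. -/
def AdmissibleParameters (q μ : ℂ) : Prop :=
  q ≠ 0 ∧ q ≠ 1 ∧ q ≠ -1 ∧ μ ≠ 0 ∧ μ ≠ q ∧ μ ≠ -q⁻¹

open Polynomial in
/-- R-matrices of BMW type with the parameters `q` and `μ`: the minimal polynomial is
`(x - q)(x + q⁻¹)(x - μ)`, and the operator `K = (q - R)(q⁻¹ + R) / (μ (q - q⁻¹))` satisfies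
`K₂ K₁ = R₁ R₂ K₁ = R₁⁻¹ R₂⁻¹ K₁` and `K₁ K₂ K₁ = K₁`. -/
structure IsBMWType {N : ℕ} (R : Op N 2 ℂ) (q μ : ℂ) : Prop where
  isRMatrix : IsRMatrix R
  admissible : AdmissibleParameters q μ
  minpoly_eq : minpoly ℂ R = (X - C q) * (X + C q⁻¹) * (X - C μ)
  kk : site 3 1 (kappaOf q μ R) * site 3 0 (kappaOf q μ R) =
    site 3 0 R * site 3 1 R * site 3 0 (kappaOf q μ R)
  kk_inv : site 3 1 (kappaOf q μ R) * site 3 0 (kappaOf q μ R) =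
    site 3 0 R⁻¹ * site 3 1 R⁻¹ * site 3 0 (kappaOf q μ R)
  kkk : site 3 0 (kappaOf q μ R) * site 3 1 (kappaOf q μ R) * site 3 0 (kappaOf q μ R) =
    site 3 0 (kappaOf q μ R)

/-! ### Braid groups and Birman-Murakami-Wenzl algebras -/

/-- The defining relations of the braid group on `n` strands. -/
def braidRels (n : ℕ) : Set (FreeGroup (Fin (n - 1))) :=
  {r | (∃ i j : Fin (n - 1), (i : ℕ) + 1 = j ∧
        r = .of i * .of j * .of i * (.of j * .of i * .of j)⁻¹) ∨
      (∃ i j : Fin (n - 1), (i : ℕ) + 1 < j ∧ r = .of i * .of j * (.of j * .of i)⁻¹)}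

/-- The braid group on `n` strands. -/
abbrev BraidGroup (n : ℕ) := PresentedGroup (braidRels n)

/-- The defining relations of the BMW algebra, as a quotient of the group algebra of the
braid group. -/
inductive BMWRel (q μ : ℂ) (n : ℕ) :
    MonoidAlgebra ℂ (BraidGroup n) → MonoidAlgebra ℂ (BraidGroup n) → Prop
  | sigma_kappa (i : Fin (n - 1)) : BMWRel q μ n
      (.of ℂ _ (.of i) * kappaOf q μ (.of ℂ _ (.of i))) (μ • kappaOf q μ (.of ℂ _ (.of i)))
  | kappa_sigma (i : Fin (n - 1)) : BMWRel q μ n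
      (kappaOf q μ (.of ℂ _ (.of i)) * .of ℂ _ (.of i)) (μ • kappaOf q μ (.of ℂ _ (.of i)))
  | kappa_sigma_kappa (i j : Fin (n - 1)) (h : (i : ℕ) + 1 = j) : BMWRel q μ n
      (kappaOf q μ (.of ℂ _ (.of i)) * .of ℂ _ (.of j) * kappaOf q μ (.of ℂ _ (.of i)))
      (μ⁻¹ • kappaOf q μ (.of ℂ _ (.of i)))
  | kappa_sigma_inv_kappa (i j : Fin (n - 1)) (h : (i : ℕ) + 1 = j) : BMWRel q μ n
      (kappaOf q μ (.of ℂ _ (.of i)) * .of ℂ _ (.of j)⁻¹ * kappaOf q μ (.of ℂ _ (.of i)))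
      (μ • kappaOf q μ (.of ℂ _ (.of i)))

/-- The BMW algebra `W_n(q, μ)`. -/
abbrev BMW (q μ : ℂ) (n : ℕ) := RingQuot (BMWRel q μ n)

/-- The image of an element of the braid group in the BMW algebra. -/
noncomputable def ofBraid (q μ : ℂ) (n : ℕ) (β : BraidGroup n) : BMW q μ n :=
  RingQuot.mkAlgHom ℂ (BMWRel q μ n) (.of ℂ _ β)

/-- The braid generator with the number `i` (`1` if there is no such generator). -/
def gen (n i : ℕ) : BraidGroup n :=
  if h : i < n - 1 then PresentedGroup.of ⟨i, h⟩ else 1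

/-- The generator `σ` of the BMW algebra with the number `i`. -/
noncomputable def bmwGen (q μ : ℂ) (n i : ℕ) : BMW q μ n := ofBraid q μ n (gen n i)

/-- The `q`-number `j_q = (q^j - q^{-j}) / (q - q⁻¹)`. -/
noncomputable def qNum (q : ℂ) (j : ℕ) : ℂ := (q ^ j - (q ^ j)⁻¹) / (q - q⁻¹)

/-- The baxterized element `1 + (x - 1)/(q - q⁻¹) σ + (x - 1)/(α x + 1) κ` made from an
element `σ` of an algebra. -/
noncomputable def baxterized {A : Type*} [Ring A] [Algebra ℂ A] (q μ α : ℂ) (σ : A) (x : ℂ) : A :=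
  1 + ((x - 1) / (q - q⁻¹)) • σ + ((x - 1) / (α * x + 1)) • kappaOf q μ σ

/-- The antisymmetrizers `a^{(i)}`, `i = 1, …, n`, in `W_n(q, μ)`:
`a^{(1)} = 1` and `a^{(i+1)} = q^i / (i+1)_q a^{(i)} σ_i^-(q^{-2i}) a^{(i)}`, where `σ^-` is the
baxterized element with `α = q μ⁻¹` (the value at `i = 0` is not used). -/
noncomputable def antisymmetrizer (q μ : ℂ) (n : ℕ) : ℕ → BMW q μ n
  | 0 => 1
  | 1 => 1
  | i + 2 => (q ^ (i + 1) / qNum q (i + 2)) •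
      (antisymmetrizer q μ n (i + 1) *
        baxterized q μ (q * μ⁻¹) (bmwGen q μ n i) (q ^ (2 * (i + 1)))⁻¹ *
        antisymmetrizer q μ n (i + 1))

/-- The symmetrizers `s^{(i)}`, `i = 1, …, n`, in `W_n(q, μ)`:
`s^{(1)} = 1` and `s^{(i+1)} = q^{-i} / (i+1)_q s^{(i)} σ_i^+(q^{2i}) s^{(i)}`, where `σ^+` is the
baxterized element with `α = - q⁻¹ μ⁻¹` (the value at `i = 0` is not used). -/
noncomputable def symmetrizer (q μ : ℂ) (n : ℕ) : ℕ → BMW q μ n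
  | 0 => 1
  | 1 => 1
  | i + 2 => ((q ^ (i + 1))⁻¹ / qNum q (i + 2)) •
      (symmetrizer q μ n (i + 1) *
        baxterized q μ (-(q⁻¹ * μ⁻¹)) (bmwGen q μ n i) (q ^ (2 * (i + 1))) *
        symmetrizer q μ n (i + 1))

/-- `η = (q - μ)(q⁻¹ + μ) / (μ (q - q⁻¹))`. -/
noncomputable def eta (q μ : ℂ) : ℂ := (q - μ) * (q⁻¹ + μ) / (μ * (q - q⁻¹))

/-- The second order contractor `c^{(2)} = η⁻¹ κ_1` in `W_2(q, μ)`. -/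
noncomputable def contractor (q μ : ℂ) : BMW q μ 2 :=
  (eta q μ)⁻¹ • kappaOf q μ (bmwGen q μ 2 0)

/-! ### Representations defined by R-matrices -/

theorem site_eq {N n m : ℕ} (h : m + 1 < n) (X : Op N 2 ℂ) :
    site n m X = place ![⟨m, by omega⟩, ⟨m + 1, h⟩] X := dif_pos h

theorem pair_injective {n m : ℕ} (h : m + 1 < n) :
    Function.Injective (![⟨m, by omega⟩, ⟨m + 1, h⟩] : Fin 2 → Fin n) := by
  intro i j
  fin_cases i <;> fin_cases j <;> simp

theorem site_mul {N : ℕ} (n m : ℕ) (X Y : Op N 2 ℂ) :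
    site n m (X * Y) = site n m X * site n m Y := by
  by_cases h : m + 1 < n
  · simp only [site_eq h, place_mul _ (pair_injective h)]
  · simp [site, h]

theorem site_one {N : ℕ} (n m : ℕ) : site n m (1 : Op N 2 ℂ) = 1 := by
  by_cases h : m + 1 < n
  · rw [site_eq h, place_one]
  · simp [site, h]

theorem site_inv_mul {N : ℕ} {R : Op N 2 ℂ} (hR : IsUnit R) (n m : ℕ) :
    site n m R⁻¹ * site n m R = 1 := by
  rw [← site_mul, Matrix.nonsing_inv_mul _ ((Matrix.isUnit_iff_isUnit_det R).1 hR), site_one]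

theorem site_mul_inv {N : ℕ} {R : Op N 2 ℂ} (hR : IsUnit R) (n m : ℕ) :
    site n m R * site n m R⁻¹ = 1 := by
  rw [← site_mul, Matrix.mul_nonsing_inv _ ((Matrix.isUnit_iff_isUnit_det R).1 hR), site_one]

/-- Three consecutive tensor factors. -/
def triple {n m : ℕ} (h : m + 2 < n) : Fin 3 → Fin n :=
  ![⟨m, by omega⟩, ⟨m + 1, by omega⟩, ⟨m + 2, h⟩]

theorem triple_injective {n m : ℕ} (h : m + 2 < n) : Function.Injective (triple h) := by
  intro i j
  fin_cases i <;> fin_cases j <;> simp [triple]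

theorem place_triple_zero {N n m : ℕ} (h : m + 2 < n) (X : Op N 2 ℂ) :
    place (triple h) (site 3 0 X) = site n m X := by
  rw [site_eq (by omega : 0 + 1 < 3), site_eq (by omega : m + 1 < n),
    place_place _ (triple_injective h)]
  congr 1
  funext i
  fin_cases i <;> simp [triple]

theorem place_triple_one {N n m : ℕ} (h : m + 2 < n) (X : Op N 2 ℂ) :
    place (triple h) (site 3 1 X) = site n (m + 1) X := by
  rw [site_eq (by omega : 1 + 1 < 3), site_eq (by omega : m + 1 + 1 < n),
    place_place _ (triple_injective h)]
  congr 1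
  funext i
  fin_cases i <;> simp [triple]

theorem site_braid {N : ℕ} {R : Op N 2 ℂ} (hR : IsRMatrix R) {n m : ℕ} (h : m + 2 < n) :
    site n m R * site n (m + 1) R * site n m R =
      site n (m + 1) R * site n m R * site n (m + 1) R := by
  have := congrArg (place (triple h)) hR.ybe
  simpa only [place_mul _ (triple_injective h), place_triple_zero, place_triple_one] using this

theorem site_commute {N : ℕ} (X Y : Op N 2 ℂ) {n m l : ℕ} (h : m + 1 < l) (hl : l + 1 < n) :
    site n m X * site n l Y = site n l Y * site n m X := by
  rw [site_eq hl, site_eq (by omega : m + 1 < n)]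
  apply place_commute
  intro i j
  fin_cases i <;> fin_cases j <;> simp <;> omega

/-- The invertible operator `R_m`. -/
noncomputable def siteUnit {N : ℕ} {R : Op N 2 ℂ} (hR : IsRMatrix R) (n m : ℕ) : (Op N n ℂ)ˣ where
  val := site n m R
  inv := site n m R⁻¹
  val_inv := site_mul_inv hR.isUnit n m
  inv_val := site_inv_mul hR.isUnit n m

/-- The representation of the braid group defined by an R-matrix: `σ_i ↦ R_i`. -/
noncomputable def braidRep {N : ℕ} {R : Op N 2 ℂ} (hR : IsRMatrix R) (n : ℕ) :
    BraidGroup n →* (Op N n ℂ)ˣ :=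
  PresentedGroup.toGroup (f := fun i : Fin (n - 1) => siteUnit hR n i) (by
    rintro r (⟨i, j, hij, rfl⟩ | ⟨i, j, hij, rfl⟩)
    · simp only [map_mul, map_inv, FreeGroup.lift_apply_of, mul_inv_eq_one]
      ext1
      simp only [Units.val_mul, siteUnit, ← hij]
      exact site_braid hR (by omega)
    · simp only [map_mul, map_inv, FreeGroup.lift_apply_of, mul_inv_eq_one]
      ext1
      simp only [Units.val_mul, siteUnit]
      exact site_commute R R hij (by omega))

theorem braidRep_of {N : ℕ} {R : Op N 2 ℂ} (hR : IsRMatrix R) (n : ℕ) (i : Fin (n - 1)) :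
    ((braidRep hR n (.of i) : (Op N n ℂ)ˣ) : Op N n ℂ) = site n i R := by
  rw [braidRep, PresentedGroup.toGroup.of]
  rfl

theorem braidRep_of_inv {N : ℕ} {R : Op N 2 ℂ} (hR : IsRMatrix R) (n : ℕ) (i : Fin (n - 1)) :
    ((braidRep hR n (.of i)⁻¹ : (Op N n ℂ)ˣ) : Op N n ℂ) = site n i R⁻¹ := by
  rw [map_inv, braidRep, PresentedGroup.toGroup.of]
  rfl

/-- The linear extension of `braidRep` to the group algebra. -/
noncomputable def groupAlgebraRep {N : ℕ} {R : Op N 2 ℂ} (hR : IsRMatrix R) (n : ℕ) :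
    MonoidAlgebra ℂ (BraidGroup n) →ₐ[ℂ] Op N n ℂ :=
  MonoidAlgebra.lift ℂ (Op N n ℂ) (BraidGroup n) ((Units.coeHom _).comp (braidRep hR n))

theorem groupAlgebraRep_of {N : ℕ} {R : Op N 2 ℂ} (hR : IsRMatrix R) (n : ℕ) (β : BraidGroup n) :
    groupAlgebraRep hR n (.of ℂ _ β) = ((braidRep hR n β : (Op N n ℂ)ˣ) : Op N n ℂ) := by
  simp [groupAlgebraRep]

theorem site_kappaOf {N n m : ℕ} (h : m + 1 < n) (q μ : ℂ) (R : Op N 2 ℂ) :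
    kappaOf q μ (site n m R) = site n m (kappaOf q μ R) := by
  rw [site_eq h, site_eq h]
  exact (map_kappaOf (placeHom _ (pair_injective h)) q μ R).symm

theorem IsBMWType.mul_kappa {N : ℕ} {R : Op N 2 ℂ} {q μ : ℂ} (h : IsBMWType R q μ) :
    R * kappaOf q μ R = μ • kappaOf q μ R := by
  have h1 := minpoly.aeval ℂ R
  rw [h.minpoly_eq] at h1
  simp only [map_mul, map_sub, map_add, Polynomial.aeval_X, Polynomial.aeval_C,
    Algebra.algebraMap_eq_smul_one] at h1
  have h2 : (R - μ • 1) * ((q • 1 - R) * (q⁻¹ • 1 + R)) = 0 := by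
    have : (R - μ • (1 : Op N 2 ℂ)) * ((q • 1 - R) * (q⁻¹ • 1 + R)) =
        -((R - q • 1) * (R + q⁻¹ • 1) * (R - μ • 1)) := by
      simp only [sub_mul, mul_sub, add_mul, mul_add, smul_mul_assoc, mul_smul_comm, one_mul,
        mul_one, mul_assoc]
      module
    rw [this, h1, neg_zero]
  rw [← sub_eq_zero, kappaOf, mul_smul_comm, smul_comm μ, ← smul_sub]
  rw [sub_mul, smul_mul_assoc, one_mul] at h2
  rw [h2, smul_zero]

theorem kappaOf_commute {A : Type*} [Ring A] [Algebra ℂ A] (q μ : ℂ) (σ : A) :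
    kappaOf q μ σ * σ = σ * kappaOf q μ σ := by
  simp only [kappaOf, smul_mul_assoc, mul_smul_comm]
  congr 1
  simp only [sub_mul, mul_sub, add_mul, mul_add, smul_mul_assoc, mul_smul_comm, one_mul,
    mul_one, mul_assoc]

theorem IsBMWType.kappa_mul_kappa {N : ℕ} {R : Op N 2 ℂ} {q μ : ℂ} (h : IsBMWType R q μ) :
    site 3 0 (kappaOf q μ R) * site 3 1 R * site 3 0 (kappaOf q μ R) =
      μ⁻¹ • site 3 0 (kappaOf q μ R) := by
  have hμ : μ ≠ 0 := h.admissible.2.2.2.1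
  have h1 : site 3 0 (kappaOf q μ R) * site 3 0 R = μ • site 3 0 (kappaOf q μ R) := by
    rw [← site_mul, kappaOf_commute, h.mul_kappa, site_eq (by omega), site_eq (by omega)]
    exact map_smul (placeHom _ (pair_injective (by omega))) _ _
  have h2 := h.kkk
  rw [mul_assoc, h.kk, ← mul_assoc, ← mul_assoc, h1, smul_mul_assoc, smul_mul_assoc] at h2
  rw [eq_inv_smul_iff₀ hμ, h2]

theorem IsBMWType.kappa_inv_mul_kappa {N : ℕ} {R : Op N 2 ℂ} {q μ : ℂ} (h : IsBMWType R q μ) :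
    site 3 0 (kappaOf q μ R) * site 3 1 R⁻¹ * site 3 0 (kappaOf q μ R) =
      μ • site 3 0 (kappaOf q μ R) := by
  have hμ : μ ≠ 0 := h.admissible.2.2.2.1
  have h0 : site 3 0 (kappaOf q μ R) * site 3 0 R = μ • site 3 0 (kappaOf q μ R) := by
    rw [← site_mul, kappaOf_commute, h.mul_kappa, site_eq (by omega), site_eq (by omega)]
    exact map_smul (placeHom _ (pair_injective (by omega))) _ _
  have h1 : μ • (site 3 0 (kappaOf q μ R) * site 3 0 R⁻¹) = site 3 0 (kappaOf q μ R) := by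
    rw [← smul_mul_assoc, ← h0, mul_assoc, site_mul_inv h.isRMatrix.isUnit, mul_one]
  have h2 := h.kkk
  rw [mul_assoc, h.kk_inv, ← mul_assoc, ← mul_assoc] at h2
  conv_rhs => rw [← h2]
  rw [← smul_mul_assoc, ← smul_mul_assoc, h1]

/-- The representation `ρ_R : W_n(q, μ) → End(V^{⊗ n})` defined by an R-matrix of BMW type. -/
noncomputable def bmwRep {N : ℕ} {R : Op N 2 ℂ} {q μ : ℂ} (h : IsBMWType R q μ) (n : ℕ) :
    BMW q μ n →ₐ[ℂ] Op N n ℂ :=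
  RingQuot.liftAlgHom ℂ ⟨groupAlgebraRep h.isRMatrix n, by
    have hs : ∀ (i : Fin (n - 1)), site n i R * site n i (kappaOf q μ R) =
        μ • site n i (kappaOf q μ R) := fun i => by
      have hi : (i : ℕ) + 1 < n := by omega
      rw [← site_mul, h.mul_kappa, site_eq hi, site_eq hi]
      exact map_smul (placeHom _ (pair_injective hi)) _ _
    intro x y hxy
    cases hxy with
    | sigma_kappa i =>
      rw [map_mul, map_smul, map_kappaOf, groupAlgebraRep_of, braidRep_of,
        site_kappaOf (by omega), hs]
    | kappa_sigma i =>
      rw [kappaOf_commute, map_mul, map_smul, map_kappaOf, groupAlgebraRep_of, braidRep_of,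
        site_kappaOf (by omega), hs]
    | kappa_sigma_kappa i j hij =>
      have hi : (i : ℕ) + 2 < n := by omega
      rw [map_mul, map_mul, map_smul, map_kappaOf, groupAlgebraRep_of, groupAlgebraRep_of,
        braidRep_of, braidRep_of, site_kappaOf (by omega), ← hij]
      have := congrArg (placeHom (triple hi) (triple_injective hi)) h.kappa_mul_kappa
      simpa only [map_mul, map_smul, placeHom_apply, place_triple_zero, place_triple_one] using this
    | kappa_sigma_inv_kappa i j hij =>
      have hi : (i : ℕ) + 2 < n := by omega
      rw [map_mul, map_mul, map_smul, map_kappaOf, groupAlgebraRep_of, groupAlgebraRep_of,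
        braidRep_of, braidRep_of_inv, site_kappaOf (by omega), ← hij]
      have := congrArg (placeHom (triple hi) (triple_injective hi)) h.kappa_inv_mul_kappa
      simpa only [map_mul, map_smul, placeHom_apply, place_triple_zero, place_triple_one]
        using this⟩

theorem bmwRep_ofBraid {N : ℕ} {R : Op N 2 ℂ} {q μ : ℂ} (h : IsBMWType R q μ) (n : ℕ)
    (β : BraidGroup n) :
    bmwRep h n (ofBraid q μ n β) = ((braidRep h.isRMatrix n β : (Op N n ℂ)ˣ) : Op N n ℂ) := by
  rw [bmwRep, ofBraid, RingQuot.liftAlgHom_mkAlgHom_apply, groupAlgebraRep_of]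

/-! ### Quantum matrix algebras -/

/-- The copies of a matrix `M` on `V^{⊗ n}`, numbered from `0`: the initial one is `M_1`, and the
next ones are obtained by successive conjugation with `F_1, F_2, …`. -/
noncomputable def copy {N : ℕ} {A : Type*} [Ring A] [Algebra ℂ A] (F : Op N 2 ℂ)
    (M : Matrix (Fin N) (Fin N) A) (n : ℕ) : ℕ → Op N n A
  | 0 => siteOne n M
  | k + 1 => scal A (site n k F) * copy F M n k * scal A (site n k F⁻¹)

/-- The matrix of the generators of the free algebra on `N²` generators. -/
def freeMatrix (N : ℕ) : Matrix (Fin N) (Fin N) (FreeAlgebra ℂ (Fin N × Fin N)) :=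
  Matrix.of fun i j => FreeAlgebra.ι ℂ (i, j)

/-- The defining relations of the quantum matrix algebra `M(R, F)`: the entries of the matrix
relation `R_1 M_{\bar 1} M_{\bar 2} = M_{\bar 1} M_{\bar 2} R_1`. -/
inductive QMRel {N : ℕ} (R F : Op N 2 ℂ) :
    FreeAlgebra ℂ (Fin N × Fin N) → FreeAlgebra ℂ (Fin N × Fin N) → Prop
  | entry (a b : Fin 2 → Fin N) : QMRel R F
      ((scal (FreeAlgebra ℂ (Fin N × Fin N)) R *
        (copy F (freeMatrix N) 2 0 * copy F (freeMatrix N) 2 1)) a b)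
      ((copy F (freeMatrix N) 2 0 * copy F (freeMatrix N) 2 1 *
        scal (FreeAlgebra ℂ (Fin N × Fin N)) R) a b)

/-- The quantum matrix algebra `M(R, F)`. -/
abbrev QMA {N : ℕ} (R F : Op N 2 ℂ) := RingQuot (QMRel R F)

/-- The matrix `M` of the generators of `M(R, F)`. -/
noncomputable def genMatrix {N : ℕ} (R F : Op N 2 ℂ) : Matrix (Fin N) (Fin N) (QMA R F) :=
  Matrix.of fun i j => RingQuot.mkAlgHom ℂ (QMRel R F) (FreeAlgebra.ι ℂ (i, j))

/-- `M_{\bar 1} M_{\bar 2} ⋯ M_{\bar n}` on `V^{⊗ n}`. -/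
noncomputable def stringM {N : ℕ} (R F : Op N 2 ℂ) (n : ℕ) : Op N n (QMA R F) :=
  ((List.range n).map (copy F (genMatrix R F) n)).prod

/-- The R-trace over all the tensor factors: `Tr_{R (1,…,n)} X = Tr_{(1,…,n)} (D_1 ⋯ D_n X)`
with `D = D_R`. -/
noncomputable def rTrace {N n : ℕ} {A : Type*} [Ring A] [Algebra ℂ A] (R : Op N 2 ℂ)
    (X : Op N n A) : A :=
  ∑ a, ∑ b, (∏ k, matD R (a k) (b k)) • X b a

/-- `Tr_{R (1,…,n)} (M_{\bar 1} ⋯ M_{\bar n} Y)` for an operator `Y` on `V^{⊗ n}`. -/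
noncomputable def chOp {N n : ℕ} (R F : Op N 2 ℂ) (Y : Op N n ℂ) : QMA R F :=
  rTrace R (stringM R F n * scal _ Y)

/-- `ch(α) = Tr_{R (1,…,n)} (M_{\bar 1} ⋯ M_{\bar n} ρ_R(α))`, for `α ∈ W_n(q, μ)`. -/
noncomputable def ch {N : ℕ} {R : Op N 2 ℂ} {q μ : ℂ} (h : IsBMWType R q μ) (F : Op N 2 ℂ) {n : ℕ}
    (α : BMW q μ n) : QMA R F :=
  chOp R F (bmwRep h n α)

/-- The underlying space of the characteristic subalgebra `C(R, F)`: the linear span of `1` and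
of all `ch(β)`, `β` an element of the braid group on `n ≥ 1` strands. -/
noncomputable def charSubspace {N : ℕ} {R : Op N 2 ℂ} (hR : IsRMatrix R) (F : Op N 2 ℂ) :
    Submodule ℂ (QMA R F) :=
  Submodule.span ℂ ({1} ∪ {x | ∃ n : ℕ, 1 ≤ n ∧ ∃ β : BraidGroup n,
    x = chOp R F ((braidRep hR n β : (Op N n ℂ)ˣ) : Op N n ℂ)})

/-- The power sums: `p_0 = Tr_R I`, `p_1 = Tr_R M`, and `p_i = ch(σ_{i-1} ⋯ σ_2 σ_1)`. -/
noncomputable def powerSum {N : ℕ} {R : Op N 2 ℂ} {q μ : ℂ} (h : IsBMWType R q μ)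
    (F : Op N 2 ℂ) : ℕ → QMA R F
  | 0 => algebraMap ℂ _ (matD R).trace
  | i + 1 => ch h F (((List.range i).reverse.map (bmwGen q μ (i + 1))).prod)

/-- `a_0 = 1` and `a_i = ch(a^{(i)})`. -/
noncomputable def elemA {N : ℕ} {R : Op N 2 ℂ} {q μ : ℂ} (h : IsBMWType R q μ)
    (F : Op N 2 ℂ) : ℕ → QMA R F
  | 0 => 1
  | i + 1 => ch h F (antisymmetrizer q μ (i + 1) (i + 1))

/-- `s_0 = 1` and `s_i = ch(s^{(i)})`. -/
noncomputable def elemS {N : ℕ} {R : Op N 2 ℂ} {q μ : ℂ} (h : IsBMWType R q μ)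
    (F : Op N 2 ℂ) : ℕ → QMA R F
  | 0 => 1
  | i + 1 => ch h F (symmetrizer q μ (i + 1) (i + 1))

/-- The 2-contraction `g = ch(c^{(2)})`. -/
noncomputable def contraction {N : ℕ} {R : Op N 2 ℂ} {q μ : ℂ} (h : IsBMWType R q μ)
    (F : Op N 2 ℂ) : QMA R F :=
  ch h F (contractor q μ)

/-- The conditions on the parameters under which `a^{(1)}, …, a^{(n)}` are defined. -/
def CondA (q μ : ℂ) (n : ℕ) : Prop :=
  ∀ j : ℕ, 2 ≤ j → j ≤ n → qNum q j ≠ 0 ∧ μ ≠ -q ^ (3 - 2 * (j : ℤ))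

/-- The conditions on the parameters under which `s^{(1)}, …, s^{(n)}` are defined. -/
def CondS (q μ : ℂ) (n : ℕ) : Prop :=
  ∀ j : ℕ, 2 ≤ j → j ≤ n → qNum q j ≠ 0 ∧ μ ≠ q ^ (2 * (j : ℤ) - 3)

end QuantumMatrix

/-! The characteristic map ch is a trace on the algebra generated by the R_i and is multiplicative
for operators on disjoint groups of strands. These two facts turn all three identities into
computations with BMW relations.

Trace property. R_i commutes with the product of the copies of M, by the defining relation of M(R,F)
and the twist relations, and with D_1 ⋯ D_n (`commute_tensorD`). Hence ch(XY) = ch(YX) for Y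
generated by the R_i (`chLin_mul_comm`). Multiplicativity. Conjugation by F_n ⋯ F_{n+k-1} shifts
copies and R-matrices by one place, while the D-weighted trace of F_12 Y_1 F_12⁻¹ over the second
factor is Tr(YD) times the identity (`sum_twist_matD`). So the last k strands split off as a factor
of ch (`chLin_liftOp_mul`). `IsCharTower` records what the rest of the proof uses.

Antisymmetrizers are idempotents which absorb every generator with the scalar -q⁻¹
(`antisymOf_mul`); the fusion identity `antisymmetric_mul_baxterized_mul` carries the induction. The
substitution q ↦ -q⁻¹ fixes κ and exchanges symmetrizers with antisymmetrizers, so the second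
relation follows from the first.

Newton. Put E_i = a_i p_{n-i} and U_i = ch(a^{(i+1)} R_{n-2} ⋯ R_i), and let V_i be U_i with R_i
replaced by κ_i. Expanding the recursion of a^{(i+2)} under ch links E_{i+1}, U_{i+1}, U_i, V_i
(`newton_step`). The alternating sum of the E_i telescopes to n_q a_n up to sign, plus a weighted
sum of the V_i. A contraction inside ch removes two strands and produces g, so the V_i of level m +
2 are combinations of E, U, V of level m times g. With the weights of `newtonT` this telescopes
again: passing from m to m + 2 multiplies the contraction sum by g and adds one multiple of a_m g
(`newton_contraction_step`).

Wronski. Let H_i be ch of an antisymmetrizer and a symmetrizer overlapping in the single factor i.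
Opening either one expresses H by a product a_{i+1} s_{n-i-1}, a term P_i with R_i and a term Q_i
with κ_i. Eliminating P_i makes the alternating sum telescope to a weighted sum of the Q_i. Removing
a contraction multiplies this sum by g and by a scalar proportional to q² - q^{2m-2} when m grows to
m + 2 (`wronskiSum_step`). The scalar vanishes at m = 2 and the sum is empty for n = 1, so only n =
2 leaves a contribution, namely -g.

Membership in C(R,F) holds because braids span the BMW algebra. -/

namespace QuantumMatrix

/-! ### Skein relations and pairs of adjacent BMW generators -/

section Skein

variable {B : Type*} [Ring B] [Algebra ℂ B] {q μ : ℂ}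

/-- The substitution q ↦ -q⁻¹ fixes q - q⁻¹ and exchanges the two commuting factors q - σ and q⁻¹ +
σ up to two signs that cancel. This symmetry transfers every result on antisymmetrizers to
symmetrizers. -/
theorem kappaOf_neg_inv (σ : B) : kappaOf (-q⁻¹) μ σ = kappaOf q μ σ := by
  have h : -q⁻¹ - (-q⁻¹)⁻¹ = q - q⁻¹ := by rw [inv_neg, inv_inv]; ring
  rw [kappaOf, kappaOf, h, inv_neg, inv_inv]
  congr 1
  simp only [sub_mul, mul_add, smul_mul_assoc, mul_smul_comm, one_mul, mul_one, neg_smul, neg_mul,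
    mul_neg]
  module

theorem smul_kappaOf (hq : q ≠ 0) (hl : q - q⁻¹ ≠ 0) (hμ : μ ≠ 0) (σ : B) :
    (μ * (q - q⁻¹)) • kappaOf q μ σ = 1 + (q - q⁻¹) • σ - σ * σ := by
  rw [kappaOf, smul_inv_smul₀ (mul_ne_zero hμ hl)]
  simp only [sub_mul, mul_add, smul_mul_assoc, mul_smul_comm, one_mul, mul_one]
  match_scalars <;> field_simp
  ring

theorem sq_eq_kappaOf (hq : q ≠ 0) (hl : q - q⁻¹ ≠ 0) (hμ : μ ≠ 0) (σ : B) :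
    σ * σ = 1 + (q - q⁻¹) • σ - (μ * (q - q⁻¹)) • kappaOf q μ σ := by
  rw [smul_kappaOf hq hl hμ]; abel

/-- The inverse of a generator, expressed by the skein relation. -/
noncomputable def skeinInv (q μ : ℂ) (σ : B) : B :=
  σ - (q - q⁻¹) • 1 + (q - q⁻¹) • kappaOf q μ σ

theorem mul_skeinInv (hq : q ≠ 0) (hl : q - q⁻¹ ≠ 0) (hμ : μ ≠ 0) {σ : B}
    (h : σ * kappaOf q μ σ = μ • kappaOf q μ σ) : σ * skeinInv q μ σ = 1 := by
  rw [skeinInv, mul_add, mul_sub, mul_smul_comm, mul_smul_comm, h, mul_one,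
    sq_eq_kappaOf hq hl hμ]
  module

theorem skeinInv_mul (hq : q ≠ 0) (hl : q - q⁻¹ ≠ 0) (hμ : μ ≠ 0) {σ : B}
    (h : σ * kappaOf q μ σ = μ • kappaOf q μ σ) : skeinInv q μ σ * σ = 1 := by
  rw [← mul_skeinInv hq hl hμ h, skeinInv]
  simp only [add_mul, sub_mul, mul_add, mul_sub, smul_mul_assoc, mul_smul_comm, one_mul, mul_one,
    kappaOf_commute]

theorem kappaOf_mul_self (hq : q ≠ 0) (hl : q - q⁻¹ ≠ 0) (hμ : μ ≠ 0) {σ : B}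
    (h : σ * kappaOf q μ σ = μ • kappaOf q μ σ) :
    kappaOf q μ σ * kappaOf q μ σ = eta q μ • kappaOf q μ σ := by
  have h1 : (μ * (q - q⁻¹)) • (kappaOf q μ σ * kappaOf q μ σ) =
      (1 + (q - q⁻¹) * μ - μ * μ) • kappaOf q μ σ := by
    rw [← smul_mul_assoc, smul_kappaOf hq hl hμ]
    simp only [sub_mul, add_mul, smul_mul_assoc, one_mul, mul_assoc, h, mul_smul_comm, smul_smul]
    module
  have h2 : 1 + (q - q⁻¹) * μ - μ * μ = (μ * (q - q⁻¹)) * eta q μ := by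
    rw [eta, mul_div_cancel₀ _ (mul_ne_zero hμ hl)]
    linear_combination -(mul_inv_cancel₀ hq)
  rw [h2, mul_smul _ (eta q μ)] at h1
  exact (smul_right_injective B (mul_ne_zero hμ hl) :) h1

/-- The relations of the Birman-Murakami-Wenzl algebra which relate a pair of adjacent
generators. -/
structure IsBMWPair (q μ : ℂ) (x y : B) : Prop where
  braid : x * y * x = y * x * y
  kk : kappaOf q μ y * kappaOf q μ x = x * y * kappaOf q μ x
  kk_swap : kappaOf q μ x * kappaOf q μ y = y * x * kappaOf q μ y
  kk_right : kappaOf q μ x * kappaOf q μ y = kappaOf q μ x * y * x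
  kk_right_swap : kappaOf q μ y * kappaOf q μ x = kappaOf q μ y * x * y
  kkk : kappaOf q μ x * kappaOf q μ y * kappaOf q μ x = kappaOf q μ x
  kkk_swap : kappaOf q μ y * kappaOf q μ x * kappaOf q μ y = kappaOf q μ y

theorem IsBMWPair.symm {x y : B} (h : IsBMWPair q μ x y) : IsBMWPair q μ y x :=
  ⟨h.braid.symm, h.kk_swap, h.kk, h.kk_right_swap, h.kk_right, h.kkk_swap, h.kkk⟩

theorem op_kappaOf (σ : B) :
    MulOpposite.op (kappaOf q μ σ) = kappaOf q μ (MulOpposite.op σ) := by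
  simp only [kappaOf, MulOpposite.op_smul, MulOpposite.op_mul]
  congr 1
  simp only [MulOpposite.op_add, MulOpposite.op_sub, MulOpposite.op_smul, MulOpposite.op_one]
  simp only [sub_mul, mul_sub, add_mul, mul_add, smul_mul_assoc, mul_smul_comm, one_mul, mul_one]
  module

/-- The list of relations is closed under reversal of products, so a statement about right
multiplication gives its left analogue in the opposite algebra. -/
theorem IsBMWPair.op {x y : B} (h : IsBMWPair q μ x y) :
    IsBMWPair q μ (MulOpposite.op x) (MulOpposite.op y) := by
  constructor <;> simp only [← op_kappaOf, ← MulOpposite.op_mul, ← mul_assoc]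
  · rw [h.braid]
  · rw [h.kk_right]
  · rw [h.kk_right_swap]
  · rw [h.kk]
  · rw [h.kk_swap]
  · rw [h.kkk]
  · rw [h.kkk_swap]

/-- The relations of the Birman-Murakami-Wenzl algebra with `k` generators
`σ 0, …, σ (k - 1)`. -/
structure IsBMWFamily (q μ : ℂ) (k : ℕ) (σ : ℕ → B) : Prop where
  cubic : ∀ i < k, σ i * kappaOf q μ (σ i) = μ • kappaOf q μ (σ i)
  pair : ∀ i, i + 1 < k → IsBMWPair q μ (σ i) (σ (i + 1))
  comm : ∀ i j, i + 1 < j → j < k → σ i * σ j = σ j * σ i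

namespace IsBMWFamily

variable {k : ℕ} {σ : ℕ → B}

theorem shift (h : IsBMWFamily q μ k σ) {i l : ℕ} (hl : i + l ≤ k) :
    IsBMWFamily q μ l fun j => σ (i + j) :=
  ⟨fun j hj => h.cubic _ (by omega), fun j hj => h.pair _ (by omega),
    fun j j' hij hj => h.comm _ _ (by omega) (by omega)⟩

theorem op (h : IsBMWFamily q μ k σ) : IsBMWFamily q μ k fun i => MulOpposite.op (σ i) := by
  refine ⟨fun i hi => ?_, fun i hi => (h.pair i hi).op, fun i j hij hj => ?_⟩
  · rw [← op_kappaOf, ← MulOpposite.op_mul, kappaOf_commute, h.cubic i hi, MulOpposite.op_smul]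
  · rw [← MulOpposite.op_mul, ← MulOpposite.op_mul, h.comm i j hij hj]

theorem reverse (h : IsBMWFamily q μ k σ) : IsBMWFamily q μ k fun i => σ (k - 1 - i) := by
  refine ⟨fun i hi => h.cubic _ (by omega), fun i hi => ?_, fun i j hij hj => ?_⟩
  · have := (h.pair (k - 1 - (i + 1)) (by omega)).symm
    rwa [show k - 1 - (i + 1) + 1 = k - 1 - i by omega] at this
  · exact (h.comm _ _ (by omega) (by omega)).symm

theorem neg_inv (h : IsBMWFamily q μ k σ) : IsBMWFamily (-q⁻¹) μ k σ := by
  refine ⟨fun i hi => ?_, fun i hi => ?_, h.comm⟩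
  · rw [kappaOf_neg_inv, h.cubic i hi]
  · obtain ⟨h1, h2, h3, h4, h5, h6, h7⟩ := h.pair i hi
    refine ⟨h1, ?_, ?_, ?_, ?_, ?_, ?_⟩ <;> simp only [kappaOf_neg_inv] <;> assumption

end IsBMWFamily

/-- The domain of the parameters. -/
structure GoodParameters (q μ : ℂ) : Prop where
  q_ne : q ≠ 0
  lam_ne : q - q⁻¹ ≠ 0
  mu_ne : μ ≠ 0

section pair

variable (hp : GoodParameters q μ) {x y z : B}
include hp

theorem kappaOf_mul_mul_kappaOf (h : IsBMWPair q μ x y)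
    (hx : x * kappaOf q μ x = μ • kappaOf q μ x) :
    kappaOf q μ x * y * kappaOf q μ x = μ⁻¹ • kappaOf q μ x := by
  rw [eq_inv_smul_iff₀ hp.mu_ne, ← mul_smul_comm, ← hx, ← mul_assoc, ← h.kk_right, h.kkk]

theorem kappaOf_mul_kappaOf_mul (h : IsBMWPair q μ x y)
    (hx : x * kappaOf q μ x = μ • kappaOf q μ x) :
    kappaOf q μ y * kappaOf q μ x * y = kappaOf q μ y * skeinInv q μ x := by
  have h1 : kappaOf q μ y * kappaOf q μ x * y * x = kappaOf q μ y := by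
    rw [mul_assoc _ _ y, mul_assoc, ← h.kk_right, ← mul_assoc, h.kkk_swap]
  conv_rhs => rw [← h1]
  rw [mul_assoc _ x, mul_skeinInv hp.q_ne hp.lam_ne hp.mu_ne hx, mul_one]

theorem skeinInv_mul_kappaOf_mul_kappaOf (h : IsBMWPair q μ x y)
    (hx : x * kappaOf q μ x = μ • kappaOf q μ x) :
    skeinInv q μ x * kappaOf q μ y * kappaOf q μ x = y * kappaOf q μ x := by
  rw [mul_assoc, h.kk, ← mul_assoc, ← mul_assoc,
    skeinInv_mul hp.q_ne hp.lam_ne hp.mu_ne hx, one_mul]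

theorem skeinInv_mul_kappaOf (hx : x * kappaOf q μ x = μ • kappaOf q μ x) :
    skeinInv q μ x * kappaOf q μ x = μ⁻¹ • kappaOf q μ x := by
  rw [eq_inv_smul_iff₀ hp.mu_ne, ← mul_smul_comm, ← hx, ← mul_assoc,
    skeinInv_mul hp.q_ne hp.lam_ne hp.mu_ne hx, one_mul]

/-- κ contains the factor q⁻¹ + x, which a annihilates. -/
theorem mul_kappaOf_eq_zero {a : B} (ha : a * x = (-q⁻¹) • a) : a * kappaOf q μ x = 0 := by
  have h : (μ * (q - q⁻¹)) • (a * kappaOf q μ x) = 0 := by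
    rw [← mul_smul_comm, smul_kappaOf hp.q_ne hp.lam_ne hp.mu_ne, mul_sub, mul_add, mul_one,
      mul_smul_comm, ← mul_assoc, ha, smul_mul_assoc, ha]
    have := hp.q_ne
    match_scalars
    field_simp
    ring
  exact (smul_eq_zero.1 h).resolve_left (mul_ne_zero hp.mu_ne hp.lam_ne)

/-- Fusion: the inductive step from one antisymmetrizer to the next. Since a absorbs x, the BMW
relations reduce the product to the six words a, ay, ayx, aκ_y, aκ_y x, aκ_yκ_x. The ratio q² of the
two spectral parameters makes every coefficient vanish; the two inequalities exclude the poles. -/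
theorem antisymmetric_mul_baxterized_mul {a : B} (h : IsBMWPair q μ x y)
    (hx : x * kappaOf q μ x = μ • kappaOf q μ x) (hy : y * kappaOf q μ y = μ • kappaOf q μ y)
    (ha : a * x = (-q⁻¹) • a) {t : ℂ} (ht : q * t + μ ≠ 0) (ht' : q * (q ^ 2 * t) + μ ≠ 0) :
    a * baxterized q μ (q * μ⁻¹) y t * baxterized q μ (q * μ⁻¹) x (q ^ 2 * t) *
      (y + q⁻¹ • 1) = 0 := by
  have hk : a * kappaOf q μ x = 0 := mul_kappaOf_eq_zero hp ha
  have hl : q ^ 2 - 1 ≠ 0 := by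
    intro h0
    apply hp.lam_ne
    field_simp [hp.q_ne]
    linear_combination h0
  have hq := hp.q_ne
  have hμ := hp.mu_ne
  have e1 : a * y * y = a + (q - q⁻¹) • (a * y) - (μ * (q - q⁻¹)) • (a * kappaOf q μ y) := by
    rw [mul_assoc, sq_eq_kappaOf hp.q_ne hp.lam_ne hp.mu_ne, mul_sub, mul_add, mul_one,
      mul_smul_comm, mul_smul_comm]
  have e2 : a * y * x * y = (-q⁻¹) • (a * y * x) := by
    rw [mul_assoc a, mul_assoc a, ← h.braid, ← mul_assoc, ← mul_assoc, ha]
    simp only [smul_mul_assoc, mul_assoc]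
  have e3 : a * y * kappaOf q μ x = (-q) • (a * kappaOf q μ y * kappaOf q μ x) := by
    rw [mul_assoc a (kappaOf q μ y), h.kk, ← mul_assoc, ← mul_assoc, ha]
    simp only [smul_mul_assoc, smul_smul]
    rw [neg_mul_neg, mul_inv_cancel₀ hq, one_smul]
  have e4 : a * kappaOf q μ y * kappaOf q μ x * y = a * kappaOf q μ y * x -
      (q - q⁻¹) • (a * kappaOf q μ y) + (q - q⁻¹) • (a * kappaOf q μ y * kappaOf q μ x) := by
    rw [mul_assoc a, mul_assoc a, kappaOf_mul_kappaOf_mul hp h hx, skeinInv]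
    simp only [mul_add, mul_sub, mul_smul_comm, mul_one, mul_assoc]
  have e5 : a * kappaOf q μ y * x * y = a * kappaOf q μ y * kappaOf q μ x := by
    rw [mul_assoc a, mul_assoc a, mul_assoc a, h.kk_right_swap]
  have e6 : a * kappaOf q μ y * y = μ • (a * kappaOf q μ y) := by
    rw [mul_assoc, kappaOf_commute, hy, mul_smul_comm]
  simp only [baxterized, mul_add, add_mul, mul_one, mul_smul_comm, smul_mul_assoc,
    smul_add, smul_sub, smul_smul, ha, hk, e1, e2, e3, e4, e5, e6, smul_zero, zero_mul]
  have d2 : q ^ 3 * t + μ ≠ 0 := by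
    intro h0; apply ht'; linear_combination h0
  have d3 : t * q ^ 3 + μ ≠ 0 := by rwa [mul_comm t]
  have d4 : t * q + μ ≠ 0 := by rwa [mul_comm t]
  match_scalars <;> field_simp <;> ring

end pair

end Skein


/-! ### Antisymmetrizers: absorption, idempotence, reversal -/

section Antisymmetrizers

theorem GoodParameters.neg_inv {q μ : ℂ} (hp : GoodParameters q μ) : GoodParameters (-q⁻¹) μ := by
  refine ⟨by simpa using hp.q_ne, ?_, hp.mu_ne⟩
  have h : -q⁻¹ - (-q⁻¹)⁻¹ = q - q⁻¹ := by rw [inv_neg, inv_inv]; ring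
  rw [h]
  exact hp.lam_ne

theorem CondA.mono {q μ : ℂ} {n m : ℕ} (h : CondA q μ n) (hm : m ≤ n) : CondA q μ m :=
  fun j h2 hj => h j h2 (hj.trans hm)

theorem CondA.qNum_ne {q μ : ℂ} (hp : GoodParameters q μ) {n j : ℕ} (h : CondA q μ n)
    (h1 : 1 ≤ j) (hj : j ≤ n) : qNum q j ≠ 0 := by
  rcases h1.eq_or_lt with rfl | h2
  · simpa [qNum] using hp.lam_ne
  · exact (h j h2 hj).1

theorem CondA.add_ne {q μ : ℂ} (hp : GoodParameters q μ) {n j : ℕ} (h : CondA q μ n)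
    (h1 : 1 ≤ j) (hj : j + 1 ≤ n) : q * (q ^ (2 * j))⁻¹ + μ ≠ 0 := by
  have h2 := (h (j + 1) (by omega) hj).2
  intro h3
  apply h2
  have : q ^ (3 - 2 * ((j + 1 : ℕ) : ℤ)) = q * (q ^ (2 * j))⁻¹ := by
    rw [show 3 - 2 * ((j + 1 : ℕ) : ℤ) = 1 + -((2 * j : ℕ) : ℤ) by push_cast; ring,
      zpow_add₀ hp.q_ne, zpow_neg, zpow_natCast, zpow_one]
  rw [this]
  linear_combination h3

theorem qNum_neg_inv (q : ℂ) (j : ℕ) :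
    qNum (-q⁻¹) j = (-1) ^ (j + 1) * qNum q j := by
  have h : -q⁻¹ - (-q⁻¹)⁻¹ = q - q⁻¹ := by rw [inv_neg, inv_inv]; ring
  have h2 : (-1 : ℂ) ^ j * (-1) ^ j = 1 := by rw [← mul_pow]; simp
  have h1 : ((-1 : ℂ) ^ j)⁻¹ = (-1) ^ j := inv_eq_of_mul_eq_one_left h2
  rw [qNum, qNum, h, neg_pow, inv_pow, mul_inv, inv_inv, h1]
  ring

/-- Under q ↦ -q⁻¹ a q-number changes at most its sign, and the exponent 3 - 2j is odd, so its power
acquires the sign that matches the two exclusions of μ. -/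
theorem CondS.condA {q μ : ℂ} {n : ℕ} (h : CondS q μ n) : CondA (-q⁻¹) μ n := by
  intro j h2 hj
  obtain ⟨h3, h4⟩ := h j h2 hj
  refine ⟨?_, ?_⟩
  · rw [qNum_neg_inv]
    exact mul_ne_zero (pow_ne_zero _ (by norm_num)) h3
  · have h5 : (-q⁻¹) ^ (3 - 2 * (j : ℤ)) = - q ^ (2 * (j : ℤ) - 3) := by
      rw [show -q⁻¹ = -1 * q⁻¹ by ring, mul_zpow, inv_zpow, ← zpow_neg,
        show -(3 - 2 * (j : ℤ)) = 2 * j - 3 by ring, Odd.neg_one_zpow ⟨1 - j, by ring⟩]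
      ring
    rw [h5, neg_neg]
    exact h4

variable {B : Type*} [Ring B] [Algebra ℂ B] {q μ : ℂ}

/-- The antisymmetrizers made from a sequence of generators. -/
noncomputable def antisymOf (q μ : ℂ) (σ : ℕ → B) : ℕ → B
  | 0 => 1
  | 1 => 1
  | i + 2 => (q ^ (i + 1) / qNum q (i + 2)) •
      (antisymOf q μ σ (i + 1) * baxterized q μ (q * μ⁻¹) (σ i) (q ^ (2 * (i + 1)))⁻¹ *
        antisymOf q μ σ (i + 1))

theorem map_antisymOf {C : Type*} [Ring C] [Algebra ℂ C] (f : B →ₐ[ℂ] C) (σ : ℕ → B) (i : ℕ) :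
    f (antisymOf q μ σ i) = antisymOf q μ (f ∘ σ) i := by
  induction i using antisymOf.induct with
  | case1 => simp [antisymOf]
  | case2 => simp [antisymOf]
  | case3 i ih => simp [antisymOf, baxterized, map_kappaOf, ih]

theorem op_baxterized (α x : ℂ) (σ : B) :
    MulOpposite.op (baxterized q μ α σ x) = baxterized q μ α (MulOpposite.op σ) x := by
  simp [baxterized, op_kappaOf]

theorem op_antisymOf (σ : ℕ → B) (i : ℕ) :
    MulOpposite.op (antisymOf q μ σ i) = antisymOf q μ (fun j => MulOpposite.op (σ j)) i := by
  induction i using antisymOf.induct with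
  | case1 => simp [antisymOf]
  | case2 => simp [antisymOf]
  | case3 i ih =>
    simp only [antisymOf, MulOpposite.op_smul, MulOpposite.op_mul, ih, op_baxterized, mul_assoc]

theorem SemiconjBy.smul_right' {g x y : B} (h : SemiconjBy g x y) (c : ℂ) :
    SemiconjBy g (c • x) (c • y) := by
  rw [SemiconjBy, mul_smul_comm, h.eq, smul_mul_assoc]

theorem SemiconjBy.kappaOf {g x y : B} (h : SemiconjBy g x y) :
    SemiconjBy g (kappaOf q μ x) (kappaOf q μ y) := by
  have h1 : ∀ c : ℂ, SemiconjBy g (c • 1) (c • 1) :=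
    fun c => SemiconjBy.smul_right' (SemiconjBy.one_right g) c
  exact SemiconjBy.smul_right' (((h1 q).sub_right h).mul_right ((h1 q⁻¹).add_right h)) _

theorem SemiconjBy.baxterized {g x y : B} (h : SemiconjBy g x y) (α t : ℂ) :
    SemiconjBy g (baxterized q μ α x t) (baxterized q μ α y t) :=
  ((SemiconjBy.one_right g).add_right (SemiconjBy.smul_right' h _)).add_right
    (SemiconjBy.smul_right' (SemiconjBy.kappaOf h) _)

/-- Semiconjugation covers three uses at once: shifts of strands, commutation when σ = τ, and
congruence when g = 1. -/
theorem SemiconjBy.antisymOf {g : B} {σ τ : ℕ → B} {i : ℕ}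
    (h : ∀ l, l + 1 < i → SemiconjBy g (σ l) (τ l)) :
    SemiconjBy g (antisymOf q μ σ i) (antisymOf q μ τ i) := by
  induction i using antisymOf.induct with
  | case1 => exact SemiconjBy.one_right g
  | case2 => exact SemiconjBy.one_right g
  | case3 i ih =>
    have ih' := ih fun l hl => h l (by omega)
    exact SemiconjBy.smul_right' ((ih'.mul_right
      (SemiconjBy.baxterized (h i (by omega)) _ _)).mul_right ih') _

theorem antisymOf_congr {σ τ : ℕ → B} {i : ℕ} (h : ∀ l, l + 1 < i → σ l = τ l) :
    antisymOf q μ σ i = antisymOf q μ τ i := by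
  have := SemiconjBy.antisymOf (q := q) (μ := μ) (g := (1 : B)) (σ := σ) (τ := τ) (i := i)
    fun l hl => by rw [h l hl]; exact SemiconjBy.one_left _
  simpa using this.eq

/-- The left a' slides through b and is absorbed by a; the right a' slides out past s. -/
theorem mul_mul_mul_eq_zero {B : Type*} [Ring B] {a a' b c s : B} (hb : b * a' = a' * b) (hs : a' * s = s * a')
    (ha : a * a' = a) (h0 : a * b * c * s = 0) : a * b * (a' * c * a') * s = 0 := by
  calc a * b * (a' * c * a') * s = a * (b * a') * c * (a' * s) := by simp only [mul_assoc]
    _ = (a * a') * b * c * s * a' := by rw [hb, hs]; simp only [mul_assoc]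
    _ = 0 := by rw [ha, h0, zero_mul]

variable (hp : GoodParameters q μ)
include hp

theorem mul_baxterized_of_eigen {b x : B} (hb : b * x = (-q⁻¹) • b) (α t : ℂ) :
    b * baxterized q μ α x t = (1 - q⁻¹ * ((t - 1) / (q - q⁻¹))) • b := by
  simp only [baxterized, mul_add, mul_one, mul_smul_comm, hb, mul_kappaOf_eq_zero hp hb]
  module

/-- The normalization in the recursion is the inverse of the scalar by which the baxterized element
acts on a (-q⁻¹)-eigenvector. -/
theorem antisymOf_scalar {i : ℕ} (hi : qNum q (i + 2) ≠ 0) :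
    q ^ (i + 1) / qNum q (i + 2) *
      (1 - q⁻¹ * (((q ^ (2 * (i + 1)))⁻¹ - 1) / (q - q⁻¹))) = 1 := by
  have hq := hp.q_ne
  have hl := hp.lam_ne
  rw [div_mul_eq_mul_div, div_eq_one_iff_eq hi, qNum]
  have e : q⁻¹ * (q ^ (2 * (i + 1)))⁻¹ * q ^ (i + 1) = (q ^ (i + 2))⁻¹ := by
    field_simp
    ring
  have e2 : (((q ^ (2 * (i + 1)))⁻¹ - 1) / (q - q⁻¹)) * (q - q⁻¹) = (q ^ (2 * (i + 1)))⁻¹ - 1 :=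
    div_mul_cancel₀ _ hl
  rw [eq_div_iff hl]
  linear_combination (-q⁻¹ * q ^ (i + 1)) * e2 - e

theorem mul_antisymOf_of_eigen {n : ℕ} (hA : CondA q μ n) {σ : ℕ → B} {b : B} {i : ℕ} (hi : i ≤ n)
    (hb : ∀ l, l + 1 < i → b * σ l = (-q⁻¹) • b) : b * antisymOf q μ σ i = b := by
  induction i using antisymOf.induct with
  | case1 => exact mul_one b
  | case2 => exact mul_one b
  | case3 i ih =>
    have ih' := ih (by omega) fun l hl => hb l (by omega)
    rw [antisymOf, mul_smul_comm, ← mul_assoc, ← mul_assoc, ih',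
      mul_baxterized_of_eigen hp (hb i (by omega)), smul_mul_assoc, ih', smul_smul,
      antisymOf_scalar hp (hA.qNum_ne hp (by omega) hi), one_smul]

/-- The case of two strands: at the spectral parameter q⁻² the baxterized element is itself an
eigenvector. It starts the induction in `antisymOf_mul`. -/
theorem baxterized_mul_self {x : B} (hx : x * kappaOf q μ x = μ • kappaOf q μ x)
    (ht : q * (q ^ 2)⁻¹ + μ ≠ 0) :
    baxterized q μ (q * μ⁻¹) x (q ^ 2)⁻¹ * x =
      (-q⁻¹) • baxterized q μ (q * μ⁻¹) x (q ^ 2)⁻¹ := by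
  have hl : q ^ 2 - 1 ≠ 0 := by
    intro h0
    apply hp.lam_ne
    field_simp [hp.q_ne]
    linear_combination h0
  have hq := hp.q_ne
  have hμ := hp.mu_ne
  simp only [baxterized, add_mul, smul_mul_assoc, one_mul, kappaOf_commute, hx,
    sq_eq_kappaOf hp.q_ne hp.lam_ne hp.mu_ne]
  have d : 1 + q * μ ≠ 0 := by
    intro h0; apply ht; field_simp; linear_combination h0
  match_scalars <;> field_simp <;> ring

/-- Strong induction on the rank. The right-hand factor of the recursion absorbs all generators but
the last, and the last one is handled by fusion. -/
theorem antisymOf_mul {n k : ℕ} (hA : CondA q μ n) {σ : ℕ → B} (h : IsBMWFamily q μ k σ) {i : ℕ}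
    (hi : i ≤ n) (hk : i ≤ k + 1) {l : ℕ} (hl : l + 1 < i) :
    antisymOf q μ σ i * σ l = (-q⁻¹) • antisymOf q μ σ i := by
  induction i using Nat.strong_induction_on generalizing l with
  | _ i ih =>
    obtain _ | _ | i := i
    · omega
    · omega
    by_cases hli : l < i
    · rw [antisymOf, smul_mul_assoc, mul_assoc, ih (i + 1) (by omega) (by omega) (by omega)
        (by omega), mul_smul_comm, smul_comm]
    · obtain rfl : l = i := by omega
      obtain _ | j := l
      · rw [antisymOf, antisymOf, one_mul, mul_one, smul_mul_assoc]
        rw [show (2 * (0 + 1) : ℕ) = 2 from rfl, baxterized_mul_self hp (h.cubic 0 (by omega))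
          (hA.add_ne hp (j := 1) (by omega) (by omega)), smul_comm]
      · have h1 : antisymOf q μ σ (j + 2) * antisymOf q μ σ (j + 1) = antisymOf q μ σ (j + 2) :=
          mul_antisymOf_of_eigen hp hA (by omega) fun l hl =>
            ih (j + 2) (by omega) (by omega) (by omega) (by omega)
        have hc : Commute (σ (j + 1)) (antisymOf q μ σ (j + 1)) :=
          SemiconjBy.antisymOf fun l hl => (h.comm l (j + 1) (by omega) (by omega)).symm
        have hb : Commute (baxterized q μ (q * μ⁻¹) (σ (j + 1)) (q ^ (2 * (j + 2)))⁻¹)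
            (antisymOf q μ σ (j + 1)) := (SemiconjBy.baxterized hc.symm _ _ :)|>.symm
        have h0 := antisymmetric_mul_baxterized_mul hp (h.pair j (by omega))
          (h.cubic j (by omega)) (h.cubic (j + 1) (by omega))
          (ih (j + 2) (by omega) (by omega) (by omega) (by omega : j + 1 < j + 2))
          (t := (q ^ (2 * (j + 2)))⁻¹) (hA.add_ne hp (by omega) (by omega)) (by
            have := hA.add_ne hp (j := j + 1) (by omega) (by omega)
            have e : q ^ 2 * (q ^ (2 * (j + 2)))⁻¹ = (q ^ (2 * (j + 1)))⁻¹ := by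
              have := hp.q_ne
              field_simp
              ring
            rwa [e])
        have e : q ^ 2 * (q ^ (2 * (j + 2)))⁻¹ = (q ^ (2 * (j + 1)))⁻¹ := by
          have := hp.q_ne
          field_simp
          ring
        rw [e] at h0
        have h2 : antisymOf q μ σ (j + 3) * (σ (j + 1) + q⁻¹ • 1) = 0 := by
          have h3 : antisymOf q μ σ (j + 2) *
              baxterized q μ (q * μ⁻¹) (σ (j + 1)) (q ^ (2 * (j + 2)))⁻¹ *
              antisymOf q μ σ (j + 2) * (σ (j + 1) + q⁻¹ • 1) = 0 := by
            have hc' : Commute (antisymOf q μ σ (j + 1)) (σ (j + 1) + q⁻¹ • 1) :=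
              hc.symm.add_right (SemiconjBy.smul_right' (SemiconjBy.one_right _) _)
            -- Only the right-hand copy of the antisymmetrizer is expanded; its outer factors have
            -- lower rank and commute with the last generator, which is the shape required by
            -- `mul_mul_mul_eq_zero`.
            conv_lhs => enter [1, 2]; rw [antisymOf]
            rw [mul_smul_comm, smul_mul_assoc, mul_mul_mul_eq_zero hb.eq hc'.eq h1 h0, smul_zero]
          rw [antisymOf, smul_mul_assoc, h3, smul_zero]
        rw [mul_add, mul_smul_comm, mul_one] at h2
        rw [eq_neg_of_add_eq_zero_left h2, neg_smul]

theorem mul_antisymOf {n k : ℕ} (hA : CondA q μ n) {σ : ℕ → B} (h : IsBMWFamily q μ k σ) {i : ℕ}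
    (hi : i ≤ n) (hk : i ≤ k + 1) {l : ℕ} (hl : l + 1 < i) :
    σ l * antisymOf q μ σ i = (-q⁻¹) • antisymOf q μ σ i := by
  have := antisymOf_mul hp hA h.op hi hk hl
  rw [← op_antisymOf, ← MulOpposite.op_mul, ← MulOpposite.op_smul] at this
  exact MulOpposite.op_injective this

theorem antisymOf_mul_self {n k : ℕ} (hA : CondA q μ n) {σ : ℕ → B} (h : IsBMWFamily q μ k σ)
    {i : ℕ} (hi : i ≤ n) (hk : i ≤ k + 1) :
    antisymOf q μ σ i * antisymOf q μ σ i = antisymOf q μ σ i :=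
  mul_antisymOf_of_eigen hp hA hi fun _ hl => antisymOf_mul hp hA h hi hk hl

/-- Both elements absorb the same generators from both sides. Their product therefore equals the
first factor by right absorption and the second by left absorption. -/
theorem antisymOf_reverse {n k : ℕ} (hA : CondA q μ n) {σ : ℕ → B} (h : IsBMWFamily q μ k σ)
    (hk : k + 1 ≤ n) :
    antisymOf q μ (fun i => σ (k - 1 - i)) (k + 1) = antisymOf q μ σ (k + 1) := by
  set τ : ℕ → B := fun i => σ (k - 1 - i) with hτ
  have h1 : antisymOf q μ τ (k + 1) * antisymOf q μ σ (k + 1) = antisymOf q μ τ (k + 1) := by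
    refine mul_antisymOf_of_eigen hp hA hk fun l hl => ?_
    have := antisymOf_mul hp hA h.reverse hk le_rfl (l := k - 1 - l) (by omega)
    rwa [show k - 1 - (k - 1 - l) = l by omega] at this
  have h2 : MulOpposite.op (antisymOf q μ τ (k + 1) * antisymOf q μ σ (k + 1)) =
      MulOpposite.op (antisymOf q μ σ (k + 1)) := by
    rw [MulOpposite.op_mul, op_antisymOf τ]
    refine mul_antisymOf_of_eigen hp hA hk fun l hl => ?_
    rw [← MulOpposite.op_mul, ← MulOpposite.op_smul, hτ]
    congr 1
    exact mul_antisymOf hp hA h hk le_rfl (by omega)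
  rw [← h1]
  exact MulOpposite.op_injective h2

/-- The recursion for the antisymmetrizers with respect to the initial generator. -/
theorem antisymOf_succ_left {n i : ℕ} (hA : CondA q μ n) {σ : ℕ → B}
    (h : IsBMWFamily q μ (i + 1) σ) (hi : i + 2 ≤ n) :
    antisymOf q μ σ (i + 2) = (q ^ (i + 1) / qNum q (i + 2)) •
      (antisymOf q μ (fun l => σ (1 + l)) (i + 1) *
        baxterized q μ (q * μ⁻¹) (σ 0) (q ^ (2 * (i + 1)))⁻¹ *
        antisymOf q μ (fun l => σ (1 + l)) (i + 1)) := by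
  have h1 : antisymOf q μ (fun l => σ (i - l)) (i + 1) =
      antisymOf q μ (fun l => σ (1 + l)) (i + 1) := by
    rw [← antisymOf_reverse hp hA (h.shift (i := 1) (l := i) (by omega)) (by omega)]
    refine antisymOf_congr fun l hl => ?_
    rw [show i - l = 1 + (i - 1 - l) by omega]
  rw [← antisymOf_reverse hp hA h hi, antisymOf]
  simp only [Nat.add_sub_cancel, Nat.sub_self, h1]

end Antisymmetrizers


/-! ### Words enclosed between contractions -/

section Sandwich

variable {B : Type*} [Ring B] [Algebra ℂ B] {q μ : ℂ} (hp : GoodParameters q μ) {x y z : B}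
  (hxy : IsBMWPair q μ x y) (hyz : IsBMWPair q μ y z) (hxz : Commute x z)
  (hx : x * kappaOf q μ x = μ • kappaOf q μ x) (hy : y * kappaOf q μ y = μ • kappaOf q μ y)
include hp hxy hyz hxz hy

/-- Here and in the next three lemmas a word in x times a word in z is enclosed by contractions
involving y. The contractions glue the strands of z to those of x, and a word in x alone remains. -/
theorem sandwich_kappaOf_mul :
    kappaOf q μ z * kappaOf q μ y * (kappaOf q μ x * z) * kappaOf q μ y =
      x * (kappaOf q μ z * kappaOf q μ y) := by
  have hxz' : Commute x (kappaOf q μ z) := SemiconjBy.kappaOf hxz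
  have hkz : Commute z (kappaOf q μ x) := SemiconjBy.kappaOf hxz.symm
  rw [← hkz.eq, ← mul_assoc, kappaOf_mul_kappaOf_mul hp hyz hy, mul_assoc, mul_assoc, ← mul_assoc _
    (kappaOf q μ x), skeinInv_mul_kappaOf_mul_kappaOf hp hxy.symm hy, ← mul_assoc, ← mul_assoc,
    hxz'.eq]

omit hxy hy hp in
theorem sandwich_mul_kappaOf :
    kappaOf q μ z * kappaOf q μ y * (x * kappaOf q μ z) * kappaOf q μ y =
      x * (kappaOf q μ z * kappaOf q μ y) := by
  have hxz' : Commute x (kappaOf q μ z) := SemiconjBy.kappaOf hxz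
  rw [hxz'.eq, ← mul_assoc, hyz.kkk_swap, ← hxz'.eq, mul_assoc]

omit hxy hy hp in
theorem sandwich_kappaOf_mul_kappaOf :
    kappaOf q μ z * kappaOf q μ y * (kappaOf q μ x * kappaOf q μ z) * kappaOf q μ y =
      kappaOf q μ x * (kappaOf q μ z * kappaOf q μ y) := by
  have hxz' : Commute (kappaOf q μ x) (kappaOf q μ z) :=
    SemiconjBy.kappaOf (SemiconjBy.kappaOf hxz.symm).symm
  rw [hxz'.eq, ← mul_assoc, hyz.kkk_swap, ← hxz'.eq, mul_assoc]

include hx in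
-- After κ_zκ_y z = κ_z y⁻¹ the factor y⁻¹xκ_y remains. The skein relation replaces x by x⁻¹, for
-- which y⁻¹x⁻¹κ_y = κ_xκ_y is a BMW relation; the other two terms are the skein corrections.
theorem sandwich_mul :
    kappaOf q μ z * kappaOf q μ y * (x * z) * kappaOf q μ y =
      (kappaOf q μ x + ((q - q⁻¹) * μ⁻¹) • 1 - (q - q⁻¹) • x) *
        (kappaOf q μ z * kappaOf q μ y) := by
  have hxz' : Commute x (kappaOf q μ z) := SemiconjBy.kappaOf hxz
  have hkxz' : Commute (kappaOf q μ x) (kappaOf q μ z) :=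
    SemiconjBy.kappaOf (SemiconjBy.kappaOf hxz.symm).symm
  have h1 : x = skeinInv q μ x + (q - q⁻¹) • 1 - (q - q⁻¹) • kappaOf q μ x := by
    rw [skeinInv]; module
  have h2 : skeinInv q μ y * skeinInv q μ x * kappaOf q μ y = kappaOf q μ x * kappaOf q μ y := by
    have e : skeinInv q μ y * skeinInv q μ x * (x * y * (kappaOf q μ x * kappaOf q μ y)) =
        kappaOf q μ x * kappaOf q μ y := by
      calc _ = skeinInv q μ y * (skeinInv q μ x * x) * y * (kappaOf q μ x * kappaOf q μ y) := by
            simp only [mul_assoc]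
        _ = _ := by
            rw [skeinInv_mul hp.q_ne hp.lam_ne hp.mu_ne hx, mul_one,
              skeinInv_mul hp.q_ne hp.lam_ne hp.mu_ne hy, one_mul]
    rwa [← mul_assoc (x * y), ← hxy.kk, hxy.kkk_swap] at e
  have h3 : skeinInv q μ y * x * kappaOf q μ y =
      kappaOf q μ x * kappaOf q μ y + ((q - q⁻¹) * μ⁻¹) • kappaOf q μ y -
        (q - q⁻¹) • (x * kappaOf q μ y) := by
    conv_lhs => rw [h1]
    simp only [mul_add, mul_sub, add_mul, sub_mul, mul_smul_comm, smul_mul_assoc, mul_one, h2,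
      skeinInv_mul_kappaOf_mul_kappaOf hp hxy.symm hy, skeinInv_mul_kappaOf hp hy, smul_smul]
  rw [hxz.eq, ← mul_assoc, kappaOf_mul_kappaOf_mul hp hyz hy, mul_assoc, mul_assoc, ← mul_assoc _
    x, h3]
  simp only [mul_add, mul_sub, add_mul, sub_mul, mul_smul_comm, smul_mul_assoc, one_mul]
  rw [← mul_assoc, ← hkxz'.eq, ← mul_assoc _ x, ← hxz'.eq]
  simp only [mul_assoc]

end Sandwich

/-! ### Transport of a pair of strands to the right end -/

section Removal

variable {B : Type*} [Ring B] [Algebra ℂ B] {q μ : ℂ}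

/-- The braid which moves the strands `p`, `p + 1` over `d` strands to the right. -/
def moveRight (σ : ℕ → B) : ℕ → ℕ → B
  | _, 0 => 1
  | p, d + 1 => moveRight σ (p + 1) d * (σ p * σ (p + 1))

variable {k : ℕ} {σ : ℕ → B} (h : IsBMWFamily q μ k σ)
include h

theorem moveRight_commute {p d l : ℕ} (hk : p + d < k) (hl : l + 1 < p) :
    Commute (moveRight σ p d) (σ l) := by
  induction d generalizing p with
  | zero => exact Commute.one_left _
  | succ d ih =>
    exact (ih (by omega) (by omega)).mul_left
      (Commute.mul_left (h.comm l p hl (by omega)).symm (h.comm l _ (by omega) (by omega)).symm)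

theorem moveRight_kappaOf {p d : ℕ} (hk : p + d < k) :
    SemiconjBy (moveRight σ p d) (kappaOf q μ (σ p)) (kappaOf q μ (σ (p + d))) := by
  induction d generalizing p with
  | zero => exact SemiconjBy.one_left _
  | succ d ih =>
    have h1 := h.pair p (by omega)
    have h2 : SemiconjBy (σ p * σ (p + 1)) (kappaOf q μ (σ p)) (kappaOf q μ (σ (p + 1))) := by
      rw [SemiconjBy, ← h1.kk, h1.kk_right_swap, mul_assoc]
    rw [show p + (d + 1) = p + 1 + d by omega]
    exact (ih (by omega)).mul_left h2

/-- Two consecutive moves σ_{p+1}σ_{p+2}σ_pσ_{p+1} carry σ_{p+2} to σ_p by the braid relations; all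
other moves commute with the generator concerned. -/
theorem moveRight_shift {p d l : ℕ} (hk : p + d < k) (hl : p ≤ l) (hl' : l + 2 ≤ p + d) :
    SemiconjBy (moveRight σ p d) (σ (l + 2)) (σ l) := by
  induction d generalizing p with
  | zero => omega
  | succ d ih =>
    rcases hl.eq_or_lt with rfl | hl
    · obtain ⟨d, rfl⟩ : ∃ e, d = e + 1 := ⟨d - 1, by omega⟩
      have h1 : SemiconjBy ((σ (p + 1) * σ (p + 2)) * (σ p * σ (p + 1))) (σ (p + 2)) (σ p) := by
        have e1 := (h.pair p (by omega)).braid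
        have e2 := (h.pair (p + 1) (by omega)).braid
        have e3 := h.comm p (p + 2) (by omega) (by omega)
        calc σ (p + 1) * σ (p + 2) * (σ p * σ (p + 1)) * σ (p + 2)
            = σ (p + 1) * (σ (p + 2) * σ p) * σ (p + 1) * σ (p + 2) := by simp only [mul_assoc]
          _ = σ (p + 1) * σ p * (σ (p + 2) * σ (p + 1) * σ (p + 2)) := by
            rw [← e3]; simp only [mul_assoc]
          _ = σ (p + 1) * σ p * σ (p + 1) * σ (p + 2) * σ (p + 1) := by
            rw [← e2]; simp only [mul_assoc]
          _ = σ p * σ (p + 1) * (σ p * σ (p + 2)) * σ (p + 1) := by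
            rw [← e1]; simp only [mul_assoc]
          _ = σ p * (σ (p + 1) * σ (p + 2) * (σ p * σ (p + 1))) := by
            rw [e3]; simp only [mul_assoc]
      have h2 : Commute (moveRight σ (p + 1 + 1) d) (σ p) := moveRight_commute h (by omega)
        (by omega)
      rw [moveRight, moveRight, mul_assoc]
      exact SemiconjBy.mul_left h2 h1
    · exact (ih (by omega) hl (by omega)).mul_left
        (Commute.mul_left (h.comm p _ (by omega) (by omega)) (h.comm _ _ (by omega) (by omega)))

theorem isUnit_moveRight (hp : GoodParameters q μ) {p d : ℕ} (hk : p + d < k) :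
    IsUnit (moveRight σ p d) := by
  have hσ : ∀ i < k, IsUnit (σ i) := fun i hi =>
    ⟨⟨σ i, _, mul_skeinInv hp.q_ne hp.lam_ne hp.mu_ne (h.cubic i hi),
      skeinInv_mul hp.q_ne hp.lam_ne hp.mu_ne (h.cubic i hi)⟩, rfl⟩
  induction d generalizing p with
  | zero => exact isUnit_one
  | succ d ih =>
    exact (ih (by omega)).mul ((hσ p (by omega)).mul (hσ (p + 1) (by omega)))

omit h in
theorem moveRight_mem (S : Subalgebra ℂ B) (hσ : ∀ i, σ i ∈ S) (p d : ℕ) :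
    moveRight σ p d ∈ S := by
  induction d generalizing p with
  | zero => exact S.one_mem
  | succ d ih => exact S.mul_mem (ih _) (S.mul_mem (hσ _) (hσ _))

end Removal

/-! ### Descending products of generators -/

section Descending

variable {B : Type*} [Ring B]

/-- The product `σ (k - 1) ⋯ σ 1 σ 0`. -/
def descProd (σ : ℕ → B) (k : ℕ) : B := ((List.range k).reverse.map σ).prod

theorem descProd_zero (σ : ℕ → B) : descProd σ 0 = 1 := rfl

theorem descProd_succ (σ : ℕ → B) (k : ℕ) :
    descProd σ (k + 1) = descProd (fun l => σ (1 + l)) k * σ 0 := by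
  simp [descProd, List.range_succ_eq_map, Function.comp_def, add_comm]

theorem SemiconjBy.descProd {g : B} {σ τ : ℕ → B} {k : ℕ} (h : ∀ l < k, SemiconjBy g (σ l) (τ l)) :
    SemiconjBy g (descProd σ k) (descProd τ k) := by
  induction k generalizing σ τ with
  | zero => exact SemiconjBy.one_right g
  | succ k ih =>
    rw [descProd_succ, descProd_succ]
    exact (ih fun l hl => h _ (by omega)).mul_right (h 0 (by omega))

variable [Algebra ℂ B] {q μ : ℂ}

theorem map_descProd {C : Type*} [Ring C] [Algebra ℂ C] (f : B →ₐ[ℂ] C) (σ : ℕ → B) (k : ℕ) :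
    f (descProd σ k) = descProd (f ∘ σ) k := by
  rw [descProd, map_list_prod, List.map_map]; rfl

theorem descProd_mem (S : Subalgebra ℂ B) {σ : ℕ → B} (hσ : ∀ i, σ i ∈ S) (k : ℕ) :
    descProd σ k ∈ S := by
  refine S.list_prod_mem fun x hx => ?_
  obtain ⟨i, -, rfl⟩ := List.mem_map.1 hx
  exact hσ i

theorem kappaOf_mem (S : Subalgebra ℂ B) {x : B} (hx : x ∈ S) : kappaOf q μ x ∈ S :=
  S.smul_mem (S.mul_mem (S.sub_mem (S.smul_mem S.one_mem _) hx)
    (S.add_mem (S.smul_mem S.one_mem _) hx)) _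

theorem baxterized_mem (S : Subalgebra ℂ B) {x : B} (hx : x ∈ S) (α t : ℂ) :
    baxterized q μ α x t ∈ S :=
  S.add_mem (S.add_mem S.one_mem (S.smul_mem hx _)) (S.smul_mem (kappaOf_mem S hx) _)

theorem antisymOf_mem (S : Subalgebra ℂ B) {σ : ℕ → B} (hσ : ∀ i, σ i ∈ S) (i : ℕ) :
    antisymOf q μ σ i ∈ S := by
  induction i using antisymOf.induct with
  | case1 => exact S.one_mem
  | case2 => exact S.one_mem
  | case3 i ih => exact S.smul_mem (S.mul_mem (S.mul_mem ih (baxterized_mem S (hσ i) _ _)) ih) _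

end Descending


/-! ### Matrix entries, the matrix D_R and its twist identity -/

section Entries

open Finset

theorem place_mul_apply {N k n : ℕ} {A : Type*} [NonUnitalNonAssocSemiring A] {e : Fin k → Fin n}
    (he : Function.Injective e) (X : Op N k A) (Z : Op N n A) (a b : Fin n → Fin N) :
    (place e X * Z) a b = ∑ d, X (a ∘ e) d * Z (Function.extend e d a) b := by
  classical
  simp only [Matrix.mul_apply, place_apply, ite_mul, zero_mul]
  rw [← sum_filter]
  refine sum_nbij' (fun c => c ∘ e) (fun d => Function.extend e d a) ?_ ?_ ?_ ?_ ?_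
  · intro c _; simp
  · intro d _
    simp only [mem_filter, mem_univ, true_and]
    intro j hj
    rw [Function.extend_apply' _ _ _ (by rintro ⟨i, hi⟩; exact hj i hi)]
  · intro c hc
    simp only [mem_filter, mem_univ, true_and] at hc
    funext j
    by_cases hj : ∃ i, e i = j
    · obtain ⟨i, rfl⟩ := hj
      rw [he.extend_apply]; rfl
    · rw [Function.extend_apply' _ _ _ hj]
      exact hc j (fun i hi => hj ⟨i, hi⟩)
  · intro d _
    funext i
    exact he.extend_apply d a i
  · intro c hc
    simp only [mem_filter, mem_univ, true_and] at hc
    congr 2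
    funext j
    by_cases hj : ∃ i, e i = j
    · obtain ⟨i, rfl⟩ := hj
      rw [he.extend_apply]; rfl
    · rw [Function.extend_apply' _ _ _ hj]
      exact (hc j (fun i hi => hj ⟨i, hi⟩)).symm

theorem mul_place_apply {N k n : ℕ} {A : Type*} [NonUnitalNonAssocSemiring A] {e : Fin k → Fin n}
    (he : Function.Injective e) (X : Op N k A) (Z : Op N n A) (a b : Fin n → Fin N) :
    (Z * place e X) a b = ∑ d, Z a (Function.extend e d b) * X d (b ∘ e) := by
  -- Transposition with values in the opposite ring reduces right multiplication to left
  -- multiplication.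
  have h := place_mul_apply (A := Aᵐᵒᵖ) he (X.transpose.map MulOpposite.op)
    (Z.transpose.map MulOpposite.op) b a
  have h1 : place e (X.transpose.map MulOpposite.op) =
      (place e X).transpose.map MulOpposite.op := by
    ext a b
    simp only [Matrix.transpose_apply, place_apply, Matrix.map_apply, eq_comm]
    split_ifs <;> rfl
  rw [h1, Matrix.mul_apply] at h
  apply MulOpposite.op_injective
  simpa [Matrix.mul_apply] using h

theorem sum_fin_two_arrow {N : ℕ} {A : Type*} [AddCommMonoid A] (f : (Fin 2 → Fin N) → A) :
    ∑ d, f d = ∑ i, ∑ j, f ![i, j] := by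
  rw [← (finTwoArrowEquiv (Fin N)).symm.sum_comp, Fintype.sum_prod_type]
  rfl

theorem sum_comm_two_three {ι A : Type*} [Fintype ι] [AddCommMonoid A] (g : ι → ι → ι → ι → ι → A) :
    ∑ a, ∑ b, ∑ c, ∑ d, ∑ e, g a b c d e = ∑ c, ∑ d, ∑ e, ∑ a, ∑ b, g a b c d e := by
  simpa only [Fintype.sum_prod_type] using
    sum_comm (s := univ) (t := univ) (f := fun (p : ι × ι) (t : ι × ι × ι) =>
      g p.1 p.2 t.1 t.2.1 t.2.2)

theorem sum_comm_two_two {ι A : Type*} [Fintype ι] [AddCommMonoid A] (g : ι → ι → ι → ι → A) :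
    ∑ a, ∑ b, ∑ c, ∑ d, g a b c d = ∑ c, ∑ d, ∑ a, ∑ b, g a b c d := by
  simpa only [Fintype.sum_prod_type] using
    sum_comm (s := univ) (t := univ) (f := fun (p : ι × ι) (t : ι × ι) => g p.1 p.2 t.1 t.2)

theorem sum_comm_one_two {ι A : Type*} [Fintype ι] [AddCommMonoid A] (g : ι → ι → ι → A) :
    ∑ a, ∑ b, ∑ c, g a b c = ∑ c, ∑ a, ∑ b, g a b c := by
  simpa only [Fintype.sum_prod_type] using
    sum_comm (s := univ) (t := univ) (f := fun (p : ι × ι) (t : ι) => g p.1 p.2 t)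

theorem site_zero_mul_apply {N : ℕ} (X : Op N 2 ℂ) (Z : Op N 3 ℂ) (a b c : Fin N)
    (w : Fin 3 → Fin N) :
    (site 3 0 X * Z) ![a, b, c] w = ∑ i, ∑ j, X ![a, b] ![i, j] * Z ![i, j, c] w := by
  rw [site_eq (by omega), place_mul_apply (pair_injective (by omega)), sum_fin_two_arrow]
  refine sum_congr rfl fun i _ => sum_congr rfl fun j _ => ?_
  congr 2
  · funext l; fin_cases l <;> rfl
  · funext l
    fin_cases l
    · exact (pair_injective (by omega : 0 + 1 < 3)).extend_apply _ _ 0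
    · exact (pair_injective (by omega : 0 + 1 < 3)).extend_apply _ _ 1
    · exact Function.extend_apply' _ _ _ (by simp [Fin.exists_fin_two])

theorem site_one_mul_apply {N : ℕ} (X : Op N 2 ℂ) (Z : Op N 3 ℂ) (a b c : Fin N)
    (w : Fin 3 → Fin N) :
    (site 3 1 X * Z) ![a, b, c] w = ∑ i, ∑ j, X ![b, c] ![i, j] * Z ![a, i, j] w := by
  rw [site_eq (by omega), place_mul_apply (pair_injective (by omega)), sum_fin_two_arrow]
  refine sum_congr rfl fun i _ => sum_congr rfl fun j _ => ?_
  congr 2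
  · funext l; fin_cases l <;> rfl
  · funext l
    fin_cases l
    · exact Function.extend_apply' _ _ _ (by simp [Fin.exists_fin_two])
    · exact (pair_injective (by omega : 1 + 1 < 3)).extend_apply _ _ 0
    · exact (pair_injective (by omega : 1 + 1 < 3)).extend_apply _ _ 1

theorem site_zero_apply {N : ℕ} (X : Op N 2 ℂ) (a b c d e f : Fin N) :
    site 3 0 X ![a, b, c] ![d, e, f] = if c = f then X ![a, b] ![d, e] else 0 := by
  rw [site_eq (by omega), place_apply]
  refine if_congr ?_ ?_ rfl
  · simp [Fin.forall_fin_succ]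
  · congr 1 <;> funext l <;> fin_cases l <;> rfl

theorem site_one_apply {N : ℕ} (X : Op N 2 ℂ) (a b c d e f : Fin N) :
    site 3 1 X ![a, b, c] ![d, e, f] = if a = d then X ![b, c] ![e, f] else 0 := by
  rw [site_eq (by omega), place_apply]
  refine if_congr ?_ ?_ rfl
  · simp [Fin.forall_fin_succ]
  · congr 1 <;> funext l <;> fin_cases l <;> rfl

theorem skewInverse_mul {N : ℕ} {R : Op N 2 ℂ} (h : SkewInvertible R) (a b c d : Fin N) :
    ∑ s, ∑ t, skewInverse R ![a, s] ![b, t] * R ![t, c] ![s, d] =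
      if a = d ∧ c = b then 1 else 0 := by
  have := congrFun (congrFun (skewInverse_spec h).2 ![a, c]) ![b, d]
  simpa [middleTrace, perm] using this

theorem mul_skewInverse {N : ℕ} {R : Op N 2 ℂ} (h : SkewInvertible R) (a b c d : Fin N) :
    ∑ s, ∑ t, R ![a, s] ![b, t] * skewInverse R ![t, c] ![s, d] =
      if a = d ∧ c = b then 1 else 0 := by
  have := congrFun (congrFun (skewInverse_spec h).1 ![a, c]) ![b, d]
  simpa [middleTrace, perm] using this

/-- `Tr_(2) R_12 D_2 = 1`. -/
theorem sum_mul_matD {N : ℕ} {R : Op N 2 ℂ} (h : SkewInvertible R) (j k : Fin N) :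
    ∑ c, ∑ f, R ![j, c] ![k, f] * matD R f c = if j = k then 1 else 0 := by
  calc ∑ c, ∑ f, R ![j, c] ![k, f] * matD R f c
      = ∑ c, ∑ f, ∑ s, R ![j, c] ![k, f] * skewInverse R ![f, s] ![c, s] := by
        simp only [matD, Matrix.of_apply, mul_sum]
    _ = ∑ s, ∑ c, ∑ f, R ![j, c] ![k, f] * skewInverse R ![f, s] ![c, s] :=
        (sum_congr rfl fun c _ => sum_comm).trans sum_comm
    _ = ∑ s, if j = s ∧ s = k then (1 : ℂ) else 0 :=
        sum_congr rfl fun s _ => mul_skewInverse h j k s s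
    _ = if j = k then 1 else 0 := by
        simp only [ite_and, sum_ite_eq, mem_univ, if_true]

/-- `Tr_(2) (F_12 Y_1 F_12⁻¹ D_2) = Tr (Y D)` for all `Y`, in terms of the matrix entries. -/
theorem sum_twist_matD {N : ℕ} {R F G : Op N 2 ℂ} (h : SkewInvertible R) (hG : G * F = 1)
    (hF : site 3 0 G * site 3 1 R * site 3 0 F = site 3 1 F * site 3 0 R * site 3 1 G)
    (b r e p : Fin N) :
    ∑ c, ∑ k, ∑ f, F ![b, c] ![r, k] * G ![p, k] ![e, f] * matD R f c =
      if b = e then matD R p r else 0 := by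
  set W : Fin N → Fin N → ℂ := fun j l =>
    ∑ c, ∑ k, ∑ f, F ![b, c] ![j, k] * G ![l, k] ![e, f] * matD R f c with hW
  -- The entries of G_1 R_2 F_1 = F_2 R_1 G_2.
  have h1 : ∀ a c d f, ∑ i, ∑ j, ∑ k, G ![a, b] ![i, j] * R ![j, c] ![k, f] * F ![i, k] ![d, e] =
      ∑ j, ∑ l, ∑ k, R ![a, j] ![d, l] * (F ![b, c] ![j, k] * G ![l, k] ![e, f]) := by
    intro a c d f
    have := congrFun (congrFun hF ![a, b, c]) ![d, e, f]
    rw [mul_assoc, mul_assoc, site_zero_mul_apply, site_one_mul_apply] at this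
    simp only [site_zero_mul_apply, site_one_mul_apply, site_zero_apply, site_one_apply, mul_ite,
      mul_zero, sum_ite_eq', mem_univ, if_true, sum_ite_irrel, sum_const_zero] at this
    calc _ = _ := by
          refine sum_congr rfl fun i _ => sum_congr rfl fun j _ => ?_
          simp only [mul_sum, mul_assoc]
      _ = _ := this
      _ = _ := by
          refine sum_congr rfl fun j _ => ?_
          simp only [mul_sum]
          rw [sum_comm]
          refine sum_congr rfl fun l _ => sum_congr rfl fun k _ => ?_
          ring
  -- The D-weighted trace over the third factor removes R_2, since Tr_(2) R_12 D_2 = 1, and leaves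
  -- GF = 1. The other side is R contracted with the unknown W.
  have h2 : ∀ a d, ∑ j, ∑ l, R ![a, j] ![d, l] * W j l = if a = d ∧ b = e then 1 else 0 := by
    intro a d
    calc ∑ j, ∑ l, R ![a, j] ![d, l] * W j l
        = ∑ j, ∑ l, ∑ k, ∑ c, ∑ f,
            R ![a, j] ![d, l] * (F ![b, c] ![j, k] * G ![l, k] ![e, f]) * matD R f c := by
          refine sum_congr rfl fun j _ => sum_congr rfl fun l _ => ?_
          simp only [hW, mul_sum]
          rw [sum_comm]
          simp only [mul_assoc]
      _ = ∑ c, ∑ f, (∑ j, ∑ l, ∑ k, R ![a, j] ![d, l] *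
            (F ![b, c] ![j, k] * G ![l, k] ![e, f])) * matD R f c := by
          rw [← sum_comm_two_three]
          simp only [sum_mul]
      _ = ∑ c, ∑ f, ∑ i, ∑ j, ∑ k,
            G ![a, b] ![i, j] * F ![i, k] ![d, e] * (R ![j, c] ![k, f] * matD R f c) := by
          simp only [← h1, sum_mul]
          refine sum_congr rfl fun _ _ => sum_congr rfl fun _ _ => sum_congr rfl fun _ _ =>
            sum_congr rfl fun _ _ => sum_congr rfl fun _ _ => ?_
          ring
      _ = ∑ i, ∑ j, G ![a, b] ![i, j] * F ![i, j] ![d, e] := by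
          rw [sum_comm_two_three]
          simp only [← mul_sum, sum_mul_matD h, mul_ite, mul_one, mul_zero, sum_ite_eq, mem_univ,
            if_true]
      _ = (G * F) ![a, b] ![d, e] := by rw [Matrix.mul_apply, sum_fin_two_arrow]
      _ = _ := by
          rw [hG, Matrix.one_apply]
          simp
  change W r p = _
  -- The skew inverse of R undoes the contraction with R and solves for W.
  calc W r p = ∑ j, ∑ l, (if p = l ∧ j = r then 1 else 0) * W j l := by
        simp [ite_and]
    _ = ∑ j, ∑ l, ∑ a, ∑ d, skewInverse R ![p, d] ![r, a] * (R ![a, j] ![d, l] * W j l) := by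
        refine sum_congr rfl fun j _ => sum_congr rfl fun l _ => ?_
        rw [← skewInverse_mul h, sum_comm, sum_mul]
        simp only [sum_mul, mul_assoc]
    _ = ∑ a, ∑ d, skewInverse R ![p, d] ![r, a] * ∑ j, ∑ l, R ![a, j] ![d, l] * W j l := by
        rw [sum_comm_two_two]
        simp only [mul_sum]
    _ = if b = e then matD R p r else 0 := by
        simp only [h2, ite_and, matD, Matrix.of_apply]
        simp

/-- `X_1 F_2 F_1 = F_2 F_1 X_2` with the factors `F_2`, `F_1` moved to different sides. -/
theorem site_conj_of_left {N : ℕ} {X F : Op N 2 ℂ} (hF : IsUnit F)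
    (h : site 3 0 X * site 3 1 F * site 3 0 F = site 3 1 F * site 3 0 F * site 3 1 X) :
    site 3 0 F * site 3 1 X * site 3 0 F⁻¹ = site 3 1 F⁻¹ * site 3 0 X * site 3 1 F := by
  calc site 3 0 F * site 3 1 X * site 3 0 F⁻¹
      = (site 3 1 F⁻¹ * site 3 1 F) * site 3 0 F * site 3 1 X * site 3 0 F⁻¹ := by
        rw [site_inv_mul hF, one_mul]
    _ = site 3 1 F⁻¹ * (site 3 0 X * site 3 1 F * site 3 0 F) * site 3 0 F⁻¹ := by
        rw [h]; simp only [mul_assoc]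
    _ = site 3 1 F⁻¹ * site 3 0 X * site 3 1 F * (site 3 0 F * site 3 0 F⁻¹) := by
        simp only [mul_assoc]
    _ = _ := by rw [site_mul_inv hF, mul_one]

theorem site_conj_of_right {N : ℕ} {X F : Op N 2 ℂ} (hF : IsUnit F)
    (h : site 3 1 X * site 3 0 F * site 3 1 F = site 3 0 F * site 3 1 F * site 3 0 X) :
    site 3 0 F⁻¹ * site 3 1 X * site 3 0 F = site 3 1 F * site 3 0 X * site 3 1 F⁻¹ := by
  calc site 3 0 F⁻¹ * site 3 1 X * site 3 0 F
      = site 3 0 F⁻¹ * site 3 1 X * site 3 0 F * (site 3 1 F * site 3 1 F⁻¹) := by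
        rw [site_mul_inv hF, mul_one]
    _ = site 3 0 F⁻¹ * (site 3 1 X * site 3 0 F * site 3 1 F) * site 3 1 F⁻¹ := by
        simp only [mul_assoc]
    _ = (site 3 0 F⁻¹ * site 3 0 F) * site 3 1 F * site 3 0 X * site 3 1 F⁻¹ := by
        rw [h]; simp only [mul_assoc]
    _ = _ := by rw [site_inv_mul hF, one_mul]

/-- The operator `D_1 ⋯ D_n`. -/
def tensorD {N : ℕ} (n : ℕ) (D : Matrix (Fin N) (Fin N) ℂ) : Op N n ℂ :=
  Matrix.of fun a b => ∏ k, D (a k) (b k)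

/-- The twist identity with F = R and with F = R⁻¹ gives R⁻¹D_2 = D_1Ψ_21 and D_2R⁻¹ = Ψ_21D_1,
where Ψ is the skew inverse of R. Hence R⁻¹D_1D_2 and D_1D_2R⁻¹ both equal D_1Ψ_21D_1. -/
theorem commute_tensorD {N : ℕ} {R : Op N 2 ℂ} (hR : IsRMatrix R) (h : SkewInvertible R) :
    Commute R (tensorD 2 (matD R)) := by
  have hu := (Matrix.isUnit_iff_isUnit_det R).1 hR.isUnit
  have hi : R⁻¹ * R = 1 := Matrix.nonsing_inv_mul _ hu
  have hi' : R * R⁻¹ = 1 := Matrix.mul_nonsing_inv _ hu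
  have t1 := sum_twist_matD h hi (site_conj_of_right hR.isUnit hR.ybe.symm)
  have t2 := sum_twist_matD h hi' (site_conj_of_left hR.isUnit hR.ybe)
  have e1 : ∀ p x e y, ∑ f, R⁻¹ ![p, x] ![e, f] * matD R f y =
      ∑ r, matD R p r * skewInverse R ![x, r] ![y, e] := by
    intro p x e y
    calc ∑ f, R⁻¹ ![p, x] ![e, f] * matD R f y
        = ∑ c, ∑ k, (if x = k ∧ c = y then 1 else 0) *
            ∑ f, R⁻¹ ![p, k] ![e, f] * matD R f c := by
          simp [ite_and]
      _ = ∑ c, ∑ k, ∑ r, ∑ b, skewInverse R ![x, r] ![y, b] *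
            (R ![b, c] ![r, k] * ∑ f, R⁻¹ ![p, k] ![e, f] * matD R f c) := by
          refine sum_congr rfl fun c _ => sum_congr rfl fun k _ => ?_
          rw [← skewInverse_mul h, sum_mul]
          simp only [sum_mul, mul_assoc]
      _ = ∑ r, ∑ b, skewInverse R ![x, r] ![y, b] *
            ∑ c, ∑ k, ∑ f, R ![b, c] ![r, k] * R⁻¹ ![p, k] ![e, f] * matD R f c := by
          rw [sum_comm_two_two]
          simp only [mul_sum, mul_assoc]
      _ = _ := by
          simp only [t1]
          simp [mul_comm]
  have e2 : ∀ b r x y, ∑ c, matD R x c * R⁻¹ ![b, c] ![r, y] =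
      ∑ p, skewInverse R ![x, b] ![y, p] * matD R p r := by
    intro b r x y
    calc ∑ c, matD R x c * R⁻¹ ![b, c] ![r, y]
        = ∑ k, ∑ f, (if x = f ∧ k = y then 1 else 0) *
            ∑ c, R⁻¹ ![b, c] ![r, k] * matD R f c := by
          simp [ite_and, mul_comm]
      _ = ∑ k, ∑ f, ∑ e, ∑ p, skewInverse R ![x, e] ![y, p] *
            (R ![p, k] ![e, f] * ∑ c, R⁻¹ ![b, c] ![r, k] * matD R f c) := by
          refine sum_congr rfl fun k _ => sum_congr rfl fun f _ => ?_
          rw [← skewInverse_mul h, sum_mul]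
          simp only [sum_mul, mul_assoc]
      _ = ∑ e, ∑ p, skewInverse R ![x, e] ![y, p] *
            ∑ c, ∑ k, ∑ f, R⁻¹ ![b, c] ![r, k] * R ![p, k] ![e, f] * matD R f c := by
          rw [sum_comm_two_two]
          refine sum_congr rfl fun e _ => sum_congr rfl fun p _ => ?_
          simp only [mul_sum]
          rw [sum_comm_one_two]
          refine sum_congr rfl fun c _ => sum_congr rfl fun k _ => sum_congr rfl fun f _ => ?_
          ring
      _ = _ := by
          simp only [t2]
          simp
  have h0 : R⁻¹ * tensorD 2 (matD R) = tensorD 2 (matD R) * R⁻¹ := by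
    ext a b
    obtain ⟨p, x, rfl⟩ : ∃ p x, a = ![p, x] := ⟨a 0, a 1, by ext i; fin_cases i <;> rfl⟩
    obtain ⟨u, y, rfl⟩ : ∃ u y, b = ![u, y] := ⟨b 0, b 1, by ext i; fin_cases i <;> rfl⟩
    rw [Matrix.mul_apply, Matrix.mul_apply, sum_fin_two_arrow, sum_fin_two_arrow]
    simp only [tensorD, Matrix.of_apply, Fin.prod_univ_two, Matrix.cons_val_zero,
      Matrix.cons_val_one]
    calc ∑ e, ∑ f, R⁻¹ ![p, x] ![e, f] * (matD R e u * matD R f y)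
        = ∑ e, (∑ f, R⁻¹ ![p, x] ![e, f] * matD R f y) * matD R e u := by
          simp only [sum_mul]
          refine sum_congr rfl fun e _ => sum_congr rfl fun f _ => ?_
          ring
      _ = ∑ r, matD R p r * ∑ e, skewInverse R ![x, r] ![y, e] * matD R e u := by
          simp only [e1, sum_mul, mul_sum, mul_assoc]
          exact sum_comm
      _ = ∑ r, ∑ c, matD R p r * matD R x c * R⁻¹ ![r, c] ![u, y] := by
          simp only [← e2, mul_sum, mul_assoc]
  calc R * tensorD 2 (matD R) = R * (tensorD 2 (matD R) * R⁻¹) * R := by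
        rw [mul_assoc, mul_assoc, hi, mul_one]
    _ = tensorD 2 (matD R) * R := by rw [← h0, ← mul_assoc, hi', one_mul]

end Entries


/-! ### Operators with coefficients in an algebra and the R-trace -/

section Coefficients

open Finset

theorem site_commute' {N : ℕ} (X Y : Op N 2 ℂ) (n : ℕ) {m l : ℕ} (h : m + 1 < l) :
    Commute (site n m X) (site n l Y) := by
  by_cases hl : l + 1 < n
  · exact site_commute X Y h hl
  · rw [site, site, dif_neg hl]
    exact Commute.one_right _

theorem commute_of_semiconjBy {B : Type*} [Monoid B] (g : Bˣ) {a a' b b' : B}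
    (ha : SemiconjBy (g : B) a a') (hb : SemiconjBy (g : B) b b') (h : Commute a b) :
    Commute a' b' := by
  have ha' : a' = g * a * ↑g⁻¹ := by rw [ha.eq, Units.mul_inv_cancel_right]
  have hb' : b' = g * b * ↑g⁻¹ := by rw [hb.eq, Units.mul_inv_cancel_right]
  rw [ha', hb', commute_iff_eq]
  simp only [mul_assoc, Units.inv_mul_cancel_left]
  rw [← mul_assoc a, h.eq, mul_assoc]

/-- Operators on the initial `m` tensor factors as operators on `n ≥ m` tensor factors. -/
def liftOp {N m n : ℕ} {A : Type*} [Zero A] (h : m ≤ n) (X : Op N m A) : Op N n A :=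
  place (Fin.castLE h) X

theorem liftOp_mul {N m n : ℕ} {A : Type*} [NonUnitalNonAssocSemiring A] (h : m ≤ n)
    (X Y : Op N m A) : liftOp h (X * Y) = liftOp h X * liftOp h Y :=
  place_mul _ (Fin.castLE_injective h) X Y

theorem liftOp_one {N m n : ℕ} {A : Type*} [Zero A] [One A] (h : m ≤ n) :
    liftOp h (1 : Op N m A) = 1 := place_one _

theorem liftOp_liftOp {N l m n : ℕ} {A : Type*} [Zero A] (h : l ≤ m) (h' : m ≤ n)
    (X : Op N l A) : liftOp h' (liftOp h X) = liftOp (h.trans h') X :=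
  place_place _ (Fin.castLE_injective h') _ X

theorem liftOp_site {N m n : ℕ} (h : m ≤ n) {i : ℕ} (hi : i + 1 < m) (X : Op N 2 ℂ) :
    liftOp h (site m i X) = site n i X := by
  rw [site_eq hi, site_eq (hi.trans_le h), liftOp, place_place _ (Fin.castLE_injective h)]
  congr 1
  funext j
  fin_cases j <;> rfl

variable {N n : ℕ} {A : Type*} [Ring A] [Algebra ℂ A]

/-- The extension of scalars of operators, as a ring homomorphism. -/
def scalHom (N n : ℕ) (A : Type*) [Ring A] [Algebra ℂ A] : Op N n ℂ →+* Op N n A :=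
  (algebraMap ℂ A).mapMatrix

theorem scalHom_apply (X : Op N n ℂ) : scalHom N n A X = scal A X := rfl

theorem scal_mul (X Y : Op N n ℂ) : scal A (X * Y) = scal A X * scal A Y :=
  map_mul (scalHom N n A) X Y

theorem scal_one : scal A (1 : Op N n ℂ) = 1 := map_one (scalHom N n A)

theorem scal_place {k : ℕ} (e : Fin k → Fin n) (X : Op N k ℂ) :
    scal A (place e X) = place e (scal A X) := by
  ext a b
  simp only [scal, Matrix.map_apply, place_apply]
  split_ifs <;> simp

theorem scal_liftOp {m : ℕ} (h : m ≤ n) (X : Op N m ℂ) :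
    scal A (liftOp h X) = liftOp h (scal A X) := scal_place _ X

theorem scal_commute {X Y : Op N n ℂ} (h : Commute X Y) : Commute (scal A X) (scal A Y) :=
  h.map (scalHom N n A)

/-- Entries of X are central scalars, so this cyclicity needs no commutativity of A. -/
theorem trace_scal_mul (X : Op N n ℂ) (Z : Op N n A) :
    (scal A X * Z).trace = (Z * scal A X).trace := by
  simp only [Matrix.trace, Matrix.diag_apply, Matrix.mul_apply, scal, Matrix.map_apply,
    Algebra.commutes]
  exact sum_comm

theorem rTrace_eq_trace (R : Op N 2 ℂ) (Z : Op N n A) :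
    rTrace R Z = (scal A (tensorD n (matD R)) * Z).trace := by
  simp only [rTrace, Matrix.trace, Matrix.diag_apply, Matrix.mul_apply, scal, Matrix.map_apply,
    tensorD, Matrix.of_apply, Algebra.smul_def]

theorem tensorD_extend {k : ℕ} {e : Fin k → Fin n} (he : Function.Injective e)
    (D : Matrix (Fin N) (Fin N) ℂ) (d : Fin k → Fin N) (a b : Fin n → Fin N) :
    tensorD n D (Function.extend e d a) b =
      tensorD k D d (b ∘ e) * ∏ j ∈ (univ.map ⟨e, he⟩)ᶜ, D (a j) (b j) := by
  rw [tensorD, Matrix.of_apply, ← prod_mul_prod_compl (univ.map ⟨e, he⟩), prod_map]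
  congr 1
  · refine prod_congr rfl fun i _ => ?_
    rw [Function.Embedding.coeFn_mk, he.extend_apply]; rfl
  · refine prod_congr rfl fun j hj => ?_
    rw [Function.extend_apply']
    simpa using hj

theorem tensorD_extend' {k : ℕ} {e : Fin k → Fin n} (he : Function.Injective e)
    (D : Matrix (Fin N) (Fin N) ℂ) (d : Fin k → Fin N) (a b : Fin n → Fin N) :
    tensorD n D a (Function.extend e d b) =
      tensorD k D (a ∘ e) d * ∏ j ∈ (univ.map ⟨e, he⟩)ᶜ, D (a j) (b j) :=
  tensorD_extend he D.transpose d b a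

theorem place_commute_tensorD {k : ℕ} {e : Fin k → Fin n} (he : Function.Injective e)
    {D : Matrix (Fin N) (Fin N) ℂ} {X : Op N k ℂ} (h : Commute X (tensorD k D)) :
    Commute (place e X) (tensorD n D) := by
  ext a b
  rw [place_mul_apply he, mul_place_apply he]
  have h1 := congrFun (congrFun h.eq (a ∘ e)) (b ∘ e)
  rw [Matrix.mul_apply, Matrix.mul_apply] at h1
  simp only [tensorD_extend he, tensorD_extend' he, mul_right_comm _ _ (X _ _), ← mul_assoc,
    ← sum_mul]
  rw [h1]

theorem rTrace_mul_scal {R : Op N 2 ℂ} {X : Op N n ℂ} (h : Commute X (tensorD n (matD R)))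
    (Z : Op N n A) : rTrace R (Z * scal A X) = rTrace R (scal A X * Z) := by
  rw [rTrace_eq_trace, rTrace_eq_trace, ← mul_assoc, ← trace_scal_mul, ← mul_assoc, ← scal_mul,
    h.eq, scal_mul, mul_assoc]

theorem rTrace_mul_scal_site {R : Op N 2 ℂ} (hR : IsRMatrix R) (h : SkewInvertible R) (i : ℕ)
    (Z : Op N n A) :
    rTrace R (Z * scal A (site n i R)) = rTrace R (scal A (site n i R) * Z) := by
  refine rTrace_mul_scal ?_ Z
  by_cases hi : i + 1 < n
  · rw [site_eq hi]
    exact place_commute_tensorD (pair_injective hi) (commute_tensorD hR h)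
  · rw [site, dif_neg hi]
    exact Commute.one_left _

theorem scal_place_commute {k l : ℕ} (e : Fin k → Fin n) (f : Fin l → Fin n)
    (hef : ∀ i j, e i ≠ f j) (X : Op N k ℂ) (Y : Op N l A) :
    Commute (scal A (place e X)) (place f Y) := by
  rw [scal_place]
  ext a b
  rw [place_mul_disjoint e f hef, place_mul_disjoint f e (fun i j => (hef j i).symm)]
  refine if_congr ⟨fun h j h1 h2 => h j h2 h1, fun h j h1 h2 => h j h2 h1⟩ ?_ rfl
  exact Algebra.commutes _ _

end Coefficients

/-! ### Copies of a matrix and twist relations -/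

section Copies

variable {N : ℕ} {A : Type*} [Ring A] [Algebra ℂ A] {F : Op N 2 ℂ}

/-- The invertible operator `F_m` with coefficients in `A`. -/
noncomputable def scalUnit (A : Type*) [Ring A] [Algebra ℂ A] (hF : IsRMatrix F) (n m : ℕ) :
    (Op N n A)ˣ := Units.map (scalHom N n A).toMonoidHom (siteUnit hF n m)

theorem coe_scalUnit (hF : IsRMatrix F) (n m : ℕ) :
    ((scalUnit A hF n m : (Op N n A)ˣ) : Op N n A) = scal A (site n m F) := rfl

theorem copy_semiconjBy (hF : IsRMatrix F) (M : Matrix (Fin N) (Fin N) A) (n k : ℕ) :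
    SemiconjBy (scal A (site n k F)) (copy F M n k) (copy F M n (k + 1)) := by
  have h : copy F M n (k + 1) = scalUnit A hF n k * copy F M n k * ↑(scalUnit A hF n k)⁻¹ := rfl
  rw [h, ← coe_scalUnit hF, SemiconjBy, Units.inv_mul_cancel_right]

theorem site_semiconjBy_left {X F : Op N 2 ℂ}
    (h : site 3 0 X * site 3 1 F * site 3 0 F = site 3 1 F * site 3 0 F * site 3 1 X) {n i : ℕ}
    (hi : i + 2 < n) :
    SemiconjBy (site n (i + 1) F * site n i F) (site n (i + 1) X) (site n i X) := by
  have := congrArg (place (triple hi)) h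
  simp only [place_mul _ (triple_injective hi), place_triple_zero, place_triple_one] at this
  rw [SemiconjBy, ← this, mul_assoc]

theorem site_semiconjBy_right {X F : Op N 2 ℂ}
    (h : site 3 1 X * site 3 0 F * site 3 1 F = site 3 0 F * site 3 1 F * site 3 0 X) {n i : ℕ}
    (hi : i + 2 < n) :
    SemiconjBy (site n i F * site n (i + 1) F) (site n i X) (site n (i + 1) X) := by
  have := congrArg (place (triple hi)) h
  simp only [place_mul _ (triple_injective hi), place_triple_zero, place_triple_one] at this
  rw [SemiconjBy, ← this, mul_assoc]

theorem site_commute_copy (X : Op N 2 ℂ) (M : Matrix (Fin N) (Fin N) A) (n : ℕ) {k l : ℕ}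
    (h : k < l) : Commute (scal A (site n l X)) (copy F M n k) := by
  by_cases hl : l + 1 < n
  · induction k with
    | zero =>
      rw [copy, siteOne, dif_pos (by omega), site_eq hl]
      refine scal_place_commute _ _ ?_ _ _
      intro i j
      fin_cases i <;> fin_cases j <;> simp
      omega
    | succ k ih =>
      exact ((scal_commute (site_commute' F X n h).symm).mul_right (ih (by omega))).mul_right
        (scal_commute (site_commute' F⁻¹ X n h).symm)
  · rw [site, dif_neg hl, scal_one]
    exact Commute.one_left _

/-- For k = i + 2, conjugation by F_{i+1}F_i carries X_{i+1} to X_i and the copy i to the copy i +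
2, and the originals commute by disjointness. For larger k conjugation by F_{k-1} leaves X_i alone.
-/
theorem site_commute_copy_of_left (hF : IsRMatrix F) {X : Op N 2 ℂ}
    (h : site 3 0 X * site 3 1 F * site 3 0 F = site 3 1 F * site 3 0 F * site 3 1 X)
    (M : Matrix (Fin N) (Fin N) A) {n i k : ℕ} (hi : i + 1 < k) (hk : k < n) :
    Commute (scal A (site n i X)) (copy F M n k) := by
  induction k with
  | zero => omega
  | succ k ih =>
    rcases eq_or_ne (i + 1) k with rfl | hne
    · refine commute_of_semiconjBy (scalUnit A hF n (i + 1) * scalUnit A hF n i)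
        (a := scal A (site n (i + 1) X)) (b := copy F M n i) ?_ ?_
        (site_commute_copy X M n (by omega))
      · have := congrArg (scal A) (site_semiconjBy_left h hk).eq
        simp only [scal_mul] at this
        exact this
      · exact (copy_semiconjBy hF M n (i + 1)).mul_left (copy_semiconjBy hF M n i)
    · exact commute_of_semiconjBy (scalUnit A hF n k)
        (scal_commute (site_commute' X F n (by omega)).symm) (copy_semiconjBy hF M n k)
        (ih (by omega) (by omega))

theorem liftOp_copy (M : Matrix (Fin N) (Fin N) A) {m n k : ℕ} (h : m ≤ n) (hk : k < m) :
    liftOp h (copy F M m k) = copy F M n k := by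
  induction k with
  | zero =>
    rw [copy, copy, siteOne, siteOne, dif_pos hk, dif_pos (by omega), liftOp,
      place_place _ (Fin.castLE_injective h)]
    congr 1
    funext j
    fin_cases j; rfl
  | succ k ih =>
    rw [copy, copy, liftOp_mul, liftOp_mul, ih (by omega), ← scal_liftOp, ← scal_liftOp,
      liftOp_site h hk, liftOp_site h hk]

theorem copy_map {C : Type*} [Ring C] [Algebra ℂ C] (f : A →ₐ[ℂ] C)
    (M : Matrix (Fin N) (Fin N) A) (n k : ℕ) :
    (copy F M n k).map f = copy F (M.map f) n k := by
  have hs : ∀ X : Op N n ℂ, (scal A X).map f = scal C X := fun X => by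
    ext a b; simp [scal]
  induction k with
  | zero =>
    rw [copy, copy, siteOne, siteOne]
    split_ifs
    · ext a b
      simp only [Matrix.map_apply, place_apply, Matrix.of_apply]
      split_ifs <;> simp
    · ext a b
      simp only [Matrix.map_apply, Matrix.one_apply]
      split_ifs <;> simp
  | succ k ih =>
    rw [copy, copy, ← ih, ← hs, ← hs]
    simp only [← AlgHom.mapMatrix_apply, map_mul]

theorem copy_shift_semiconjBy (hF : IsRMatrix F) (M : Matrix (Fin N) (Fin N) A) {n i : ℕ}
    (hi : i + 2 < n) :
    SemiconjBy (scal A (site n i F * site n (i + 1) F)) (copy F M n i * copy F M n (i + 1))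
      (copy F M n (i + 1) * copy F M n (i + 2)) := by
  rw [scal_mul]
  refine SemiconjBy.mul_right ?_ ?_
  · exact (copy_semiconjBy hF M n i).mul_left (site_commute_copy F M n (by omega))
  · exact SemiconjBy.mul_left (site_commute_copy_of_left hF hF.ybe M (by omega) hi)
      (copy_semiconjBy hF M n (i + 1))

end Copies

/-! ### The string of copies and the trace property of ch -/

section String

variable {N : ℕ} {R F : Op N 2 ℂ}

theorem genMatrix_rel :
    scal (QMA R F) R * (copy F (genMatrix R F) 2 0 * copy F (genMatrix R F) 2 1) =
      copy F (genMatrix R F) 2 0 * copy F (genMatrix R F) 2 1 * scal (QMA R F) R := by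
  set f := RingQuot.mkAlgHom ℂ (QMRel R F)
  have hM : genMatrix R F = (freeMatrix N).map f := rfl
  have hs : (scal (FreeAlgebra ℂ (Fin N × Fin N)) R).map f = scal (QMA R F) R := by
    ext a b; simp [scal]
  rw [hM, ← copy_map, ← copy_map, ← hs]
  simp only [← AlgHom.mapMatrix_apply, ← map_mul]
  ext a b
  exact RingQuot.mkAlgHom_rel ℂ (QMRel.entry a b)

theorem site_two_zero (X : Op N 2 ℂ) : site 2 0 X = X := by
  rw [site_eq (by omega)]
  ext a b
  have h : (![⟨0, by omega⟩, ⟨0 + 1, by omega⟩] : Fin 2 → Fin 2) = id := by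
    funext i; fin_cases i <;> rfl
  rw [place_apply, h, if_pos]
  · rfl
  · intro j hj
    exact absurd rfl (hj j)

/-- For i = 0 this is the defining relation of the quantum matrix algebra; conjugation by F_iF_{i+1}
shifts R_i together with both copies by one place. -/
theorem site_commute_copies (hF : IsRMatrix F) (hRF : IsCompatible R F) {n i : ℕ}
    (hi : i + 1 < n) : Commute (scal (QMA R F) (site n i R))
      (copy F (genMatrix R F) n i * copy F (genMatrix R F) n (i + 1)) := by
  induction i with
  | zero =>
    have h := congrArg (liftOp (show 2 ≤ n by omega)) (genMatrix_rel (R := R) (F := F))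
    rw [← site_two_zero R] at h
    simp only [liftOp_mul, ← scal_liftOp] at h
    rw [liftOp_site _ (by omega), liftOp_copy _ _ (by omega), liftOp_copy _ _ (by omega),
      site_two_zero] at h
    exact h
  | succ i ih =>
    refine commute_of_semiconjBy (scalUnit _ hF n i * scalUnit _ hF n (i + 1)) ?_ ?_
      (ih (by omega))
    · have := congrArg (scal (QMA R F)) (site_semiconjBy_right hRF.right hi).eq
      simp only [scal_mul] at this
      exact this
    · have := copy_shift_semiconjBy hF (genMatrix R F) hi
      rwa [scal_mul] at this

theorem site_commute_stringM (hF : IsRMatrix F) (hRF : IsCompatible R F) (n i : ℕ) :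
    Commute (scal (QMA R F) (site n i R)) (stringM R F n) := by
  by_cases hi : i + 1 < n
  · obtain ⟨d, hd⟩ : ∃ d, n = i + 2 + d := ⟨n - (i + 2), by omega⟩
    -- The copies before i commute with R_i by locality, those after i + 1 by the left twist
    -- relation, and the pair i, i + 1 only as a product.
    have hr : List.range n = List.range i ++ [i, i + 1] ++ (List.range d).map (i + 2 + ·) := by
      rw [hd, List.range_add, List.range_succ, List.range_succ, List.append_assoc]
      simp
    rw [stringM, hr, List.map_append, List.map_append, List.prod_append, List.prod_append]
    refine Commute.mul_right (Commute.mul_right ?_ ?_) ?_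
    · refine Commute.list_prod_right _ _ fun x hx => ?_
      obtain ⟨k, hk, rfl⟩ := List.mem_map.1 hx
      exact site_commute_copy R _ n (List.mem_range.1 hk)
    · simpa using site_commute_copies hF hRF hi
    · refine Commute.list_prod_right _ _ fun x hx => ?_
      obtain ⟨k, hk, rfl⟩ := List.mem_map.1 hx
      obtain ⟨j, hj, rfl⟩ := List.mem_map.1 hk
      have := List.mem_range.1 hj
      exact site_commute_copy_of_left hF hRF.left _ (by omega) (by omega)
  · rw [site, dif_neg hi, scal_one]
    exact Commute.one_left _

/-- The algebra generated by the operators `R_i`. -/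
def siteAlgebra (R : Op N 2 ℂ) (n : ℕ) : Subalgebra ℂ (Op N n ℂ) :=
  Algebra.adjoin ℂ (Set.range fun i => site n i R)

theorem site_mem (R : Op N 2 ℂ) (n i : ℕ) : site n i R ∈ siteAlgebra R n :=
  Algebra.subset_adjoin ⟨i, rfl⟩

theorem chOp_add {n : ℕ} (X Y : Op N n ℂ) : chOp R F (X + Y) = chOp R F X + chOp R F Y := by
  have : scal (QMA R F) (X + Y) = scal _ X + scal _ Y := map_add (scalHom N n _) X Y
  simp [chOp, rTrace_eq_trace, this, mul_add]

theorem chOp_smul {n : ℕ} (c : ℂ) (X : Op N n ℂ) : chOp R F (c • X) = c • chOp R F X := by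
  have : scal (QMA R F) (c • X) = c • scal _ X := by
    ext a b
    simp only [scal, Matrix.map_apply, Matrix.smul_apply, smul_eq_mul, map_mul]
    rw [Algebra.smul_def]
  simp [chOp, rTrace_eq_trace, this]

/-- `Y ↦ ch(Y)` as a linear map on the operators. -/
noncomputable def chLin (R F : Op N 2 ℂ) (n : ℕ) : Op N n ℂ →ₗ[ℂ] QMA R F where
  toFun := chOp R F
  map_add' := chOp_add
  map_smul' := chOp_smul

theorem chLin_mul_site (hR : IsRMatrix R) (hs : SkewInvertible R) (hF : IsRMatrix F)
    (hRF : IsCompatible R F) (n i : ℕ) (X : Op N n ℂ) :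
    chLin R F n (X * site n i R) = chLin R F n (site n i R * X) := by
  change rTrace R _ = rTrace R _
  rw [scal_mul, scal_mul, ← mul_assoc, rTrace_mul_scal_site hR hs, ← mul_assoc, ← mul_assoc,
    (site_commute_stringM hF hRF n i).eq]

theorem chLin_mul_comm (hR : IsRMatrix R) (hs : SkewInvertible R) (hF : IsRMatrix F)
    (hRF : IsCompatible R F) {n : ℕ} {Y : Op N n ℂ} (hY : Y ∈ siteAlgebra R n) (X : Op N n ℂ) :
    chLin R F n (X * Y) = chLin R F n (Y * X) := by
  induction hY using Algebra.adjoin_induction generalizing X with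
  | mem x hx =>
    obtain ⟨i, rfl⟩ := hx
    exact chLin_mul_site hR hs hF hRF n i X
  | algebraMap c => rw [Algebra.commutes]
  | add x y _ _ hx hy => rw [mul_add, add_mul, map_add, map_add, hx, hy]
  | mul x y _ _ hx hy => rw [← mul_assoc, hy, ← mul_assoc, hx, mul_assoc]

end String


/-! ### Weighted partial traces -/

section PartialTrace

open Finset

variable {N : ℕ} {A : Type*} [Ring A]

/-- A multi-index with one more component. -/
def snocIdx {n : ℕ} (a : Fin n → Fin N) (t : Fin N) : Fin (n + 1) → Fin N :=
  Fin.snoc (α := fun _ => Fin N) a t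

theorem snocIdx_castSucc {n : ℕ} (a : Fin n → Fin N) (t : Fin N) (i : Fin n) :
    snocIdx a t i.castSucc = a i := Fin.snoc_castSucc (α := fun _ => Fin N) t a i

theorem snocIdx_last {n : ℕ} (a : Fin n → Fin N) (t : Fin N) :
    snocIdx a t (Fin.last n) = t := Fin.snoc_last (α := fun _ => Fin N) t a

theorem exists_eq_snocIdx {n : ℕ} (a : Fin (n + 1) → Fin N) : ∃ a' t, a = snocIdx a' t :=
  ⟨Fin.init a, a (Fin.last n), (Fin.snoc_init_self a).symm⟩

theorem snocIdx_comp {n : ℕ} (a : Fin n → Fin N) (t : Fin N) :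
    snocIdx a t ∘ Fin.castLE n.le_succ = a :=
  funext fun i => snocIdx_castSucc a t i

theorem sum_snocIdx {n : ℕ} {C : Type*} [AddCommMonoid C] (f : (Fin (n + 1) → Fin N) → C) :
    ∑ a, f a = ∑ a, ∑ t, f (snocIdx a t) := by
  rw [← (Fin.snocEquiv fun _ => Fin N).sum_comp, Fintype.sum_prod_type, sum_comm]
  rfl

theorem extend_snocIdx {n : ℕ} (a d : Fin n → Fin N) (t : Fin N) :
    Function.extend (Fin.castLE n.le_succ) d (snocIdx a t) = snocIdx d t := by
  funext i
  refine Fin.lastCases ?_ (fun j => ?_) i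
  · rw [Function.extend_apply', snocIdx_last, snocIdx_last]
    rintro ⟨j, hj⟩
    exact absurd hj (Fin.castSucc_lt_last j).ne
  · rw [snocIdx_castSucc]
    exact (Fin.castLE_injective n.le_succ).extend_apply _ _ _

theorem liftOp_mul_apply {n : ℕ} (X : Op N n A) (Z : Op N (n + 1) A) (a : Fin n → Fin N)
    (t : Fin N) (b : Fin (n + 1) → Fin N) :
    (liftOp n.le_succ X * Z) (snocIdx a t) b = ∑ d, X a d * Z (snocIdx d t) b := by
  rw [liftOp, place_mul_apply (Fin.castLE_injective _), snocIdx_comp]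
  simp only [extend_snocIdx]

theorem mul_liftOp_apply {n : ℕ} (X : Op N n A) (Z : Op N (n + 1) A) (a : Fin (n + 1) → Fin N)
    (b : Fin n → Fin N) (t : Fin N) :
    (Z * liftOp n.le_succ X) a (snocIdx b t) = ∑ d, Z a (snocIdx d t) * X d b := by
  rw [liftOp, mul_place_apply (Fin.castLE_injective _), snocIdx_comp]
  simp only [extend_snocIdx]

theorem liftOp_apply {n : ℕ} (X : Op N n A) (a b : Fin n → Fin N) (s t : Fin N) :
    liftOp n.le_succ X (snocIdx a s) (snocIdx b t) = if s = t then X a b else 0 := by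
  rw [liftOp, place_apply, snocIdx_comp, snocIdx_comp]
  refine if_congr ⟨fun h => ?_, fun h j hj => ?_⟩ rfl rfl
  · have := h (Fin.last n) fun i => (Fin.castSucc_lt_last i).ne
    rwa [snocIdx_last, snocIdx_last] at this
  · revert hj
    refine Fin.lastCases (fun _ => ?_) (fun i hi => absurd rfl (hi i)) j
    rw [snocIdx_last, snocIdx_last, h]

theorem liftOp_self {n : ℕ} (X : Op N n A) : liftOp le_rfl X = X := by
  ext a b
  rw [liftOp, place_apply, if_pos]
  · rfl
  · intro j hj
    exact absurd rfl (hj j)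

variable [Algebra ℂ A]

/-- The trace with the weight `D` over the last tensor factor. -/
def lastTrace {n : ℕ} (D : Matrix (Fin N) (Fin N) ℂ) (X : Op N (n + 1) A) : Op N n A :=
  Matrix.of fun a b => ∑ s, ∑ t, D s t • X (snocIdx a t) (snocIdx b s)

theorem rTrace_succ {n : ℕ} (R : Op N 2 ℂ) (X : Op N (n + 1) A) :
    rTrace R X = rTrace R (lastTrace (matD R) X) := by
  simp only [rTrace, lastTrace, Matrix.of_apply, sum_snocIdx, Fin.prod_univ_castSucc,
    snocIdx_castSucc, snocIdx_last, smul_sum, smul_smul]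
  exact sum_congr rfl fun a _ => sum_comm

theorem lastTrace_liftOp_mul {n : ℕ} (D : Matrix (Fin N) (Fin N) ℂ) (X : Op N n A)
    (Z : Op N (n + 1) A) : lastTrace D (liftOp n.le_succ X * Z) = X * lastTrace D Z := by
  ext a b
  simp only [lastTrace, Matrix.of_apply, liftOp_mul_apply]
  rw [Matrix.mul_apply]
  simp only [Matrix.of_apply, smul_sum, mul_sum, mul_smul_comm]
  exact (sum_congr rfl fun s _ => sum_comm).trans sum_comm

theorem lastTrace_mul_liftOp {n : ℕ} (D : Matrix (Fin N) (Fin N) ℂ) (X : Op N n A)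
    (Z : Op N (n + 1) A) : lastTrace D (Z * liftOp n.le_succ X) = lastTrace D Z * X := by
  ext a b
  simp only [lastTrace, Matrix.of_apply, mul_liftOp_apply]
  rw [Matrix.mul_apply]
  simp only [Matrix.of_apply, smul_sum, sum_mul, smul_mul_assoc]
  exact (sum_congr rfl fun s _ => sum_comm).trans sum_comm

theorem extend_last_two {n : ℕ} (a : Fin n → Fin N) (x t : Fin N) (d : Fin 2 → Fin N) :
    Function.extend (![⟨n, by omega⟩, ⟨n + 1, by omega⟩] : Fin 2 → Fin (n + 2)) d
      (snocIdx (snocIdx a x) t) = snocIdx (snocIdx a (d 0)) (d 1) := by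
  have hi := pair_injective (show n + 1 < n + 2 by omega)
  funext i
  refine Fin.lastCases ?_ (fun j => Fin.lastCases ?_ (fun k => ?_) j) i
  · rw [snocIdx_last]
    exact hi.extend_apply d _ 1
  · rw [snocIdx_castSucc, snocIdx_last]
    exact hi.extend_apply d _ 0
  · rw [Function.extend_apply']
    · simp only [snocIdx_castSucc]
    · rintro ⟨j, hj⟩
      have := congrArg Fin.val hj
      fin_cases j <;> simp at this <;> omega

theorem snocIdx_comp_last_two {n : ℕ} (a : Fin n → Fin N) (x t : Fin N) :
    snocIdx (snocIdx a x) t ∘ (![⟨n, by omega⟩, ⟨n + 1, by omega⟩] : Fin 2 → Fin (n + 2)) =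
      ![x, t] := by
  funext j
  fin_cases j
  · exact (snocIdx_castSucc (snocIdx a x) t (Fin.last n)).trans (snocIdx_last a x)
  · exact snocIdx_last (snocIdx a x) t

/-- This is `sum_twist_matD` with spectator factors. The parameter m stays apart from p + 1 because
the application has m = n + 1 + k and p = n + k, where the equality is not definitional. -/
theorem lastTrace_twist {F R : Op N 2 ℂ} (hR : SkewInvertible R) (hF : IsRMatrix F)
    (hRF : IsCompatible R F) {p m : ℕ} (h : m = p + 1) (X : Op N (p + 1) A) :
    lastTrace (matD R) (scal A (site (m + 1) p F) * liftOp (show p + 1 ≤ m + 1 by omega) X *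
      scal A (site (m + 1) p F⁻¹)) =
      liftOp (show p ≤ m by omega) (lastTrace (matD R) X) := by
  subst h
  have hi : F⁻¹ * F = 1 :=
    Matrix.nonsing_inv_mul _ ((Matrix.isUnit_iff_isUnit_det F).1 hF.isUnit)
  have tw := sum_twist_matD hR hi (site_conj_of_right hF.isUnit hRF.right)
  have hpi := pair_injective (show p + 1 < p + 1 + 1 by omega)
  ext a b
  obtain ⟨a, x, rfl⟩ := exists_eq_snocIdx a
  obtain ⟨b, y, rfl⟩ := exists_eq_snocIdx b
  rw [liftOp_apply]
  simp only [lastTrace, Matrix.of_apply]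
  have key : ∀ s t, (scal A (site (p + 1 + 1) p F) * liftOp (show p + 1 ≤ p + 1 + 1 by omega) X *
      scal A (site (p + 1 + 1) p F⁻¹)) (snocIdx (snocIdx a x) t) (snocIdx (snocIdx b y) s) =
      ∑ i, ∑ k, ∑ j, (F ![x, t] ![i, j] * F⁻¹ ![k, j] ![y, s]) •
        X (snocIdx a i) (snocIdx b k) := by
    intro s t
    rw [site_eq (by omega), site_eq (by omega), scal_place, scal_place, mul_assoc,
      place_mul_apply hpi, sum_fin_two_arrow]
    refine sum_congr rfl fun i _ => ?_
    rw [sum_comm]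
    refine sum_congr rfl fun j _ => ?_
    rw [extend_last_two, mul_place_apply hpi, sum_fin_two_arrow, mul_sum]
    refine sum_congr rfl fun k _ => ?_
    simp only [extend_last_two, snocIdx_comp_last_two, liftOp_apply, Matrix.cons_val_zero,
      Matrix.cons_val_one, mul_ite, mul_zero, sum_ite_eq, mem_univ, if_true, scal,
      Matrix.map_apply, ← Algebra.commutes (F⁻¹ _ _)]
    rw [← mul_assoc, ← map_mul, ← Algebra.smul_def]
  calc _ = ∑ s, ∑ t, ∑ i, ∑ k, ∑ j, (F ![x, t] ![i, j] * F⁻¹ ![k, j] ![y, s] * matD R s t) •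
        X (snocIdx a i) (snocIdx b k) := by
        refine sum_congr rfl fun s _ => sum_congr rfl fun t _ => ?_
        rw [key]
        simp only [smul_sum, smul_smul, mul_comm]
    _ = ∑ i, ∑ k, (∑ t, ∑ j, ∑ s, F ![x, t] ![i, j] * F⁻¹ ![k, j] ![y, s] * matD R s t) •
        X (snocIdx a i) (snocIdx b k) := by
        rw [sum_comm_two_three]
        refine sum_congr rfl fun i _ => sum_congr rfl fun k _ => ?_
        simp only [sum_smul]
        rw [sum_comm_one_two]
    _ = _ := by
        simp only [tw]
        split_ifs with hxy
        · exact sum_comm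
        · simp

/-- The trace with the weight `D` over the tensor factors `n, …, n + k - 1`. -/
def partialTrace (D : Matrix (Fin N) (Fin N) ℂ) (n : ℕ) : (k : ℕ) → Op N (n + k) A → Op N n A
  | 0, X => X
  | k + 1, X => partialTrace D n k (lastTrace D X)

theorem rTrace_partialTrace (R : Op N 2 ℂ) (n k : ℕ) (X : Op N (n + k) A) :
    rTrace R X = rTrace R (partialTrace (matD R) n k X) := by
  induction k with
  | zero => rfl
  | succ k ih => exact (rTrace_succ (n := n + k) R X).trans (ih _)

theorem partialTrace_liftOp_mul (D : Matrix (Fin N) (Fin N) ℂ) (n k : ℕ) (X : Op N n A)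
    (Z : Op N (n + k) A) :
    partialTrace D n k (liftOp (n.le_add_right k) X * Z) = X * partialTrace D n k Z := by
  induction k with
  | zero => exact congrArg (· * Z) (liftOp_self X)
  | succ k ih =>
    have h : liftOp (n.le_add_right (k + 1)) X =
        liftOp (n + k).le_succ (liftOp (n.le_add_right k) X) := (liftOp_liftOp _ _ X).symm
    rw [partialTrace, h]
    exact (congrArg (partialTrace D n k) (lastTrace_liftOp_mul D _ Z)).trans (ih _)

/-- The product `F_a F_(a+1) ⋯ F_(a+k-1)`. -/
noncomputable def twistUnit {F : Op N 2 ℂ} (hF : IsRMatrix F) (n a : ℕ) : ℕ → (Op N n ℂ)ˣ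
  | 0 => 1
  | k + 1 => twistUnit hF n a k * siteUnit hF n (a + k)

theorem liftOp_twistUnit {F : Op N 2 ℂ} (hF : IsRMatrix F) {m n a k : ℕ} (h : m ≤ n)
    (hk : a + k < m) :
    liftOp h (twistUnit hF m a k : Op N m ℂ) = (twistUnit hF n a k : Op N n ℂ) ∧
      liftOp h (↑(twistUnit hF m a k)⁻¹ : Op N m ℂ) = (↑(twistUnit hF n a k)⁻¹ : Op N n ℂ) := by
  induction k with
  | zero => simp [twistUnit, liftOp_one]
  | succ k ih =>
    obtain ⟨h1, h2⟩ := ih (by omega)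
    simp only [twistUnit, Units.val_mul, mul_inv_rev, liftOp_mul, h1, h2]
    constructor <;> congr 1 <;> exact liftOp_site h (by omega) _

/-- The innermost F is consumed by the trace over the last factor; the remaining F's do not touch
that factor, pass through its trace, and are treated by induction. -/
theorem partialTrace_twist {F R : Op N 2 ℂ} (hR : SkewInvertible R) (hF : IsRMatrix F)
    (hRF : IsCompatible R F) (n k : ℕ) (X : Op N (n + k) A) :
    partialTrace (matD R) (n + 1) k (scal A (twistUnit hF (n + 1 + k) n k : Op N (n + 1 + k) ℂ) *
      liftOp (by omega) X * scal A (↑(twistUnit hF (n + 1 + k) n k)⁻¹ : Op N (n + 1 + k) ℂ)) =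
      liftOp n.le_succ (partialTrace (matD R) n k X) := by
  induction k with
  | zero => simp only [twistUnit, inv_one, Units.val_one, scal_one, one_mul, mul_one]; rfl
  | succ k ih =>
    rw [partialTrace, partialTrace, ← ih]
    congr 1
    obtain ⟨h1, h2⟩ := liftOp_twistUnit hF (n + 1 + k).le_succ (a := n) (k := k) (by omega)
    have e1 : (twistUnit hF (n + 1 + (k + 1)) n (k + 1) : Op N (n + 1 + (k + 1)) ℂ) =
        liftOp (n + 1 + k).le_succ (twistUnit hF (n + 1 + k) n k : Op N (n + 1 + k) ℂ) *
          site (n + 1 + (k + 1)) (n + k) F := by rw [h1]; rfl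
    have e2 : (↑(twistUnit hF (n + 1 + (k + 1)) n (k + 1))⁻¹ : Op N (n + 1 + (k + 1)) ℂ) =
        site (n + 1 + (k + 1)) (n + k) F⁻¹ *
        liftOp (n + 1 + k).le_succ (↑(twistUnit hF (n + 1 + k) n k)⁻¹ : Op N (n + 1 + k) ℂ) := by
      rw [h2, twistUnit, mul_inv_rev]; rfl
    rw [e1, e2, scal_mul, scal_mul, scal_liftOp, scal_liftOp]
    rw [show ∀ a b c d e : Op N (n + 1 + (k + 1)) A, a * b * c * (d * e) = a * (b * c * d) * e from
      fun a b c d e => by simp only [mul_assoc]]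
    refine (lastTrace_mul_liftOp _ _ _).trans ?_
    rw [lastTrace_liftOp_mul]
    congr 2
    exact lastTrace_twist hR hF hRF (p := n + k) (m := n + 1 + k) (by omega) X

end PartialTrace

/-! ### Multiplicativity of the characteristic map -/

section Multiplicativity

variable {N : ℕ} {R F : Op N 2 ℂ}

/-- The product of the `k` copies of the matrix of the generators, starting from the copy with the
number `a`. -/
noncomputable def copiesProd (R F : Op N 2 ℂ) (n a k : ℕ) : Op N n (QMA R F) :=
  ((List.range k).map fun j => copy F (genMatrix R F) n (a + j)).prod

/-- The homomorphism from the free algebra to the operators given by `R_a, R_(a+1), …`. -/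
noncomputable def evalSites (R : Op N 2 ℂ) (n a : ℕ) : FreeAlgebra ℂ ℕ →ₐ[ℂ] Op N n ℂ :=
  FreeAlgebra.lift ℂ fun i => site n (a + i) R

theorem twistUnit_commute (hF : IsRMatrix F) (X : Op N 2 ℂ) (n : ℕ) {a k l : ℕ} (h : a + k < l) :
    Commute (twistUnit hF n a k : Op N n ℂ) (site n l X) := by
  induction k with
  | zero => exact Commute.one_left _
  | succ k ih => exact (ih (by omega)).mul_left (site_commute' F X n (by omega))

theorem twistUnit_semiconjBy_site (hF : IsRMatrix F) (hRF : IsCompatible R F) {n a k i : ℕ}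
    (hi : i + 1 < k) (hk : a + k < n) :
    SemiconjBy (twistUnit hF n a k : Op N n ℂ) (site n (a + i) R) (site n (a + i + 1) R) := by
  induction k with
  | zero => omega
  | succ k ih =>
    rcases eq_or_ne (i + 1) k with rfl | hne
    · rw [twistUnit, twistUnit, mul_assoc]
      exact SemiconjBy.mul_left (twistUnit_commute hF R n (by omega))
        (site_semiconjBy_right hRF.right (by omega))
    · exact (ih (by omega) (by omega)).mul_left (site_commute' R F n (by omega)).symm

theorem twistUnit_semiconjBy_copy (hF : IsRMatrix F) {A : Type*} [Ring A] [Algebra ℂ A]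
    (M : Matrix (Fin N) (Fin N) A) {n a k i : ℕ} (hi : i < k) (hk : a + k < n) :
    SemiconjBy (scal A (twistUnit hF n a k : Op N n ℂ)) (copy F M n (a + i))
      (copy F M n (a + i + 1)) := by
  have comm : ∀ k l, a + k < l → l < n →
      Commute (scal A (twistUnit hF n a k : Op N n ℂ)) (copy F M n l) := by
    intro k l h hl
    induction k with
    | zero => rw [twistUnit, Units.val_one, scal_one]; exact Commute.one_left _
    | succ k ih =>
      rw [twistUnit, Units.val_mul, scal_mul]
      exact (ih (by omega)).mul_left (site_commute_copy_of_left hF hF.ybe M (by omega) hl)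
  induction k with
  | zero => omega
  | succ k ih =>
    rw [twistUnit, Units.val_mul, scal_mul]
    rcases eq_or_ne i k with rfl | hne
    · exact SemiconjBy.mul_left (comm _ _ (by omega) (by omega)) (copy_semiconjBy hF M n _)
    · exact (ih (by omega) (by omega)).mul_left (site_commute_copy F M n (by omega))

theorem copiesProd_succ (n a k : ℕ) : copiesProd R F n a (k + 1) =
    copiesProd R F n a k * copy F (genMatrix R F) n (a + k) := by
  simp [copiesProd, List.range_succ]

theorem twistUnit_semiconjBy_copiesProd (hF : IsRMatrix F) (n k : ℕ) {j : ℕ} (hj : j ≤ k) :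
    SemiconjBy (scal (QMA R F) (twistUnit hF (n + 1 + k) n k : Op N (n + 1 + k) ℂ))
      (liftOp (show n + k ≤ n + 1 + k by omega) (copiesProd R F (n + k) n j))
      (copiesProd R F (n + 1 + k) (n + 1) j) := by
  induction j with
  | zero => rw [copiesProd, copiesProd]; simp [liftOp_one]
  | succ j ih =>
    rw [copiesProd_succ, copiesProd_succ, liftOp_mul, liftOp_copy _ _ (by omega)]
    have := twistUnit_semiconjBy_copy hF (genMatrix R F) (n := n + 1 + k) (a := n) (k := k)
      (i := j) (by omega) (by omega)
    rw [show n + j + 1 = n + 1 + j by omega] at this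
    exact (ih (by omega)).mul_right this

theorem twistUnit_semiconjBy_evalSites (hF : IsRMatrix F) (hRF : IsCompatible R F) (n k : ℕ)
    (f : FreeAlgebra ℂ ℕ) :
    SemiconjBy (twistUnit hF (n + 1 + k) n k : Op N (n + 1 + k) ℂ)
      (liftOp (show n + k ≤ n + 1 + k by omega) (evalSites R (n + k) n f))
      (evalSites R (n + 1 + k) (n + 1) f) := by
  have hl : ∀ X, liftOp (show n + k ≤ n + 1 + k by omega) X =
      placeHom (N := N) (Fin.castLE (show n + k ≤ n + 1 + k by omega)) (Fin.castLE_injective _) X :=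
    fun _ => rfl
  induction f using FreeAlgebra.induction with
  | grade0 r =>
    rw [hl, AlgHom.commutes, AlgHom.commutes, AlgHom.commutes]
    exact (Algebra.commutes _ _).symm
  | grade1 i =>
    rw [evalSites, evalSites, FreeAlgebra.lift_ι_apply, FreeAlgebra.lift_ι_apply]
    by_cases hi : i + 1 < k
    · rw [liftOp_site _ (by omega), show n + 1 + i = n + i + 1 by omega]
      exact twistUnit_semiconjBy_site hF hRF hi (by omega)
    · rw [site, dif_neg (by omega), site, dif_neg (by omega), liftOp_one]
      exact SemiconjBy.one_right _
  | mul a b ha hb =>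
    rw [map_mul, map_mul, liftOp_mul]
    exact ha.mul_right hb
  | add a b ha hb =>
    rw [hl] at ha hb ⊢
    rw [map_add, map_add, map_add]
    exact ha.add_right hb

/-- Induction on n: conjugation by F_n ⋯ F_{n+k-1} shifts copies and R-matrices by one place, and
`partialTrace_twist` evaluates the trace after it. The free algebra gives a word a meaning at every
position. -/
theorem partialTrace_copiesProd (hR : SkewInvertible R) (hF : IsRMatrix F)
    (hRF : IsCompatible R F) (n k : ℕ) (f : FreeAlgebra ℂ ℕ) :
    partialTrace (matD R) n k (copiesProd R F (n + k) n k * scal _ (evalSites R (n + k) n f)) =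
      chLin R F k (evalSites R k 0 f) • (1 : Op N n (QMA R F)) := by
  induction n with
  | zero =>
    -- Since 0 + k is not definitionally k, the number of factors is generalized.
    have h1 : ∀ m, m = k → rTrace R (copiesProd R F m 0 k * scal _ (evalSites R m 0 f)) =
        chLin R F k (evalSites R k 0 f) := by
      rintro _ rfl
      simp only [copiesProd, zero_add]
      rfl
    rw [← h1 (0 + k) (Nat.zero_add k), rTrace_partialTrace]
    ext a b
    simp [rTrace, Subsingleton.elim default a, Subsingleton.elim b a]
  | succ n ih =>
    have h1 : SemiconjBy (scal (QMA R F) (twistUnit hF (n + 1 + k) n k : Op N (n + 1 + k) ℂ))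
        (liftOp (show n + k ≤ n + 1 + k by omega)
          (copiesProd R F (n + k) n k * scal _ (evalSites R (n + k) n f)))
        (copiesProd R F (n + 1 + k) (n + 1) k * scal _ (evalSites R (n + 1 + k) (n + 1) f)) := by
      rw [liftOp_mul, ← scal_liftOp]
      refine (twistUnit_semiconjBy_copiesProd hF n k le_rfl).mul_right ?_
      have := congrArg (scal (QMA R F)) (twistUnit_semiconjBy_evalSites hF hRF n k f).eq
      rwa [scal_mul, scal_mul] at this
    have h2 : ∀ Z : Op N (n + 1 + k) (QMA R F), Z *
        scal _ (twistUnit hF (n + 1 + k) n k : Op N (n + 1 + k) ℂ) *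
        scal _ (↑(twistUnit hF (n + 1 + k) n k)⁻¹ : Op N (n + 1 + k) ℂ) = Z := by
      intro Z
      rw [mul_assoc, ← scal_mul, Units.mul_inv, scal_one, mul_one]
    rw [← h2 (copiesProd _ _ _ _ _ * _), ← h1.eq, partialTrace_twist hR hF hRF, ih]
    ext a b
    obtain ⟨a, x, rfl⟩ := exists_eq_snocIdx a
    obtain ⟨b, y, rfl⟩ := exists_eq_snocIdx b
    have h3 := liftOp_apply (1 : Op N n (QMA R F)) a b x y
    rw [liftOp_one] at h3
    rw [liftOp_apply, Matrix.smul_apply, Matrix.smul_apply, h3]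
    split_ifs <;> simp

theorem stringM_add (n k : ℕ) : stringM R F (n + k) =
    liftOp (n.le_add_right k) (stringM R F n) * copiesProd R F (n + k) n k := by
  have h : ∀ j ≤ n, liftOp (n.le_add_right k) (copiesProd R F n 0 j) =
      copiesProd R F (n + k) 0 j := by
    intro j hj
    induction j with
    | zero => rw [copiesProd, copiesProd]; simp [liftOp_one]
    | succ j ih =>
      rw [copiesProd_succ, copiesProd_succ, liftOp_mul, liftOp_copy _ _ (by omega),
        ih (by omega)]
  have hs : ∀ m, stringM R F m = copiesProd R F m 0 m := fun m => by
    simp only [copiesProd, zero_add]; rfl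
  rw [hs n, h n le_rfl]
  rw [stringM, List.range_add, List.map_append, List.prod_append, List.map_map]
  simp only [copiesProd, zero_add]
  rfl

theorem liftOp_commute_copiesProd (hF : IsRMatrix F) (hRF : IsCompatible R F) {n k : ℕ}
    {X : Op N n ℂ} (hX : X ∈ siteAlgebra R n) :
    Commute (scal (QMA R F) (liftOp (n.le_add_right k) X)) (copiesProd R F (n + k) n k) := by
  set φ : Op N n ℂ →+* Op N (n + k) (QMA R F) := (scalHom N (n + k) (QMA R F)).comp
    (placeHom (N := N) (Fin.castLE (n.le_add_right k)) (Fin.castLE_injective _)).toRingHom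
  change Commute (φ X) _
  induction hX using Algebra.adjoin_induction with
  | mem x hx =>
    obtain ⟨i, rfl⟩ := hx
    change Commute (scal (QMA R F) (liftOp (n.le_add_right k) (site n i R))) _
    by_cases hi : i + 1 < n
    · rw [liftOp_site _ hi]
      refine Commute.list_prod_right _ _ fun x hx => ?_
      obtain ⟨j, hj, rfl⟩ := List.mem_map.1 hx
      have := List.mem_range.1 hj
      exact site_commute_copy_of_left hF hRF.left _ (by omega) (by omega)
    · rw [site, dif_neg hi, liftOp_one, scal_one]
      exact Commute.one_left _
  | algebraMap c =>
    have h : φ (algebraMap ℂ _ c) = algebraMap ℂ _ c := by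
      change scalHom N (n + k) (QMA R F) (placeHom _ _ (algebraMap ℂ _ c)) = _
      rw [AlgHom.commutes]
      ext a b
      simp only [scalHom_apply, scal, Matrix.map_apply, Matrix.algebraMap_matrix_apply]
      split_ifs <;> simp
    rw [h]
    exact Algebra.commutes _ _
  | add x y _ _ hx hy => rw [map_add]; exact hx.add_left hy
  | mul x y _ _ hx hy => rw [map_mul]; exact hx.mul_left hy

/-- The multiplicativity of the characteristic map. -/
theorem chLin_liftOp_mul (hR : SkewInvertible R) (hF : IsRMatrix F) (hRF : IsCompatible R F)
    {n k : ℕ} {X : Op N n ℂ} (hX : X ∈ siteAlgebra R n) (f : FreeAlgebra ℂ ℕ) :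
    chLin R F (n + k) (liftOp (n.le_add_right k) X * evalSites R (n + k) n f) =
      chLin R F n X * chLin R F k (evalSites R k 0 f) := by
  have h1 : stringM R F (n + k) * scal _ (liftOp (n.le_add_right k) X * evalSites R (n + k) n f) =
      liftOp (n.le_add_right k) (stringM R F n * scal _ X) *
        (copiesProd R F (n + k) n k * scal _ (evalSites R (n + k) n f)) := by
    rw [stringM_add, scal_mul, liftOp_mul, ← scal_liftOp, mul_assoc, ← mul_assoc (copiesProd _ _ _ _ _),
      ← (liftOp_commute_copiesProd hF hRF hX).eq]
    simp only [mul_assoc]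
  change rTrace R _ = rTrace R (stringM R F n * scal _ X) * _
  rw [h1, rTrace_partialTrace, partialTrace_liftOp_mul, partialTrace_copiesProd hR hF hRF]
  simp only [rTrace, Finset.sum_mul, smul_mul_assoc]
  refine Finset.sum_congr rfl fun a _ => Finset.sum_congr rfl fun b _ => ?_
  congr 1
  rw [Matrix.mul_apply, Finset.sum_eq_single a]
  · simp
  · intro c _ hc
    simp [Matrix.one_apply_ne hc]
  · simp

end Multiplicativity


/-! ### BMW relations for the operators R_i -/

section Family

theorem IsBMWPair.map {B C : Type*} [Ring B] [Algebra ℂ B] [Ring C] [Algebra ℂ C] {q μ : ℂ}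
    {x y : B} (h : IsBMWPair q μ x y) (f : B →ₐ[ℂ] C) : IsBMWPair q μ (f x) (f y) := by
  constructor <;> simp only [← map_kappaOf, ← map_mul]
  · rw [h.braid]
  · rw [h.kk]
  · rw [h.kk_swap]
  · rw [h.kk_right]
  · rw [h.kk_right_swap]
  · rw [h.kkk]
  · rw [h.kkk_swap]

/-- Conjugation by xyx exchanges x with y, hence κ_x with κ_y, and so produces the mirror image of
each relation. Conjugation by xy or yx gives the right-handed forms. -/
theorem isBMWPair_of_isUnit {B : Type*} [Ring B] [Algebra ℂ B] {q μ : ℂ} {x y : B}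
    (hx : IsUnit x) (hy : IsUnit y) (braid : x * y * x = y * x * y)
    (kk : kappaOf q μ y * kappaOf q μ x = x * y * kappaOf q μ x)
    (kkk : kappaOf q μ x * kappaOf q μ y * kappaOf q μ x = kappaOf q μ x) :
    IsBMWPair q μ x y := by
  have s1 : SemiconjBy (x * y) x y := by rw [SemiconjBy, braid, mul_assoc]
  have s2 : SemiconjBy (y * x) y x := by rw [SemiconjBy, ← braid, mul_assoc]
  have d1 : SemiconjBy (x * y * x) x y := s1.mul_left (Commute.refl x)
  have d2 : SemiconjBy (x * y * x) y x := by
    rw [braid]; exact s2.mul_left (Commute.refl y)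
  have hd : IsUnit (x * y * x) := (hx.mul hy).mul hx
  have k1 : SemiconjBy (x * y * x) (kappaOf q μ x) (kappaOf q μ y) := SemiconjBy.kappaOf d1
  have k2 : SemiconjBy (x * y * x) (kappaOf q μ y) (kappaOf q μ x) := SemiconjBy.kappaOf d2
  have kk_swap : kappaOf q μ x * kappaOf q μ y = y * x * kappaOf q μ y := by
    apply hd.mul_left_injective
    change _ * (x * y * x) = _ * (x * y * x)
    rw [← (k2.mul_right k1).eq, ← ((d1.mul_right d2).mul_right k1).eq, kk]
  refine ⟨braid, kk, kk_swap, ?_, ?_, kkk, ?_⟩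
  · rw [kk_swap, mul_assoc (kappaOf q μ x)]
    exact SemiconjBy.kappaOf s2
  · rw [kk, mul_assoc (kappaOf q μ y)]
    exact SemiconjBy.kappaOf s1
  · apply hd.mul_left_injective
    change _ * (x * y * x) = _ * (x * y * x)
    rw [← ((k1.mul_right k2).mul_right k1).eq, ← k1.eq, kkk]

variable {N : ℕ} {R F : Op N 2 ℂ} {q μ : ℂ}

theorem AdmissibleParameters.good (h : AdmissibleParameters q μ) : GoodParameters q μ := by
  obtain ⟨h0, h1, h2, h3, -, -⟩ := h
  refine ⟨h0, fun h => ?_, h3⟩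
  field_simp at h
  have : (q - 1) * (q + 1) = 0 := by linear_combination h
  rcases mul_eq_zero.1 this with h | h
  · exact h1 (sub_eq_zero.1 h)
  · exact h2 (eq_neg_of_add_eq_zero_left h)

theorem AdmissibleParameters.eta_ne (h : AdmissibleParameters q μ) : eta q μ ≠ 0 := by
  have hg := h.good
  obtain ⟨-, -, -, h3, h4, h5⟩ := h
  refine div_ne_zero (mul_ne_zero (sub_ne_zero.2 (Ne.symm h4)) fun h => h5 ?_)
    (mul_ne_zero h3 hg.lam_ne)
  linear_combination h

theorem isUnit_site (hR : IsUnit R) (n i : ℕ) : IsUnit (site n i R) :=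
  ⟨⟨_, _, site_mul_inv hR n i, site_inv_mul hR n i⟩, rfl⟩

theorem IsBMWType.pair (h : IsBMWType R q μ) : IsBMWPair q μ (site 3 0 R) (site 3 1 R) := by
  have h0 := site_kappaOf (q := q) (μ := μ) (show 0 + 1 < 3 by omega) R
  have h1 := site_kappaOf (q := q) (μ := μ) (show 1 + 1 < 3 by omega) R
  have e1 := h.kk
  have e2 := h.kkk
  simp only [← h0, ← h1] at e1 e2
  exact isBMWPair_of_isUnit (isUnit_site h.isRMatrix.isUnit 3 0) (isUnit_site h.isRMatrix.isUnit 3 1)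
    h.isRMatrix.ybe e1 e2

theorem IsBMWType.family (h : IsBMWType R q μ) (n : ℕ) :
    IsBMWFamily q μ (n - 1) fun i => site n i R := by
  refine ⟨fun i hi => ?_, fun i hi => ?_, fun i j hij hj => ?_⟩
  · have hi' : i + 1 < n := by omega
    have := congrArg (site n i) h.mul_kappa
    rw [site_mul] at this
    rw [site_kappaOf hi', this, site_eq hi', site_eq hi']
    exact map_smul (placeHom _ (pair_injective hi')) _ _
  · have hi' : i + 2 < n := by omega
    have := h.pair.map (placeHom (triple hi') (triple_injective hi'))
    simpa only [placeHom_apply, place_triple_zero, place_triple_one] using this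
  · exact site_commute' R R n hij

theorem bmwRep_bmwGen (h : IsBMWType R q μ) (n i : ℕ) :
    bmwRep h n (bmwGen q μ n i) = site n i R := by
  rw [bmwGen, bmwRep_ofBraid, gen]
  split_ifs with hi
  · rw [braidRep_of]
  · rw [map_one, Units.val_one, site, dif_neg (by omega)]

theorem antisymmetrizer_eq (n i : ℕ) :
    antisymmetrizer q μ n i = antisymOf q μ (bmwGen q μ n) i := by
  induction i using antisymmetrizer.induct with
  | case1 => rfl
  | case2 => rfl
  | case3 i ih => rw [antisymmetrizer, antisymOf, ih]

/-- Under q ↦ -q⁻¹ the signs of the power and of the q-number cancel in the normalization, the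
spectral parameter is inverted, and the α of the antisymmetric case becomes that of the symmetric
one. -/
theorem symmetrizer_eq (n i : ℕ) :
    symmetrizer q μ n i = antisymOf (-q⁻¹) μ (bmwGen q μ n) i := by
  induction i using symmetrizer.induct with
  | case1 => rfl
  | case2 => rfl
  | case3 i ih =>
    have h1 : ((q ^ (i + 1))⁻¹ / qNum q (i + 2)) = (-q⁻¹) ^ (i + 1) / qNum (-q⁻¹) (i + 2) := by
      rw [qNum_neg_inv, neg_pow q⁻¹, inv_pow, show i + 2 + 1 = i + 1 + 2 by ring,
        pow_add (-1 : ℂ) (i + 1) 2]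
      rw [neg_one_sq, mul_one, mul_div_mul_left _ _ (pow_ne_zero _ (by norm_num))]
    have h2 : ((-q⁻¹) ^ (2 * (i + 1)))⁻¹ = q ^ (2 * (i + 1)) := by
      rw [Even.neg_pow (even_two_mul _), inv_pow, inv_inv]
    have h3 : -q⁻¹ - (-q⁻¹)⁻¹ = q - q⁻¹ := by rw [inv_neg, inv_inv]; ring
    rw [symmetrizer, antisymOf, ih, h1]
    simp only [baxterized, h2, h3, kappaOf_neg_inv, neg_mul]

end Family

/-! ### Abstract properties of ch and removal of strands -/

section Tower

variable {N : ℕ} {R F : Op N 2 ℂ} {q μ : ℂ}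

/-- The properties of the characteristic map used for the Newton and Wronski relations. -/
structure IsCharTower (q μ : ℂ) (R F : Op N 2 ℂ) : Prop where
  good : GoodParameters q μ
  eta_ne : eta q μ ≠ 0
  family : ∀ n, IsBMWFamily q μ (n - 1) fun i => site n i R
  comm : ∀ {n : ℕ} {Y : Op N n ℂ}, Y ∈ siteAlgebra R n → ∀ X,
    chLin R F n (X * Y) = chLin R F n (Y * X)
  mul : ∀ {n k : ℕ} {X : Op N n ℂ}, X ∈ siteAlgebra R n → ∀ f,
    chLin R F (n + k) (liftOp (n.le_add_right k) X * evalSites R (n + k) n f) =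
      chLin R F n X * chLin R F k (evalSites R k 0 f)

theorem eta_neg_inv : eta (-q⁻¹) μ = eta q μ := by
  have h : -q⁻¹ - (-q⁻¹)⁻¹ = q - q⁻¹ := by rw [inv_neg, inv_inv]; ring
  rw [eta, eta, h, inv_neg, inv_inv]
  congr 1
  ring

theorem IsCharTower.neg_inv (h : IsCharTower q μ R F) : IsCharTower (-q⁻¹) μ R F :=
  ⟨h.good.neg_inv, by rw [eta_neg_inv]; exact h.eta_ne, fun n => (h.family n).neg_inv, h.comm,
    h.mul⟩

/-- The 2-contraction. -/
noncomputable def contr (q μ : ℂ) (R F : Op N 2 ℂ) : QMA R F :=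
  (eta q μ)⁻¹ • chLin R F 2 (kappaOf q μ (site 2 0 R))

theorem contr_neg_inv : contr (-q⁻¹) μ R F = contr q μ R F := by
  rw [contr, contr, eta_neg_inv, kappaOf_neg_inv]

theorem liftOp_mem {m n : ℕ} (h : m ≤ n) {X : Op N m ℂ} (hX : X ∈ siteAlgebra R m) :
    liftOp h X ∈ siteAlgebra R n := by
  set φ := placeHom (N := N) (Fin.castLE h) (Fin.castLE_injective _)
  change φ X ∈ _
  induction hX using Algebra.adjoin_induction with
  | mem x hx =>
    obtain ⟨i, rfl⟩ := hx
    change liftOp h (site m i R) ∈ _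
    by_cases hi : i + 1 < m
    · rw [liftOp_site _ hi]; exact site_mem R n i
    · rw [site, dif_neg hi, liftOp_one]; exact one_mem _
  | algebraMap c => rw [AlgHom.commutes]; exact Subalgebra.algebraMap_mem _ _
  | add x y _ _ hx hy => rw [map_add]; exact add_mem hx hy
  | mul x y _ _ hx hy => rw [map_mul]; exact mul_mem hx hy

theorem liftOp_kappaOf {m n : ℕ} (h : m ≤ n) (X : Op N m ℂ) :
    liftOp h (kappaOf q μ X) = kappaOf q μ (liftOp h X) :=
  map_kappaOf (placeHom (N := N) (Fin.castLE h) (Fin.castLE_injective _)) q μ X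

theorem liftOp_add {m n : ℕ} (h : m ≤ n) (X Y : Op N m ℂ) :
    liftOp h (X + Y) = liftOp h X + liftOp h Y :=
  map_add (placeHom (N := N) (Fin.castLE h) (Fin.castLE_injective _)) X Y

theorem liftOp_smul {m n : ℕ} (h : m ≤ n) (c : ℂ) (X : Op N m ℂ) :
    liftOp h (c • X) = c • liftOp h X :=
  map_smul (placeHom (N := N) (Fin.castLE h) (Fin.castLE_injective _)) c X

theorem liftOp_antisymOf {m n : ℕ} (h : m ≤ n) {σ : ℕ → Op N m ℂ} {τ : ℕ → Op N n ℂ} {i : ℕ}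
    (hσ : ∀ l, l + 1 < i → liftOp h (σ l) = τ l) :
    liftOp h (antisymOf q μ σ i) = antisymOf q μ τ i :=
  (map_antisymOf (placeHom (N := N) (Fin.castLE h) (Fin.castLE_injective _)) σ i).trans
    (antisymOf_congr hσ)

namespace IsCharTower

variable (h : IsCharTower q μ R F)
include h

theorem chLin_semiconjBy {n : ℕ} {g Y Y' : Op N n ℂ} (hg : IsUnit g) (hm : g ∈ siteAlgebra R n)
    (hY : SemiconjBy g Y Y') : chLin R F n Y = chLin R F n Y' := by
  obtain ⟨u, rfl⟩ := hg
  have : Y' = u * (Y * ↑u⁻¹) := by rw [← mul_assoc, hY.eq, Units.mul_inv_cancel_right]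
  rw [this, ← h.comm hm, Units.inv_mul_cancel_right]

theorem chLin_lift_mul_kappaOf {m : ℕ} {X : Op N m ℂ} (hX : X ∈ siteAlgebra R m) :
    chLin R F (m + 2) (liftOp (m.le_add_right 2) X * kappaOf q μ (site (m + 2) m R)) =
      eta q μ • (chLin R F m X * contr q μ R F) := by
  have := h.mul (k := 2) hX (kappaOf q μ (FreeAlgebra.ι ℂ 0))
  rw [map_kappaOf, map_kappaOf, evalSites, evalSites, FreeAlgebra.lift_ι_apply,
    FreeAlgebra.lift_ι_apply] at this
  rw [contr, mul_smul_comm, smul_inv_smul₀ h.eta_ne]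
  exact this

/-- The removal of a pair of adjacent strands. -/
theorem chLin_remove {p d m : ℕ} (hm : p + (d + 1) = m) {X Z : Op N (m + 2) ℂ} {X' Z' : Op N m ℂ}
    (hX' : X' ∈ siteAlgebra R m) (hZ' : Z' ∈ siteAlgebra R m)
    (hX : SemiconjBy (moveRight (fun i => site (m + 2) i R) p (d + 1)) X
      (liftOp (m.le_add_right 2) X'))
    (hc : Commute (moveRight (fun i => site (m + 2) i R) (p + 1) d)
      (liftOp (m.le_add_right 2) Z'))
    (hZ : kappaOf q μ (site (m + 2) (p + 1) R) * kappaOf q μ (site (m + 2) p R) * Z =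
      liftOp (m.le_add_right 2) Z' *
        (kappaOf q μ (site (m + 2) (p + 1) R) * kappaOf q μ (site (m + 2) p R))) :
    chLin R F (m + 2) (kappaOf q μ (site (m + 2) p R) * Z * X) =
      eta q μ • (chLin R F m (X' * Z') * contr q μ R F) := by
  have hf := h.family (m + 2)
  have hpair := hf.pair p (by omega)
  set r : ℕ → Op N (m + 2) ℂ := fun i => site (m + 2) i R with hr
  have hγ := isUnit_moveRight hf h.good (p := p) (d := d + 1) (by omega)
  have hγm := moveRight_mem (siteAlgebra R (m + 2)) (σ := r) (fun i => site_mem R _ i) p (d + 1)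
  have hk := moveRight_kappaOf hf (p := p) (d := d + 1) (by omega)
  -- The rightmost move r_p r_{p+1} turns κ_p into κ_{p+1}κ_p, so Z is replaced by Z'. The remaining
  -- moves commute with Z' and carry the contraction to the last two factors.
  have h1 : SemiconjBy (moveRight r p (d + 1)) (kappaOf q μ (site (m + 2) p R) * Z)
      (liftOp (m.le_add_right 2) Z' * kappaOf q μ (r m)) := by
    rw [hm] at hk
    change moveRight r p (d + 1) * (kappaOf q μ (r p) * Z) = _
    rw [mul_assoc (liftOp _ _), ← hk.eq, moveRight]
    calc moveRight r (p + 1) d * (r p * r (p + 1)) * (kappaOf q μ (r p) * Z)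
        = moveRight r (p + 1) d * (r p * r (p + 1) * kappaOf q μ (r p) * Z) := by
          simp only [mul_assoc]
      _ = moveRight r (p + 1) d * (liftOp (m.le_add_right 2) Z' *
            (kappaOf q μ (r (p + 1)) * kappaOf q μ (r p))) := by
          rw [← hpair.kk, hZ]
      _ = liftOp (m.le_add_right 2) Z' * moveRight r (p + 1) d *
            (r p * r (p + 1) * kappaOf q μ (r p)) := by
          rw [← hpair.kk, ← mul_assoc, hc.eq]
      _ = _ := by simp only [mul_assoc]
  rw [h.chLin_semiconjBy hγ hγm (h1.mul_right hX), h.comm (liftOp_mem _ hX'), ← mul_assoc,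
    ← liftOp_mul]
  exact h.chLin_lift_mul_kappaOf (mul_mem hX' hZ')

end IsCharTower

end Tower


/-! ### The general sandwich identity -/

section Sandwich

variable {B : Type*} [Ring B] [Algebra ℂ B] {q μ : ℂ}

/-- Bilinear expansion into nine sandwiches. The coefficient c of the unit in the second factor is
free because the Newton relations need c = 0 and the Wronski relations c = 1. -/
theorem sandwich_eq (hp : GoodParameters q μ) {x y z : B}
    (hxy : IsBMWPair q μ x y) (hyz : IsBMWPair q μ y z) (hxz : Commute x z)
    (hx : x * kappaOf q μ x = μ • kappaOf q μ x) (hy : y * kappaOf q μ y = μ • kappaOf q μ y)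
    (u v c u' v' : ℂ) :
    kappaOf q μ z * kappaOf q μ y *
      ((1 + u • x + v • kappaOf q μ x) * (c • 1 + u' • z + v' • kappaOf q μ z) * kappaOf q μ y) =
    ((c * (eta q μ + u * μ⁻¹ + v) + u' * μ⁻¹ + v' + u * u' * ((q - q⁻¹) * μ⁻¹)) • 1 +
      (u * v' + v * u' - (q - q⁻¹) * u * u') • x + (u * u' + v * v') • kappaOf q μ x) *
      (kappaOf q μ z * kappaOf q μ y) := by
  have hxz' : Commute x (kappaOf q μ z) := SemiconjBy.kappaOf hxz
  have e1 := sandwich_mul hp hxy hyz hxz hx hy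
  have e2 := sandwich_kappaOf_mul hp hxy hyz hxz hy
  have e3 := sandwich_mul_kappaOf hyz hxz
  have e4 := sandwich_kappaOf_mul_kappaOf hyz hxz
  have e5 := kappaOf_mul_self hp.q_ne hp.lam_ne hp.mu_ne hy
  have e6 := kappaOf_mul_mul_kappaOf hp hxy.symm hy
  have e7 := kappaOf_mul_mul_kappaOf hp hyz hy
  have e8 := hxy.kkk_swap
  have e9 := hyz.kkk
  simp only [mul_assoc] at e1 e2 e3 e4 e5 e6 e7 e8 e9 ⊢
  simp only [add_mul, mul_add, sub_mul, mul_sub, smul_mul_assoc, mul_smul_comm, one_mul,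
    e1, e2, e3, e4, e5, e6, e7, e8, e9]
  module

end Sandwich

/-! ### Removal of a contraction under ch -/

section Contract

variable {N : ℕ} {R F : Op N 2 ℂ} {q μ : ℂ}

namespace IsCharTower

variable (h : IsCharTower q μ R F)
include h

theorem kappa_sq {n p : ℕ} (hp : p + 1 < n) :
    kappaOf q μ (site n p R) * kappaOf q μ (site n p R) = eta q μ • kappaOf q μ (site n p R) :=
  kappaOf_mul_self h.good.q_ne h.good.lam_ne h.good.mu_ne ((h.family n).cubic p (by omega))

/-- The identity κ² = ηκ provides a second contraction, which the trace property moves to the front.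
Commuting A and S outwards leaves b and c alone between the two contractions. -/
theorem chLin_collect {n p : ℕ} (hp : p + 1 < n) {A b S c S' : Op N n ℂ}
    (hA : A ∈ siteAlgebra R n) (hS : S ∈ siteAlgebra R n)
    (hAK : Commute A (kappaOf q μ (site n p R))) (hSK : Commute S (kappaOf q μ (site n p R)))
    (hSK' : Commute S' (kappaOf q μ (site n p R))) (hAS : Commute A S)
    (hAc : Commute A c) (hSb : Commute S b) :
    eta q μ • chLin R F n (A * b * A * (S * c * S') * kappaOf q μ (site n p R)) =
      chLin R F n (kappaOf q μ (site n p R) * (b * c * kappaOf q μ (site n p R)) *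
        (A * S' * (A * S))) := by
  have hsq := h.kappa_sq hp
  have hKm : kappaOf q μ (site n p R) ∈ siteAlgebra R n := kappaOf_mem _ (site_mem R n p)
  set K := kappaOf q μ (site n p R)
  have e : K * (A * b * A * (S * c * S') * K) = A * S * (K * (b * c * K) * (A * S')) := by
    calc K * (A * b * A * (S * c * S') * K) = (K * A) * b * (A * S) * c * (S' * K) := by
          simp only [mul_assoc]
      _ = A * (K * (b * S) * (A * c) * K * S') := by
          rw [← hAK.eq, hAS.eq, hSK'.eq]; simp only [mul_assoc]
      _ = A * ((K * S) * b * c * (A * K) * S') := by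
          rw [← hSb.eq, hAc.eq]; simp only [mul_assoc]
      _ = _ := by rw [← hSK.eq, hAK.eq]; simp only [mul_assoc]
  rw [← map_smul, ← mul_smul_comm, ← hsq, ← mul_assoc, h.comm hKm, e, ← h.comm (mul_mem hA hS)]
  simp only [mul_assoc]

/-- The removal of the strands joined by a contraction, with strands on both sides. -/
theorem chLin_contract {s m : ℕ} (hs : s + 2 ≤ m) {A S S' X : Op N (m + 2) ℂ} {X' : Op N m ℂ}
    (hA : A ∈ siteAlgebra R (m + 2)) (hS : S ∈ siteAlgebra R (m + 2))
    (hX' : X' ∈ siteAlgebra R m)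
    (hAr : ∀ l, s < l → Commute A (site (m + 2) l R))
    (hSr : ∀ l, l ≤ s + 1 → Commute S (site (m + 2) l R))
    (hSr' : Commute S' (site (m + 2) (s + 1) R)) (hAS : Commute A S) (hXe : A * S' * (A * S) = X)
    (hX : SemiconjBy (moveRight (fun i => site (m + 2) i R) (s + 1) (m - s - 1)) X
      (liftOp (m.le_add_right 2) X')) (u v c u' v' : ℂ) :
    chLin R F (m + 2) (A * (1 + u • site (m + 2) s R + v • kappaOf q μ (site (m + 2) s R)) * A *
        (S * (c • 1 + u' • site (m + 2) (s + 2) R + v' • kappaOf q μ (site (m + 2) (s + 2) R)) *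
          S') * kappaOf q μ (site (m + 2) (s + 1) R)) =
      ((c * (eta q μ + u * μ⁻¹ + v) + u' * μ⁻¹ + v' + u * u' * ((q - q⁻¹) * μ⁻¹)) •
        chLin R F m X' +
      (u * v' + v * u' - (q - q⁻¹) * u * u') • chLin R F m (X' * site m s R) +
      (u * u' + v * v') • chLin R F m (X' * kappaOf q μ (site m s R))) * contr q μ R F := by
  have hf := h.family (m + 2)
  have hx := site_mem R m s
  have hl : liftOp (m.le_add_right 2) (site m s R) = site (m + 2) s R := liftOp_site _ (by omega) R
  -- Multiplication by η allows the single contraction to be doubled by `chLin_collect`.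
  apply smul_right_injective _ h.eta_ne
  dsimp only
  rw [h.chLin_collect (by omega) hA hS (SemiconjBy.kappaOf (hAr _ (by omega)))
    (SemiconjBy.kappaOf (hSr _ (by omega))) (SemiconjBy.kappaOf hSr') hAS, hXe]
  · set e := c * (eta q μ + u * μ⁻¹ + v) + u' * μ⁻¹ + v' + u * u' * ((q - q⁻¹) * μ⁻¹)
    set f := u * v' + v * u' - (q - q⁻¹) * u * u'
    set g := u * u' + v * v'
    have hlift : liftOp (m.le_add_right 2)
        (e • 1 + f • site m s R + g • kappaOf q μ (site m s R)) =
        e • 1 + f • site (m + 2) s R + g • kappaOf q μ (site (m + 2) s R) := by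
      simp only [liftOp_add, liftOp_smul, liftOp_kappaOf, hl, liftOp_one]
    rw [h.chLin_remove (p := s + 1) (d := m - s - 2) (by omega) hX'
      (Z' := e • 1 + f • site m s R + g • kappaOf q μ (site m s R)) ?_ ?_ ?_ ?_]
    · simp only [mul_add, mul_smul_comm, mul_one, map_add, map_smul]
    · exact add_mem (add_mem (Subalgebra.smul_mem _ (one_mem _) _) (Subalgebra.smul_mem _ hx _))
        (Subalgebra.smul_mem _ (kappaOf_mem _ hx) _)
    · rwa [show m - s - 2 + 1 = m - s - 1 by omega]
    · rw [hlift]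
      have := moveRight_commute hf (p := s + 1 + 1) (d := m - s - 2) (l := s) (by omega) (by omega)
      exact (((Commute.one_right _).smul_right e).add_right (this.smul_right f)).add_right
        (Commute.smul_right (SemiconjBy.kappaOf this) g)
    · rw [hlift]
      exact sandwich_eq h.good (hf.pair s (by omega)) (hf.pair (s + 1) (by omega))
        (hf.comm _ _ (by omega) (by omega)) (hf.cubic _ (by omega)) (hf.cubic _ (by omega)) _ _ _ _ _
  · have := hAr (s + 2) (by omega)
    exact (((Commute.one_right _).smul_right _).add_right (this.smul_right _)).add_right
        (Commute.smul_right (SemiconjBy.kappaOf this) _)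
  · have := hSr s (by omega)
    exact ((Commute.one_right _).add_right (this.smul_right _)).add_right
        (Commute.smul_right (SemiconjBy.kappaOf this) _)

/-- The removal of the strands joined by a contraction, with strands on the right only. -/
theorem chLin_contract_left {m : ℕ} (hm : 0 < m) {S S' X : Op N (m + 2) ℂ} {X' : Op N m ℂ}
    (hS : S ∈ siteAlgebra R (m + 2))
    (hX' : X' ∈ siteAlgebra R m)
    (hSr : Commute S (site (m + 2) 0 R))
    (hSr' : Commute S' (site (m + 2) 0 R)) (hXe : S' * S = X)
    (hX : SemiconjBy (moveRight (fun i => site (m + 2) i R) 0 m) X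
      (liftOp (m.le_add_right 2) X')) (c u' v' : ℂ) :
    chLin R F (m + 2)
        (S * (c • 1 + u' • site (m + 2) 1 R + v' • kappaOf q μ (site (m + 2) 1 R)) *
          S' * kappaOf q μ (site (m + 2) 0 R)) =
      (c * eta q μ + u' * μ⁻¹ + v') • (chLin R F m X' * contr q μ R F) := by
  have hf := h.family (m + 2)
  have hpair := hf.pair 0 (by omega)
  have hc0 := hf.cubic 0 (by omega)
  apply smul_right_injective _ h.eta_ne
  dsimp only
  have := h.chLin_collect (p := 0) (A := 1) (b := 1)
    (c := (c • 1 + u' • site (m + 2) 1 R + v' • kappaOf q μ (site (m + 2) 1 R)))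
    (by omega) (one_mem _) hS (Commute.one_left _)
    (SemiconjBy.kappaOf hSr) (SemiconjBy.kappaOf hSr') (Commute.one_left _) (Commute.one_left _)
    (Commute.one_right _)
  simp only [one_mul] at this
  rw [this, hXe, h.chLin_remove (p := 0) (d := m - 1) (by omega) hX'
    (Z' := (c * eta q μ + u' * μ⁻¹ + v') • 1) (Subalgebra.smul_mem _ (one_mem _) _)]
  · rw [mul_smul_comm, mul_one, map_smul, smul_mul_assoc]
  · rwa [show m - 1 + 1 = m by omega]
  · rw [liftOp_smul, liftOp_one]
    exact (Commute.one_right _).smul_right _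
  · have e5 := h.kappa_sq (n := m + 2) (p := 0) (by omega)
    have e7 := kappaOf_mul_mul_kappaOf h.good hpair hc0
    have e9 := hpair.kkk
    rw [liftOp_smul, liftOp_one]
    simp only [mul_assoc, zero_add] at e5 e7 e9 ⊢
    simp only [add_mul, mul_add, smul_mul_assoc, mul_smul_comm, one_mul,
      e5, e7, e9]
    module

/-- The removal of the strands joined by a contraction, with strands on the left only. -/
theorem chLin_contract_right {s : ℕ} {A : Op N (s + 3) ℂ} {X' : Op N (s + 1) ℂ}
    (hA : A ∈ siteAlgebra R (s + 3)) (hX' : X' ∈ siteAlgebra R (s + 1))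
    (hAr : Commute A (site (s + 3) (s + 1) R))
    (hX : A * A = liftOp ((s + 1).le_add_right 2) X') (u v : ℂ) :
    chLin R F (s + 3) (A * (1 + u • site (s + 3) s R + v • kappaOf q μ (site (s + 3) s R)) * A *
        kappaOf q μ (site (s + 3) (s + 1) R)) =
      (eta q μ + u * μ⁻¹ + v) • (chLin R F (s + 1) X' * contr q μ R F) := by
  have hf := h.family (s + 3)
  have hpair := hf.pair s (by omega)
  have hc := hf.cubic (s + 1) (by omega)
  apply smul_right_injective _ h.eta_ne
  dsimp only
  have := h.chLin_collect (p := s + 1) (S := 1) (S' := 1) (c := 1)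
    (b := (1 + u • site (s + 3) s R + v • kappaOf q μ (site (s + 3) s R)))
    (by omega) hA (one_mem _) (SemiconjBy.kappaOf hAr) (Commute.one_left _)
    (Commute.one_left _) (Commute.one_right _) (Commute.one_right _) (Commute.one_left _)
  simp only [mul_one] at this
  have e5 := h.kappa_sq (n := s + 3) (p := s + 1) (by omega)
  have e7 := kappaOf_mul_mul_kappaOf h.good hpair.symm hc
  have e9 := hpair.kkk_swap
  have e : kappaOf q μ (site (s + 3) (s + 1) R) *
      ((1 + u • site (s + 3) s R + v • kappaOf q μ (site (s + 3) s R)) *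
        kappaOf q μ (site (s + 3) (s + 1) R)) =
      (eta q μ + u * μ⁻¹ + v) • kappaOf q μ (site (s + 3) (s + 1) R) := by
    simp only [mul_assoc] at e5 e7 e9 ⊢
    simp only [add_mul, mul_add, smul_mul_assoc, mul_smul_comm, one_mul,
      e5, e7, e9]
    module
  rw [this, e, smul_mul_assoc, map_smul, hX, h.comm (liftOp_mem _ hX'),
    h.chLin_lift_mul_kappaOf hX', smul_comm]

theorem chLin_kappaOf_two : chLin R F 2 (kappaOf q μ (site 2 0 R)) =
    eta q μ • contr q μ R F := by
  rw [contr, smul_inv_smul₀ h.eta_ne]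

end IsCharTower

end Contract


/-! ### Newton relations: recursion and contraction terms -/

section Newton

variable {N : ℕ} (q μ : ℂ) (R F : Op N 2 ℂ) (n i : ℕ)

/-- The antisymmetrizer on the initial `i` tensor factors. -/
noncomputable def antisymOp : Op N n ℂ := antisymOf q μ (fun l => site n l R) i

/-- The product `R_{n-2} ⋯ R_{i+1} R_i`, which joins the tensor factors from `i` on. -/
def cycleOp : Op N n ℂ := descProd (fun l => site n (i + l) R) (n - 1 - i)

/-- In E the antisymmetrizer and the cycle are disjoint, so E = a_i p_{n-i}. In U they share one
tensor factor. V is U with the generator joining them replaced by a contraction. -/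
noncomputable def newtonE : QMA R F := chLin R F n (antisymOp q μ R n i * cycleOp R n i)
noncomputable def newtonU : QMA R F := chLin R F n (antisymOp q μ R n (i + 1) * cycleOp R n i)
noncomputable def newtonV : QMA R F := chLin R F n
  (antisymOp q μ R n (i + 1) * (cycleOp R n (i + 1) * kappaOf q μ (site n i R)))

/-- The coefficient of the generator in the baxterized element. -/
noncomputable def baxU (q t : ℂ) : ℂ := (t - 1) / (q - q⁻¹)

/-- The coefficient of the contraction in the baxterized element which enters the
antisymmetrizers. -/
noncomputable def baxV (q μ t : ℂ) : ℂ := (t - 1) / (q * μ⁻¹ * t + 1)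

variable {q μ R F n i}

theorem antisymOp_mem : antisymOp q μ R n i ∈ siteAlgebra R n := antisymOf_mem _ (site_mem R n) _

theorem cycleOp_mem : cycleOp R n i ∈ siteAlgebra R n := descProd_mem _ (fun _ => site_mem R n _) _

theorem cycleOp_succ (hi : i + 1 < n) : cycleOp R n i = cycleOp R n (i + 1) * site n i R := by
  rw [cycleOp, show n - 1 - i = n - 1 - (i + 1) + 1 by omega, descProd_succ, cycleOp]
  simp only [add_zero, add_assoc]

theorem cycleOp_eq_one (hi : n ≤ i + 1) : cycleOp R n i = 1 := by
  rw [cycleOp, show n - 1 - i = 0 by omega, descProd_zero]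

theorem antisymOp_add_two : antisymOp q μ R n (i + 2) = (q ^ (i + 1) / qNum q (i + 2)) •
    (antisymOp q μ R n (i + 1) * (1 + baxU q (q ^ (2 * (i + 1)))⁻¹ • site n i R +
      baxV q μ (q ^ (2 * (i + 1)))⁻¹ • kappaOf q μ (site n i R)) * antisymOp q μ R n (i + 1)) := rfl

theorem antisymOp_commute {x : Op N n ℂ} (hx : ∀ l, l + 1 < i → Commute x (site n l R)) :
    Commute x (antisymOp q μ R n i) := SemiconjBy.antisymOf hx

theorem antisymOp_commute_site {l : ℕ} (hl : i ≤ l) :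
    Commute (antisymOp q μ R n i) (site n l R) :=
  (antisymOp_commute fun _ hl' => (site_commute' R R n (by omega)).symm).symm

theorem cycleOp_commute {x : Op N n ℂ} (hx : ∀ l, i ≤ l → Commute x (site n l R)) :
    Commute x (cycleOp R n i) := SemiconjBy.descProd fun _ _ => hx _ (by omega)

theorem cycleOp_commute_site {l : ℕ} (hl : l + 1 < i) : Commute (cycleOp R n i) (site n l R) :=
  (cycleOp_commute fun _ hl' => site_commute' R R n (by omega)).symm

theorem antisymOp_commute_cycleOp {j : ℕ} (hij : i ≤ j) :
    Commute (antisymOp q μ R n i) (cycleOp R n j) :=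
  cycleOp_commute fun _ hl => antisymOp_commute_site (hij.trans hl)

theorem liftOp_antisymOp {m : ℕ} (h : m ≤ n) (hi : i ≤ m) :
    liftOp h (antisymOp q μ R m i) = antisymOp q μ R n i :=
  liftOp_antisymOf h fun _ hl => liftOp_site h (by omega) R

theorem liftOp_cycleOp {m : ℕ} (h : m ≤ n) : liftOp h (cycleOp R m i) =
    descProd (fun l => site n (i + l) R) (m - 1 - i) := by
  rw [cycleOp]
  have e := map_descProd (placeHom (N := N) (Fin.castLE h) (Fin.castLE_injective _))
    (fun l => site m (i + l) R) (m - 1 - i)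
  have e' := SemiconjBy.descProd (g := (1 : Op N n ℂ)) (k := m - 1 - i)
    (σ := placeHom (N := N) (Fin.castLE h) (Fin.castLE_injective _) ∘ fun l => site m (i + l) R)
    (τ := fun l => site n (i + l) R)
    fun l hl => by
      have : liftOp h (site m (i + l) R) = site n (i + l) R := liftOp_site h (by omega) R
      rw [← this]; exact SemiconjBy.one_left _
  rw [SemiconjBy, one_mul, mul_one] at e'
  exact e.trans e'

namespace IsCharTower

variable (h : IsCharTower q μ R F)
include h

theorem antisymOp_mul_self (hA : CondA q μ n) (hi : i ≤ n) :
    antisymOp q μ R n i * antisymOp q μ R n i = antisymOp q μ R n i :=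
  antisymOf_mul_self h.good hA (h.family n) hi (by omega)

theorem cycleOp_semiconjBy {m s : ℕ} (hs : s ≤ m) :
    SemiconjBy (moveRight (fun i => site (m + 2) i R) s (m - s)) (cycleOp R (m + 2) (s + 2))
      (liftOp (m.le_add_right 2) (cycleOp R m s)) := by
  rw [liftOp_cycleOp, cycleOp, show m + 2 - 1 - (s + 2) = m - 1 - s by omega]
  refine SemiconjBy.descProd fun l hl => ?_
  have := moveRight_shift (h.family (m + 2)) (p := s) (d := m - s) (l := s + l) (by omega)
    (by omega) (by omega)
  rwa [show s + l + 2 = s + 2 + l by omega] at this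

theorem antisymOp_semiconjBy {m s i : ℕ} (hi : i ≤ s) (hs : s ≤ m) :
    SemiconjBy (moveRight (fun i => site (m + 2) i R) s (m - s)) (antisymOp q μ R (m + 2) i)
      (liftOp (m.le_add_right 2) (antisymOp q μ R m i)) := by
  rw [liftOp_antisymOp _ (hi.trans hs)]
  exact antisymOp_commute fun l hl =>
    moveRight_commute (h.family (m + 2)) (p := s) (d := m - s) (by omega) (by omega)

/-- Expand a^{(i+2)} by its recursion. Since a^{(i+1)} commutes with the cycle starting at i + 1,
its two copies merge under ch, and the terms of the baxterized element give E, U and V. -/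
theorem newton_step (hA : CondA q μ n) (hi : i + 2 ≤ n) :
    qNum q (i + 2) • newtonU q μ R F n (i + 1) = q ^ (i + 1) • newtonE q μ R F n (i + 1) -
      qNum q (i + 1) • newtonU q μ R F n i +
      (q ^ (i + 1) * baxV q μ (q ^ (2 * (i + 1)))⁻¹) • newtonV q μ R F n i := by
  have hAA := h.antisymOp_mul_self hA (i := i + 1) (by omega)
  have hAW := antisymOp_commute_cycleOp (q := q) (μ := μ) (R := R) (n := n) (le_refl (i + 1))
  have hU : newtonU q μ R F n i = chLin R F n (antisymOp q μ R n (i + 1) *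
      (cycleOp R n (i + 1) * site n i R)) := by
    rw [newtonU, cycleOp_succ (by omega)]
  have hu : q ^ (i + 1) * baxU q (q ^ (2 * (i + 1)))⁻¹ = - qNum q (i + 1) := by
    have := h.good.q_ne
    have := h.good.lam_ne
    rw [baxU, qNum]
    field_simp
    ring
  have e : newtonU q μ R F n (i + 1) = (q ^ (i + 1) / qNum q (i + 2)) •
      (newtonE q μ R F n (i + 1) + baxU q (q ^ (2 * (i + 1)))⁻¹ • newtonU q μ R F n i +
        baxV q μ (q ^ (2 * (i + 1)))⁻¹ • newtonV q μ R F n i) := by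
    rw [hU, newtonE, newtonV, newtonU, antisymOp_add_two]
    set A := antisymOp q μ R n (i + 1)
    set W := cycleOp R n (i + 1)
    have e1 : ∀ b, chLin R F n (A * b * A * W) = chLin R F n (A * (W * b)) := fun b => by
      rw [mul_assoc (A * b), h.comm (mul_mem antisymOp_mem cycleOp_mem), hAW.eq, mul_assoc,
        ← mul_assoc A A, hAA, ← mul_assoc, ← mul_assoc, hAW.eq]
    rw [smul_mul_assoc, map_smul, e1]
    simp only [mul_add, mul_one, map_add, map_smul, mul_smul_comm]
  rw [e, smul_smul, mul_div_cancel₀ _ (hA.qNum_ne h.good (by omega) hi), smul_add, smul_add,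
    smul_smul, smul_smul, hu]
  module

theorem newtonV_zero {m : ℕ} (hm : 0 < m) :
    newtonV q μ R F (m + 2) 0 = μ⁻¹ • (newtonE q μ R F m 0 * contr q μ R F) := by
  have := h.chLin_contract_left hm (S := cycleOp R (m + 2) 2) (S' := 1)
    (X := cycleOp R (m + 2) 2) (X' := cycleOp R m 0) cycleOp_mem cycleOp_mem
    (cycleOp_commute_site (by omega)) (Commute.one_left _) (one_mul _)
    (h.cycleOp_semiconjBy (Nat.zero_le m)) 0 1 0
  rw [newtonV, cycleOp_succ (by omega), newtonE]
  simpa [antisymOp, antisymOf, mul_assoc] using this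

theorem newtonV_two : newtonV q μ R F 2 0 = eta q μ • contr q μ R F := by
  rw [newtonV, cycleOp_eq_one (by omega), ← h.chLin_kappaOf_two, one_mul]
  simp [antisymOp, antisymOf]

/-- The antisymmetrizer is opened at R_s and R_{s+2} is split off from the cycle, so the contraction
at s + 1 has generators on both sides and `chLin_contract` applies, with second factor 0 · 1 + 1 ·
R_{s+2} + 0 · κ. -/
theorem newtonV_succ {m s : ℕ} (hA : CondA q μ (m + 2)) (hs : s + 2 ≤ m) {c t u v : ℂ}
    (hc : c = q ^ (s + 1) / qNum q (s + 2)) (ht : t = (q ^ (2 * (s + 1)))⁻¹) (hu : u = baxU q t)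
    (hv : v = baxV q μ t) :
    newtonV q μ R F (m + 2) (s + 1) = (c • ((μ⁻¹ * (1 + (q - q⁻¹) * u)) • newtonE q μ R F m (s + 1) +
      (v - (q - q⁻¹) * u) • newtonU q μ R F m s + u • newtonV q μ R F m s)) * contr q μ R F := by
  have hX' : antisymOp q μ R m (s + 1) * cycleOp R m (s + 1) ∈ siteAlgebra R m :=
    mul_mem antisymOp_mem cycleOp_mem
  have := h.chLin_contract hs (A := antisymOp q μ R (m + 2) (s + 1)) (S := cycleOp R (m + 2) (s + 3))
    (S' := 1) (X := antisymOp q μ R (m + 2) (s + 1) * cycleOp R (m + 2) (s + 3))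
    (X' := antisymOp q μ R m (s + 1) * cycleOp R m (s + 1)) antisymOp_mem cycleOp_mem hX'
    (fun l hl => antisymOp_commute_site (by omega)) (fun l hl => cycleOp_commute_site (by omega))
    (Commute.one_left _) (antisymOp_commute_cycleOp (by omega))
    (by rw [mul_one, ← mul_assoc, h.antisymOp_mul_self hA (by omega)])
    (by
      rw [liftOp_mul]
      exact (h.antisymOp_semiconjBy (s := s + 1) le_rfl (by omega)).mul_right
        (h.cycleOp_semiconjBy (s := s + 1) (by omega)))
    u v 0 1 0
  have e0 : (0 : ℂ) • (1 : Op N (m + 2) ℂ) + (1 : ℂ) • site (m + 2) (s + 2) R +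
      (0 : ℂ) • kappaOf q μ (site (m + 2) (s + 2) R) = site (m + 2) (s + 2) R := by
    rw [zero_smul, zero_smul, one_smul, zero_add, add_zero]
  rw [e0, mul_one, mul_assoc _ (cycleOp R (m + 2) (s + 3) * _)] at this
  have hU : newtonU q μ R F m s =
      chLin R F m (antisymOp q μ R m (s + 1) * cycleOp R m (s + 1) * site m s R) := by
    rw [newtonU, cycleOp_succ (by omega : s + 1 < m), mul_assoc]
  have hV : newtonV q μ R F m s =
      chLin R F m (antisymOp q μ R m (s + 1) * cycleOp R m (s + 1) * kappaOf q μ (site m s R)) := by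
    rw [newtonV, mul_assoc]
  rw [newtonV, cycleOp_succ (i := s + 1 + 1) (by omega), antisymOp_add_two, ← ht, ← hu, ← hv, ← hc,
    smul_mul_assoc, map_smul, this, smul_mul_assoc, hU, hV, newtonE]
  congr 3
  · congr 2
    · ring
    · rw [mul_zero, mul_one, mul_one, zero_add]
  · rw [mul_zero, mul_one, add_zero]

theorem newtonV_last {s : ℕ} (hA : CondA q μ (s + 3)) {c t : ℂ}
    (hc : c = q ^ (s + 1) / qNum q (s + 2)) (ht : t = (q ^ (2 * (s + 1)))⁻¹) :
    newtonV q μ R F (s + 3) (s + 1) = (c * (eta q μ + baxU q t * μ⁻¹ + baxV q μ t)) •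
      (chLin R F (s + 1) (antisymOp q μ R (s + 1) (s + 1)) * contr q μ R F) := by
  have := h.chLin_contract_right (A := antisymOp q μ R (s + 3) (s + 1))
    (X' := antisymOp q μ R (s + 1) (s + 1)) antisymOp_mem antisymOp_mem
    (antisymOp_commute_site le_rfl)
    (by rw [h.antisymOp_mul_self hA (by omega), liftOp_antisymOp _ le_rfl])
    (baxU q t) (baxV q μ t)
  rw [newtonV, cycleOp_eq_one (by omega), antisymOp_add_two, ← ht, ← hc, smul_mul_assoc, map_smul,
    one_mul, this, smul_smul]

end IsCharTower

end Newton


/-! ### Scalar identities for the Newton relations -/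

section NewtonScalars

variable {q μ Q : ℂ}

/-- The coefficients of the Newton recursion. -/
noncomputable def newtonT (q μ Q : ℂ) : ℂ := μ * Q * (Q ^ 2 - 1) / (q + μ * Q ^ 2)

theorem GoodParameters.sq_sub_one_ne (hp : GoodParameters q μ) : q ^ 2 - 1 ≠ 0 := by
  intro h
  apply hp.lam_ne
  have := hp.q_ne
  field_simp
  linear_combination h

theorem newtonT_eq (hμ : μ ≠ 0) (hQ : Q ≠ 0) (h1 : q + μ * Q ^ 2 ≠ 0) :
    Q * baxV q μ (Q ^ 2)⁻¹ = -newtonT q μ Q := by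
  have h : q * μ⁻¹ * (Q ^ 2)⁻¹ + 1 = (q + μ * Q ^ 2) / (μ * Q ^ 2) := by field_simp
  rw [baxV, newtonT, h]
  field_simp
  ring

theorem baxV_eq (hμ : μ ≠ 0) (hQ : Q ≠ 0) :
    baxV q μ (Q ^ 2)⁻¹ = μ * (1 - Q ^ 2) / (q + μ * Q ^ 2) := by
  have h : q * μ⁻¹ * (Q ^ 2)⁻¹ + 1 = (q + μ * Q ^ 2) / (μ * Q ^ 2) := by field_simp
  rw [baxV, h, div_div_eq_mul_div]
  congr 1
  field_simp

variable (hp : GoodParameters q μ) (hQ : Q ≠ 0) (h1 : q + μ * Q ^ 2 ≠ 0)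
  (h2 : q + μ * (q * Q) ^ 2 ≠ 0) (h3 : (q * Q) ^ 2 - 1 ≠ 0)
include hp hQ h1 h2 h3

/-- Here Q stands for q^{s+1}. After E is eliminated by `newton_step`, this lemma evaluates the
coefficient of U_s and the next one that of V_s in T(qQ) V_{s+1}. The latter being -T(Q) is what
makes the alternating sum of the V_i reproduce itself two levels lower. -/
theorem newton_scalar_u :
    newtonT q μ (q * Q) * (Q / ((q * Q - (q * Q)⁻¹) / (q - q⁻¹)) *
      (μ⁻¹ * (Q ^ 2)⁻¹ * (Q⁻¹ * ((Q - Q⁻¹) / (q - q⁻¹))) + baxV q μ (Q ^ 2)⁻¹ -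
        ((Q ^ 2)⁻¹ - 1))) = newtonT q μ Q * μ⁻¹ * (q ^ 2 / Q ^ 2) := by
  have hq := hp.q_ne
  have hμ := hp.mu_ne
  have hl := hp.sq_sub_one_ne
  rw [baxV_eq hμ hQ, newtonT, newtonT]
  have h2' : q + μ * q ^ 2 * Q ^ 2 ≠ 0 := by rwa [mul_pow, ← mul_assoc] at h2
  have h3' : q ^ 2 * Q ^ 2 - 1 ≠ 0 := by rwa [mul_pow] at h3
  have h4 : 1 + μ * q * Q ^ 2 ≠ 0 := fun h => h2' (by linear_combination q * h)
  field_simp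
  ring

theorem newton_scalar_v :
    newtonT q μ (q * Q) * (Q / ((q * Q - (q * Q)⁻¹) / (q - q⁻¹)) *
      (baxU q (Q ^ 2)⁻¹ - μ⁻¹ * (Q ^ 2)⁻¹ * baxV q μ (Q ^ 2)⁻¹)) = -newtonT q μ Q := by
  have hq := hp.q_ne
  have hμ := hp.mu_ne
  have hl := hp.sq_sub_one_ne
  rw [baxV_eq hμ hQ, baxU, newtonT, newtonT]
  have h2' : q + μ * q ^ 2 * Q ^ 2 ≠ 0 := by rwa [mul_pow, ← mul_assoc] at h2
  have h3' : q ^ 2 * Q ^ 2 - 1 ≠ 0 := by rwa [mul_pow] at h3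
  have h4 : 1 + μ * q * Q ^ 2 ≠ 0 := fun h => h2' (by linear_combination q * h)
  field_simp
  ring

/-- The last contraction has no strand to its right. Its defect μQ - q/Q is the source of the
coefficients on the right-hand side of the Newton relations. -/
theorem newton_scalar_last :
    newtonT q μ (q * Q) * (Q / ((q * Q - (q * Q)⁻¹) / (q - q⁻¹)) *
      (eta q μ + baxU q (Q ^ 2)⁻¹ * μ⁻¹ + baxV q μ (Q ^ 2)⁻¹)) =
    newtonT q μ Q * μ⁻¹ * (q ^ 2 / Q ^ 2) - (μ * Q - q / Q) := by
  have hq := hp.q_ne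
  have hμ := hp.mu_ne
  have hl := hp.sq_sub_one_ne
  rw [baxV_eq hμ hQ, baxU, newtonT, newtonT, eta]
  have h2' : q + μ * q ^ 2 * Q ^ 2 ≠ 0 := by rwa [mul_pow, ← mul_assoc] at h2
  have h3' : q ^ 2 * Q ^ 2 - 1 ≠ 0 := by rwa [mul_pow] at h3
  have h4 : 1 + μ * q * Q ^ 2 ≠ 0 := fun h => h2' (by linear_combination q * h)
  field_simp
  ring

end NewtonScalars

/-! ### Telescoping of the Newton relations -/

section Newton

variable {N : ℕ} {q μ : ℂ} {R F : Op N 2 ℂ} {n i : ℕ}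

theorem CondA.add_pow_ne (hp : GoodParameters q μ) (hA : CondA q μ n) (h1 : 1 ≤ i)
    (hi : i + 1 ≤ n) : q + μ * (q ^ i) ^ 2 ≠ 0 := by
  intro h
  have hQ : q ^ i ≠ 0 := pow_ne_zero _ hp.q_ne
  refine hA.add_ne hp h1 hi ?_
  rw [pow_mul']
  field_simp
  linear_combination h

theorem CondA.pow_sub_one_ne (hp : GoodParameters q μ) (hA : CondA q μ n) (h1 : 1 ≤ i)
    (hi : i ≤ n) : (q ^ i) ^ 2 - 1 ≠ 0 := by
  intro h
  have hQ : q ^ i ≠ 0 := pow_ne_zero _ hp.q_ne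
  refine hA.qNum_ne hp h1 hi ?_
  rw [qNum, div_eq_zero_iff]
  left
  field_simp
  linear_combination h

/-- The elementary sums. -/
noncomputable def elemSum (q μ : ℂ) (R F : Op N 2 ℂ) (i : ℕ) : QMA R F :=
  chLin R F i (antisymOp q μ R i i)

/-- The power sums. -/
noncomputable def cycleSum (R F : Op N 2 ℂ) (i : ℕ) : QMA R F := chLin R F i (cycleOp R i 0)

theorem newtonU_last (n : ℕ) : newtonU q μ R F (n + 1) n = elemSum q μ R F (n + 1) := by
  rw [newtonU, cycleOp_eq_one le_rfl, mul_one, elemSum]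

theorem chLin_zero_one : chLin R F 0 1 = 1 := by
  change rTrace R (stringM R F 0 * scal _ 1) = 1
  rw [scal_one, mul_one]
  simp [stringM, rTrace]

theorem elemSum_zero : elemSum q μ R F 0 = 1 := chLin_zero_one

namespace IsCharTower

variable (h : IsCharTower q μ R F)
include h

theorem newtonE_eq (hi : i < n) :
    newtonE q μ R F n i = elemSum q μ R F i * cycleSum R F (n - i) := by
  obtain ⟨k, rfl⟩ : ∃ k, n = i + k := ⟨n - i, by omega⟩
  have := h.mul (X := antisymOp q μ R i i) (k := k) antisymOp_mem
    (descProd (fun l => FreeAlgebra.ι ℂ l) (k - 1))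
  rw [liftOp_antisymOp _ le_rfl, map_descProd, map_descProd] at this
  rw [newtonE, elemSum, cycleSum, Nat.add_sub_cancel_left, cycleOp, cycleOp,
    show i + k - 1 - i = k - 1 - 0 by omega]
  simpa [Function.comp_def, evalSites] using this

theorem newtonT_smul_newtonV_zero {m : ℕ} (hm : 0 < m) :
    newtonT q μ (q ^ 1) • newtonV q μ R F (m + 2) 0 =
      (newtonT q μ (q ^ 1) * μ⁻¹ * (q ^ (2 * 0))⁻¹) • (newtonU q μ R F m 0 * contr q μ R F) := by
  rw [h.newtonV_zero hm, smul_smul, mul_zero, pow_zero, inv_one, mul_one]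
  rfl

theorem newtonT_smul_newtonV_succ {m s : ℕ} (hA : CondA q μ (m + 2)) (hs : s + 2 ≤ m) :
    newtonT q μ (q ^ (s + 2)) • newtonV q μ R F (m + 2) (s + 1) =
      ((newtonT q μ (q ^ (s + 2)) * μ⁻¹ * (q ^ (2 * (s + 1)))⁻¹) • newtonU q μ R F m (s + 1) +
        (newtonT q μ (q ^ (s + 1)) * μ⁻¹ * (q ^ (2 * s))⁻¹) • newtonU q μ R F m s -
        newtonT q μ (q ^ (s + 1)) • newtonV q μ R F m s) * contr q μ R F := by
  have hp := h.good
  have hQ : q ^ (s + 1) ≠ 0 := pow_ne_zero _ hp.q_ne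
  have e := h.newton_step (hA.mono (by omega)) hs
  have h1 := hA.add_pow_ne hp (i := s + 1) (by omega) (by omega)
  have h2 := hA.add_pow_ne hp (i := s + 2) (by omega) (by omega)
  have h3 := hA.pow_sub_one_ne hp (i := s + 2) (by omega) (by omega)
  have hn := hA.qNum_ne hp (j := s + 2) (by omega) (by omega)
  have hqs : q ^ (s + 2) = q * q ^ (s + 1) := pow_succ' q (s + 1)
  have hqt : (q ^ (2 * s))⁻¹ = q ^ 2 / (q ^ (s + 1)) ^ 2 := by
    have := hp.q_ne
    rw [pow_succ, pow_mul']
    field_simp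
    ring
  have hl : (q - q⁻¹) * baxU q ((q ^ (s + 1)) ^ 2)⁻¹ = ((q ^ (s + 1)) ^ 2)⁻¹ - 1 :=
    mul_div_cancel₀ _ hp.lam_ne
  have hE : newtonE q μ R F m (s + 1) = (q ^ (s + 1))⁻¹ • (qNum q (s + 2) • newtonU q μ R F m (s + 1) +
      qNum q (s + 1) • newtonU q μ R F m s) -
      baxV q μ (q ^ (2 * (s + 1)))⁻¹ • newtonV q μ R F m s := by
    rw [e, sub_add_eq_add_sub, sub_add_cancel, smul_add, smul_smul, smul_smul,
      inv_mul_cancel₀ hQ, inv_mul_cancel_left₀ hQ, one_smul, add_sub_cancel_right]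
  rw [h.newtonV_succ hA hs rfl rfl rfl rfl, ← smul_mul_assoc, hE]
  congr 1
  rw [hqs] at h2 h3
  rw [qNum, hqs] at hn
  rw [hqt, pow_mul' q 2 (s + 1), qNum, qNum, hqs]
  have s1 := newton_scalar_u hp hQ h1 h2 h3
  have s2 := newton_scalar_v hp hQ h1 h2 h3
  set Q := q ^ (s + 1)
  have hc : Q / ((q * Q - (q * Q)⁻¹) / (q - q⁻¹)) * (Q⁻¹ * ((q * Q - (q * Q)⁻¹) / (q - q⁻¹))) = 1 := by
    rw [div_mul_eq_mul_div, mul_inv_cancel_left₀ hQ, div_self hn]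
  match_scalars
  · rw [hl]
    linear_combination (newtonT q μ (q * Q)) * μ⁻¹ * (Q ^ 2)⁻¹ * hc
  · rw [hl]
    linear_combination s1
  · rw [hl]
    linear_combination s2

/-- The U-terms of neighbouring summands cancel and only the last survives; the V-terms assemble
into the same sum at level m. -/
theorem newton_contraction_partial {m j : ℕ} (hA : CondA q μ (m + 2)) (hj : j + 1 ≤ m) :
    ∑ i ∈ Finset.range (j + 1),
      ((-1) ^ (i + 1) * newtonT q μ (q ^ (i + 1))) • newtonV q μ R F (m + 2) i =
    (∑ i ∈ Finset.range j,
      ((-1) ^ (i + 1) * newtonT q μ (q ^ (i + 1))) • newtonV q μ R F m i) * contr q μ R F +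
    ((-1) ^ (j + 1) * (newtonT q μ (q ^ (j + 1)) * μ⁻¹ * (q ^ (2 * j))⁻¹)) •
      (newtonU q μ R F m j * contr q μ R F) := by
  induction j with
  | zero =>
    rw [Finset.sum_range_one, Finset.sum_range_zero, zero_mul, zero_add, mul_smul, mul_smul,
      h.newtonT_smul_newtonV_zero (by omega), zero_add]
  | succ j ih =>
    rw [Finset.sum_range_succ, ih (by omega), mul_smul _ (newtonT q μ (q ^ (j + 1 + 1))),
      h.newtonT_smul_newtonV_succ hA (by omega),
      Finset.sum_range_succ]
    simp only [add_mul, sub_mul, smul_mul_assoc]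
    match_scalars <;> ring

/-- The part of the Newton relation which is due to the contractions. -/
theorem newton_contraction_step (m : ℕ) (hA : CondA q μ (m + 2)) :
    ∑ i ∈ Finset.range (m + 1),
      ((-1) ^ (i + 1) * newtonT q μ (q ^ (i + 1))) • newtonV q μ R F (m + 2) i =
    (∑ i ∈ Finset.range (m - 1),
      ((-1) ^ (i + 1) * newtonT q μ (q ^ (i + 1))) • newtonV q μ R F m i) * contr q μ R F +
    ((-1) ^ m * (μ * q ^ m - q / q ^ m)) • (elemSum q μ R F m * contr q μ R F) := by
  have hp := h.good
  rcases m with _ | s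
  -- With no strands besides the contracted pair, V_0 is ηg.
  · have h2 := hA.add_pow_ne hp (i := 1) (by omega) (by omega)
    have hq := hp.q_ne
    have hμ := hp.mu_ne
    have hl := hp.sq_sub_one_ne
    rw [Finset.sum_range_one, Finset.sum_range_zero, zero_mul, zero_add, h.newtonV_two, smul_smul,
      elemSum_zero, one_mul (contr q μ R F)]
    match_scalars
    rw [newtonT, eta]
    simp only [pow_one] at h2 ⊢
    have h4 : 1 + μ * q ≠ 0 := fun h => h2 (by linear_combination q * h)
    field_simp
    ring
  · have hQ : q ^ (s + 1) ≠ 0 := pow_ne_zero _ hp.q_ne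
    have h1 := hA.add_pow_ne hp (i := s + 1) (by omega) (by omega)
    have h2 := hA.add_pow_ne hp (i := s + 2) (by omega) (by omega)
    have h3 := hA.pow_sub_one_ne hp (i := s + 2) (by omega) (by omega)
    have hqs : q ^ (s + 2) = q * q ^ (s + 1) := pow_succ' q (s + 1)
    have hqt : (q ^ (2 * s))⁻¹ = q ^ 2 / (q ^ (s + 1)) ^ 2 := by
      have := hp.q_ne
      rw [pow_succ, pow_mul']
      field_simp
      ring
    rw [hqs] at h2 h3
    have s1 := newton_scalar_last hp hQ h1 h2 h3
    rw [Finset.sum_range_succ, h.newton_contraction_partial hA (by omega), newtonU_last, add_assoc,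
      h.newtonV_last hA rfl rfl, ← elemSum, Nat.add_sub_cancel, hqt, pow_mul' q 2 (s + 1), qNum, hqs]
    congr 1
    rw [smul_smul, ← add_smul]
    congr 1
    linear_combination (-1) ^ (s + 2) * s1

/-- Induction in steps of two: multiplication by g shifts i to i + 1, and the new term is i = 1. -/
theorem newton_contraction (n : ℕ) (hA : CondA q μ n) :
    ∑ i ∈ Finset.range (n - 1),
      ((-1) ^ (i + 1) * newtonT q μ (q ^ (i + 1))) • newtonV q μ R F n i =
    (-1 : ℂ) ^ n • ∑ i ∈ Finset.Icc 1 (n / 2),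
      (μ * q ^ ((n : ℤ) - 2 * i) - q ^ (1 - (n : ℤ) + 2 * i)) •
        (elemSum q μ R F (n - 2 * i) * contr q μ R F ^ i) := by
  induction n using Nat.twoStepInduction with
  | zero => simp
  | one => simp
  | more m ih _ =>
    have hq := h.good.q_ne
    have e : ∀ f : ℕ → QMA R F, ∑ i ∈ Finset.Icc 1 ((m + 2) / 2), f i =
        ∑ i ∈ Finset.Icc 1 (m / 2), f (i + 1) + f 1 := fun f => by
      rw [Nat.add_div_right _ (by omega)]
      generalize m / 2 = k
      induction k with
      | zero => simp
      | succ k ih =>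
        rw [Finset.sum_Icc_succ_top (by omega), ih,
          Finset.sum_Icc_succ_top (by omega)]
        abel
    rw [show m + 2 - 1 = m + 1 by omega, h.newton_contraction_step m hA, ih (hA.mono (by omega)),
      e, smul_mul_assoc, Finset.sum_mul, smul_add, mul_smul,
      show (-1 : ℂ) ^ (m + 2) = (-1) ^ m by rw [pow_add]; norm_num]
    congr 2
    · refine Finset.sum_congr rfl fun i _ => ?_
      rw [smul_mul_assoc, mul_assoc, ← pow_succ, show m + 2 - 2 * (i + 1) = m - 2 * i by omega]
      congr 1
      push_cast
      ring_nf
    · rw [show m + 2 - 2 * 1 = m by omega, pow_one]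
      congr 1
      push_cast
      rw [show ((m : ℤ) + 2 - 2) = m by ring, show 1 - ((m : ℤ) + 2) + 2 = 1 - m by ring,
        zpow_sub₀ hq, zpow_one, zpow_natCast]

/-- By `newton_step` each E_{i+1} is a sum of neighbouring U's and a V; the signs make the U's
telescope. -/
theorem newton_sum_partial {j : ℕ} (hA : CondA q μ n) (hj : j + 1 ≤ n) :
    ∑ i ∈ Finset.range (j + 1), (-q) ^ i • newtonE q μ R F n i =
      ((-1) ^ j * qNum q (j + 1)) • newtonU q μ R F n j + ∑ i ∈ Finset.range j,
        ((-1) ^ (i + 1) * newtonT q μ (q ^ (i + 1))) • newtonV q μ R F n i := by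
  have hp := h.good
  induction j with
  | zero =>
    have : qNum q 1 = 1 := by rw [qNum, pow_one, div_self hp.lam_ne]
    simp [this, newtonU, newtonE, antisymOp, antisymOf]
  | succ j ih =>
    have h1 := hA.add_pow_ne hp (i := j + 1) (by omega) (by omega)
    have e := h.newton_step hA hj
    rw [pow_mul', newtonT_eq hp.mu_ne (pow_ne_zero _ hp.q_ne) h1] at e
    have e' : (-q) ^ (j + 1) • newtonE q μ R F n (j + 1) = (-1 : ℂ) ^ (j + 1) •
        (qNum q (j + 2) • newtonU q μ R F n (j + 1) + qNum q (j + 1) • newtonU q μ R F n j +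
          newtonT q μ (q ^ (j + 1)) • newtonV q μ R F n j) := by
      rw [e, neg_pow q]; module
    rw [Finset.sum_range_succ, ih (by omega), e', Finset.sum_range_succ]
    match_scalars <;> ring

/-- The Newton relations. -/
theorem newton (hA : CondA q μ n) :
    ∑ i ∈ Finset.range n, (-q) ^ i • (elemSum q μ R F i * cycleSum R F (n - i)) =
      ((-1) ^ (n + 1) * qNum q n) • elemSum q μ R F n +
        (-1 : ℂ) ^ n • ∑ i ∈ Finset.Icc 1 (n / 2),
          (μ * q ^ ((n : ℤ) - 2 * i) - q ^ (1 - (n : ℤ) + 2 * i)) •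
            (elemSum q μ R F (n - 2 * i) * contr q μ R F ^ i) := by
  rw [← h.newton_contraction n hA]
  rcases n with _ | n
  · simp [qNum]
  · rw [Finset.sum_congr rfl fun i hi => by rw [← h.newtonE_eq (Finset.mem_range.1 hi)],
      h.newton_sum_partial hA le_rfl, newtonU_last, pow_add _ (n + 1) 1, pow_add _ n 1]
    simp

end IsCharTower

end Newton


/-! ### Scalar identities for the Wronski relations -/

section WronskiScalars

variable {q μ x y : ℂ}

theorem baxV_eq_div (hμ : μ ≠ 0) (x : ℂ) : baxV q μ x = μ * (x - 1) / (μ + q * x) := by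
  have h : q * μ⁻¹ * x + 1 = (μ + q * x) / μ := by field_simp; ring
  rw [baxV, h, div_div_eq_mul_div]
  congr 1
  ring

theorem baxV_neg_inv_eq_div (hq : q ≠ 0) (hμ : μ ≠ 0) (y : ℂ) :
    baxV (-q⁻¹) μ y = q * μ * (y - 1) / (q * μ - y) := by
  have h : -q⁻¹ * μ⁻¹ * y + 1 = (q * μ - y) / (q * μ) := by field_simp; ring
  rw [baxV, h, div_div_eq_mul_div]
  congr 1
  ring

theorem baxU_neg_inv (t : ℂ) : baxU (-q⁻¹) t = baxU q t := by
  rw [baxU, baxU, inv_neg, inv_inv]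
  congr 1
  ring

/-- The coefficients which appear in the Wronski relations. -/
noncomputable def wronskiG (q μ x y : ℂ) : ℂ := ((μ + x / q) * (μ - q * y))⁻¹

noncomputable def wronskiL (q μ x y : ℂ) : ℂ :=
  baxU q y * ((y - μ / q) * (x * y - q ^ 2 * μ ^ 2)) / (μ * (q * μ - y) * (x - y))

noncomputable def wronskiR (q μ x y : ℂ) : ℂ :=
  q ^ 2 * baxU q x * ((x + q * μ) * (x * y - μ ^ 2 / q ^ 2)) / (q * μ * (μ + q * x) * (x - y))

noncomputable def wronskiZ (q μ x y : ℂ) : ℂ :=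
  (q - x / q) / (q - q⁻¹) * ((q * y - q⁻¹) / (q - q⁻¹)) * wronskiG q μ x y

noncomputable def wronskiE (q μ x y : ℂ) : ℂ :=
  -(baxU q y * (x * y - q ^ 2 * μ ^ 2) / (μ * (q * μ + x) * (q * μ - y) * (x - y))) *
    ((q - x / q) / (q - q⁻¹))

variable (hp : GoodParameters q μ) (hx : μ + q * x ≠ 0) (hy : q * μ - y ≠ 0)

include hp in
-- The two boundary contractions, with strands on one side only, have the coefficients L at x = 1
-- and R at y = 1 of the general case.
theorem wronski_scalar_left (hy : q * μ - y ≠ 0) (h1 : 1 - y ≠ 0) :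
    eta q μ + baxU q y * μ⁻¹ + baxV (-q⁻¹) μ y = wronskiL q μ 1 y := by
  have hq := hp.q_ne
  have hμ := hp.mu_ne
  have hl := hp.sq_sub_one_ne
  rw [baxV_neg_inv_eq_div hq hμ, wronskiL, baxU, eta]
  field_simp
  ring

include hp in
theorem wronski_scalar_right (hx : μ + q * x ≠ 0) (h1 : x - 1 ≠ 0) :
    eta q μ + baxU q x * μ⁻¹ + baxV q μ x = wronskiR q μ x 1 := by
  have hq := hp.q_ne
  have hμ := hp.mu_ne
  have hl := hp.sq_sub_one_ne
  rw [baxV_eq_div hμ, wronskiR, baxU, eta]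
  field_simp
  ring

variable (hxy : x - y ≠ 0)
include hp hx hy hxy

/-- L and R are the solution of two linear equations, this one and the next: the combination L ·
(left step) + R · (right step) must reproduce the coefficients of AS and P in a contracted Q. -/
theorem wronski_scalar_one :
    1 * (eta q μ + baxU q x * μ⁻¹ + baxV q μ x) + baxU q y * μ⁻¹ + baxV (-q⁻¹) μ y +
      baxU q x * baxU q y * ((q - q⁻¹) * μ⁻¹) = wronskiL q μ x y + wronskiR q μ x y := by
  have hq := hp.q_ne
  have hμ := hp.mu_ne
  have hl := hp.sq_sub_one_ne
  rw [baxV_neg_inv_eq_div hq hμ, baxV_eq_div hμ, wronskiL, wronskiR, baxU, baxU, eta]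
  field_simp
  ring

theorem wronski_scalar_sigma :
    baxU q x * baxV (-q⁻¹) μ y + baxV q μ x * baxU q y - (q - q⁻¹) * baxU q x * baxU q y =
      wronskiL q μ x y * baxU q x + wronskiR q μ x y * baxU q y := by
  have hq := hp.q_ne
  have hμ := hp.mu_ne
  have hl := hp.sq_sub_one_ne
  rw [baxV_neg_inv_eq_div hq hμ, baxV_eq_div hμ, wronskiL, wronskiR, baxU, baxU]
  have hx2 : μ + x * q ≠ 0 := by rwa [mul_comm x]
  field_simp
  ring

/-- What is left of Q after this matching carries the weight Z of the lower level, times a factor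
which depends only on the ratio y/x. -/
theorem wronski_scalar_kappa (hx' : μ + x / q ≠ 0) (hy' : μ - q * y ≠ 0) :
    wronskiG q μ x y * (baxU q x * baxU q y + baxV q μ x * baxV (-q⁻¹) μ y -
      wronskiL q μ x y * baxV q μ x - wronskiR q μ x y * baxV (-q⁻¹) μ y) =
      -((q ^ 2 * x - y / q ^ 2) / (x - y)) * wronskiZ q μ (q ^ 2 * x) (y / q ^ 2) := by
  have hq := hp.q_ne
  have hμ := hp.mu_ne
  have hl := hp.sq_sub_one_ne
  have h1 : q * μ + x ≠ 0 := fun h => hx' (by field_simp; linear_combination h)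
  have h2 : wronskiG q μ (q ^ 2 * x) (y / q ^ 2) = q / ((μ + q * x) * (q * μ - y)) := by
    rw [wronskiG]
    have e1 : μ + q ^ 2 * x / q = μ + q * x := by field_simp
    have e2 : μ - q * (y / q ^ 2) = (q * μ - y) / q := by field_simp
    rw [e1, e2]
    field_simp
  have hx2 : μ + x * q ≠ 0 := by rwa [mul_comm x]
  have h4 : baxU q x * baxU q y + baxV q μ x * baxV (-q⁻¹) μ y - wronskiL q μ x y * baxV q μ x -
      wronskiR q μ x y * baxV (-q⁻¹) μ y = baxU q x * baxU q y * ((μ + x / q) * (μ - q * y)) *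
        (q ^ 3 * x - y / q) / ((μ + q * x) * (q * μ - y) * (x - y)) := by
    rw [baxV_neg_inv_eq_div hq hμ, baxV_eq_div hμ, wronskiL, wronskiR, baxU, baxU]
    field_simp
    ring
  have h5 : wronskiG q μ x y * ((μ + x / q) * (μ - q * y)) = 1 :=
    inv_mul_cancel₀ (mul_ne_zero hx' hy')
  have h6 : (q - q ^ 2 * x / q) / (q - q⁻¹) = -q * baxU q x := by
    rw [baxU]; field_simp; ring
  have h7 : (q * (y / q ^ 2) - q⁻¹) / (q - q⁻¹) = q⁻¹ * baxU q y := by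
    rw [baxU]; field_simp
  have h8 : q ^ 3 * x - y / q = q * (q ^ 2 * x - y / q ^ 2) := by field_simp
  rw [wronskiZ, h2, h4, h6, h7, h8, mul_div_assoc, mul_comm (baxU q x * baxU q y), ← mul_assoc,
    ← mul_assoc, ← mul_assoc, h5]
  generalize q ^ 2 * x - y / q ^ 2 = w
  field_simp

omit hx hy hxy in
theorem wronskiE_eq (hx' : μ + x / q ≠ 0) (hy' : μ - q * y ≠ 0) :
    wronskiE q μ x y = wronskiG q μ x y * wronskiL q μ x y * ((q - x / q) / (q - q⁻¹)) := by
  have hq := hp.q_ne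
  have h1 : q * μ + x ≠ 0 := fun h => hx' (by field_simp; linear_combination h)
  have h2 : y - μ / q = -(μ - q * y) / q := by field_simp; ring
  have h3 : wronskiG q μ x y = q / ((q * μ + x) * (μ - q * y)) := by
    rw [wronskiG]
    field_simp
  rw [wronskiE, wronskiL, h2, h3]
  congr 1
  generalize baxU q y = u
  generalize x * y - q ^ 2 * μ ^ 2 = w
  rw [show μ * (q * μ + x) * (q * μ - y) * (x - y) = (q * μ + x) * (μ * (q * μ - y) * (x - y)) by
    ring]
  generalize μ * (q * μ - y) * (x - y) = d
  generalize q * μ + x = e at *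
  generalize μ - q * y = f at *
  field_simp

omit hx hy hxy in
-- One function E gives the coefficient of H seen from the left and, with shifted arguments, from
-- the right. Therefore H-terms of neighbouring summands cancel in the alternating sum.
theorem wronskiE_shift (hx' : μ + x / q ≠ 0) (hy' : μ - q * y ≠ 0) :
    wronskiE q μ (q ^ 2 * x) (q ^ 2 * y) =
      wronskiG q μ x y * wronskiR q μ x y * ((q * y - q⁻¹) / (q - q⁻¹)) := by
  have hq := hp.q_ne
  have hμ := hp.mu_ne
  have hl := hp.sq_sub_one_ne
  have h1 : x + q * μ ≠ 0 := fun h => hx' (by field_simp; linear_combination h)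
  have h3 : wronskiG q μ x y = q / ((x + q * μ) * (μ - q * y)) := by
    rw [wronskiG]
    have : μ + x / q = (x + q * μ) / q := by field_simp; ring
    rw [this]
    field_simp
  rw [wronskiE, wronskiR, h3, baxU, baxU]
  rw [show q * μ + q ^ 2 * x = q * (μ + q * x) by ring, show q * μ - q ^ 2 * y = q * (μ - q * y) by
    ring, show q ^ 2 * x - q ^ 2 * y = q ^ 2 * (x - y) by ring,
    show q - q ^ 2 * x / q = -q * (x - 1) by field_simp; ring, show q ^ 2 * y - 1 = q * (q * y - q⁻¹) by field_simp,
    show q ^ 2 * x * (q ^ 2 * y) - q ^ 2 * μ ^ 2 = q ^ 4 * (x * y - μ ^ 2 / q ^ 2) by field_simp]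
  generalize x * y - μ ^ 2 / q ^ 2 = w
  generalize q * y - q⁻¹ = z
  generalize x - 1 = x1
  generalize x - y = d
  generalize μ + q * x = e
  generalize q - q⁻¹ = l
  generalize μ - q * y = f at *
  field_simp

end WronskiScalars


/-! ### Wronski relations: recursions and contraction terms -/

section Wronski

variable {N : ℕ} (q μ : ℂ) (R F : Op N 2 ℂ) (n i k : ℕ)

/-- The symmetrizer on the tensor factors `i, …, i + k - 1`. -/
noncomputable def symOp : Op N n ℂ := antisymOf (-q⁻¹) μ (fun l => site n (i + l) R) k

/-- In H the antisymmetrizer and the symmetrizer share the tensor factor i. In AS they are disjoint,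
and P and Q join disjoint ones by R_i and κ_i. -/
noncomputable def wronskiH : QMA R F :=
  chLin R F n (antisymOp q μ R n (i + 1) * symOp q μ R n i (n - i))

noncomputable def wronskiP : QMA R F :=
  chLin R F n (antisymOp q μ R n (i + 1) * symOp q μ R n (i + 1) (n - (i + 1)) * site n i R)

noncomputable def wronskiQ : QMA R F :=
  chLin R F n (antisymOp q μ R n (i + 1) * symOp q μ R n (i + 1) (n - (i + 1)) *
    kappaOf q μ (site n i R))

noncomputable def wronskiAS : QMA R F :=
  chLin R F n (antisymOp q μ R n i * symOp q μ R n i (n - i))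

variable {q μ R F n i k}

theorem symOp_mem : symOp q μ R n i k ∈ siteAlgebra R n := antisymOf_mem _ (fun _ => site_mem R n _) _

theorem symOp_one : symOp q μ R n i 1 = 1 := rfl

theorem symOp_commute {x : Op N n ℂ} (hx : ∀ l, i ≤ l → l + 1 < i + k → Commute x (site n l R)) :
    Commute x (symOp q μ R n i k) :=
  SemiconjBy.antisymOf fun _ _ => hx _ (by omega) (by omega)

theorem symOp_commute_site {l : ℕ} (hl : l + 1 < i) : Commute (symOp q μ R n i k) (site n l R) :=
  (symOp_commute fun _ hl' _ => site_commute' R R n (by omega)).symm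

theorem antisymOp_commute_symOp {j : ℕ} (hij : i ≤ j) :
    Commute (antisymOp q μ R n i) (symOp q μ R n j k) :=
  symOp_commute fun _ hl _ => antisymOp_commute_site (hij.trans hl)

theorem liftOp_symOp {m : ℕ} (h : m ≤ n) (hi : i + k ≤ m) : liftOp h (symOp q μ R m i k) =
    symOp q μ R n i k :=
  liftOp_antisymOf h fun _ hl => liftOp_site h (by omega) R

theorem baxterized_neg_inv (x : Op N n ℂ) (t : ℂ) : baxterized (-q⁻¹) μ (-q⁻¹ * μ⁻¹) x t =
    1 + baxU q t • x + baxV (-q⁻¹) μ t • kappaOf q μ x := by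
  rw [← baxU_neg_inv, ← kappaOf_neg_inv]
  rfl

theorem wronski_norm_left (hp : GoodParameters q μ) (hn : qNum q (i + 2) ≠ 0) {x : ℂ}
    (hx : x = (q ^ (2 * (i + 1)))⁻¹) :
    (q - x / q) / (q - q⁻¹) * (q ^ (i + 1) / qNum q (i + 2)) = 1 := by
  have := hp.q_ne
  have := hp.lam_ne
  rw [mul_div_assoc', div_eq_one_iff_eq hn, qNum, hx]
  field_simp
  ring

theorem wronski_norm_right (hp : GoodParameters q μ) (hn : qNum q (k + 2) ≠ 0) {y : ℂ}
    (hy : y = q ^ (2 * (k + 1))) :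
    (q * y - q⁻¹) / (q - q⁻¹) * ((q ^ (k + 1))⁻¹ / qNum q (k + 2)) = 1 := by
  have := hp.q_ne
  have := hp.lam_ne
  rw [mul_div_assoc', div_eq_one_iff_eq hn, qNum, hy]
  field_simp
  ring

theorem CondS.sub_ne (hp : GoodParameters q μ) (hS : CondS q μ n) (hk : 1 ≤ k) (hn : k + 1 ≤ n) :
    q * μ - q ^ (2 * k) ≠ 0 := by
  intro h
  refine (hS (k + 1) (by omega) hn).2 ?_
  rw [show 2 * ((k + 1 : ℕ) : ℤ) - 3 = ((2 * k : ℕ) : ℤ) - 1 by push_cast; ring, zpow_sub_one₀ hp.q_ne,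
    zpow_natCast, eq_mul_inv_iff_mul_eq₀ hp.q_ne]
  linear_combination h

namespace IsCharTower

variable (h : IsCharTower q μ R F)
include h

theorem symOp_mul_self (hS : CondS q μ n) (hi : i + k ≤ n) :
    symOp q μ R n i k * symOp q μ R n i k = symOp q μ R n i k := by
  rcases k with _ | k
  · exact one_mul _
  · exact antisymOf_mul_self h.neg_inv.good hS.condA
      ((h.neg_inv.family n).shift (i := i) (l := n - 1 - i) (by omega)) (by omega) (by omega)

/-- The recursion is taken at the left end, so that the exposed generator is the one adjacent to the
antisymmetrizer. -/
theorem symOp_add_two (hS : CondS q μ n) (hi : i + (k + 2) ≤ n) :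
    symOp q μ R n i (k + 2) = ((q ^ (k + 1))⁻¹ / qNum q (k + 2)) •
      (symOp q μ R n (i + 1) (k + 1) * (1 + baxU q (q ^ (2 * (k + 1))) • site n i R +
        baxV (-q⁻¹) μ (q ^ (2 * (k + 1))) • kappaOf q μ (site n i R)) *
        symOp q μ R n (i + 1) (k + 1)) := by
  have h1 : (-q⁻¹) ^ (k + 1) / qNum (-q⁻¹) (k + 2) = (q ^ (k + 1))⁻¹ / qNum q (k + 2) := by
    rw [qNum_neg_inv, neg_pow q⁻¹, inv_pow, show k + 2 + 1 = k + 1 + 2 by ring,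
      pow_add (-1 : ℂ) (k + 1) 2, neg_one_sq, mul_one,
      mul_div_mul_left _ _ (pow_ne_zero _ (by norm_num))]
  have h2 : ((-q⁻¹) ^ (2 * (k + 1)))⁻¹ = q ^ (2 * (k + 1)) := by
    rw [Even.neg_pow (even_two_mul _), inv_pow, inv_inv]
  have e := antisymOf_succ_left h.neg_inv.good hS.condA
    ((h.neg_inv.family n).shift (i := i) (l := k + 1) (by omega)) (by omega)
  rw [h1, h2, baxterized_neg_inv] at e
  simp only [add_zero, ← add_assoc] at e
  exact e

theorem symOp_semiconjBy {m s i k : ℕ} (hs : s ≤ i) (hik : i + k ≤ m) :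
    SemiconjBy (moveRight (fun i => site (m + 2) i R) s (m - s)) (symOp q μ R (m + 2) (i + 2) k)
      (liftOp (m.le_add_right 2) (symOp q μ R m i k)) := by
  rw [liftOp_symOp _ hik]
  refine SemiconjBy.antisymOf fun l hl => ?_
  have := moveRight_shift (h.family (m + 2)) (p := s) (d := m - s) (l := i + l) (by omega)
    (by omega) (by omega)
  rwa [show i + l + 2 = i + 2 + l by omega] at this

theorem wronskiAS_eq (hi : i ≤ n) :
    wronskiAS q μ R F n i = elemSum q μ R F i * elemSum (-q⁻¹) μ R F (n - i) := by
  obtain ⟨k, rfl⟩ : ∃ k, n = i + k := ⟨n - i, by omega⟩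
  have := h.mul (X := antisymOp q μ R i i) (k := k) antisymOp_mem
    (antisymOf (-q⁻¹) μ (fun l => FreeAlgebra.ι ℂ l) k)
  rw [liftOp_antisymOp _ le_rfl, map_antisymOf, map_antisymOf] at this
  rw [wronskiAS, elemSum, elemSum, Nat.add_sub_cancel_left]
  simpa [Function.comp_def, evalSites, symOp, antisymOp] using this

/-- The antisymmetrizer is opened here and the symmetrizer in `wronski_step_right`; the doubled
idempotent merges under the trace. Both yield the same AS, P, Q, with different coefficients. -/
theorem wronski_step_left (hA : CondA q μ n) (hi : i + 2 ≤ n) {x : ℂ}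
    (hx : x = (q ^ (2 * (i + 1)))⁻¹) :
    ((q - x / q) / (q - q⁻¹)) • wronskiH q μ R F n (i + 1) = wronskiAS q μ R F n (i + 1) +
      baxU q x • wronskiP q μ R F n i + baxV q μ x • wronskiQ q μ R F n i := by
  have hAA := h.antisymOp_mul_self hA (i := i + 1) (by omega)
  have hAW := antisymOp_commute_symOp (q := q) (μ := μ) (R := R) (n := n) (k := n - (i + 1))
    (le_refl (i + 1))
  have hn := hA.qNum_ne h.good (j := i + 2) (by omega) hi
  have hc := wronski_norm_left h.good hn hx
  rw [wronskiH, wronskiAS, wronskiP, wronskiQ, antisymOp_add_two, ← hx]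
  set A := antisymOp q μ R n (i + 1)
  set W := symOp q μ R n (i + 1) (n - (i + 1))
  have e1 : ∀ b, chLin R F n (A * b * A * W) = chLin R F n (A * W * b) := fun b => by
    rw [mul_assoc (A * b), h.comm (mul_mem antisymOp_mem symOp_mem), hAW.eq, mul_assoc,
      ← mul_assoc A A, hAA, ← mul_assoc, ← hAW.eq]
  rw [smul_mul_assoc, map_smul, e1, smul_smul, hc, one_smul]
  simp only [mul_add, mul_one, map_add, map_smul, mul_smul_comm]

theorem wronski_step_right (hS : CondS q μ n) (hn : n = i + (k + 2)) {y : ℂ}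
    (hy : y = q ^ (2 * (k + 1))) :
    ((q * y - q⁻¹) / (q - q⁻¹)) • wronskiH q μ R F n i = wronskiAS q μ R F n (i + 1) +
      baxU q y • wronskiP q μ R F n i + baxV (-q⁻¹) μ y • wronskiQ q μ R F n i := by
  have hSS := h.symOp_mul_self hS (i := i + 1) (k := k + 1) (by omega)
  have hAW := antisymOp_commute_symOp (q := q) (μ := μ) (R := R) (n := n) (k := k + 1)
    (le_refl (i + 1))
  have hk : qNum q (k + 2) ≠ 0 := (hS (k + 2) (by omega) (by omega)).1
  have hc := wronski_norm_right h.good hk hy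
  rw [wronskiH, wronskiAS, wronskiP, wronskiQ, show n - i = k + 2 by omega,
    show n - (i + 1) = k + 1 by omega, h.symOp_add_two hS (by omega), ← hy]
  set A := antisymOp q μ R n (i + 1)
  set W := symOp q μ R n (i + 1) (k + 1)
  have e1 : ∀ b, chLin R F n (A * (W * b * W)) = chLin R F n (A * W * b) := fun b => by
    rw [← mul_assoc, h.comm symOp_mem, ← mul_assoc, ← mul_assoc, ← hAW.eq, mul_assoc A, hSS]
  rw [mul_smul_comm, map_smul, e1, smul_smul, hc, one_smul]
  simp only [mul_add, mul_one, map_add, map_smul, mul_smul_comm]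

theorem wronskiQ_two : wronskiQ q μ R F 2 0 = eta q μ • contr q μ R F := by
  rw [wronskiQ, ← h.chLin_kappaOf_two]
  simp [antisymOp, antisymOf, symOp]

theorem wronskiQ_first {m : ℕ} (hS : CondS q μ (m + 3)) {y : ℂ} (hy : y = q ^ (2 * (m + 1))) :
    ((q * y - q⁻¹) / (q - q⁻¹)) • wronskiQ q μ R F (m + 3) 0 =
      (eta q μ + baxU q y * μ⁻¹ + baxV (-q⁻¹) μ y) •
        (wronskiH q μ R F (m + 1) 0 * contr q μ R F) := by
  have hc := wronski_norm_right h.good ((hS (m + 2) (by omega) (by omega)).1) hy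
  have := h.chLin_contract_left (m := m + 1) (by omega) (S := symOp q μ R (m + 3) 2 (m + 1))
    (S' := symOp q μ R (m + 3) 2 (m + 1)) (X := symOp q μ R (m + 3) 2 (m + 1))
    (X' := symOp q μ R (m + 1) 0 (m + 1)) symOp_mem symOp_mem
    (symOp_commute_site (by omega)) (symOp_commute_site (by omega))
    (h.symOp_mul_self hS (by omega)) (h.symOp_semiconjBy (Nat.zero_le _) (by omega))
    1 (baxU q y) (baxV (-q⁻¹) μ y)
  rw [one_smul, one_mul] at this
  have e0 : ∀ m, antisymOp q μ R m (0 + 1) = 1 := fun _ => rfl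
  rw [wronskiQ, show m + 3 - (0 + 1) = m + 2 by omega, e0, one_mul,
    h.symOp_add_two hS (by omega), ← hy, smul_mul_assoc, map_smul, smul_smul, hc, one_smul, this,
    wronskiH, e0, one_mul, Nat.sub_zero]

theorem wronskiQ_last {s : ℕ} (hA : CondA q μ (s + 3)) {x : ℂ} (hx : x = (q ^ (2 * (s + 1)))⁻¹) :
    ((q - x / q) / (q - q⁻¹)) • wronskiQ q μ R F (s + 3) (s + 1) =
      (eta q μ + baxU q x * μ⁻¹ + baxV q μ x) •
        (wronskiH q μ R F (s + 1) s * contr q μ R F) := by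
  have hc := wronski_norm_left h.good (hA.qNum_ne h.good (j := s + 2) (by omega) (by omega)) hx
  -- A symmetrizer on one strand is trivial, as is a cycle on one strand, so the Newton computation
  -- applies.
  have e := h.newtonV_last hA rfl hx
  rw [newtonV, cycleOp_eq_one (by omega), one_mul] at e
  rw [wronskiQ, wronskiH, show s + 3 - (s + 1 + 1) = 1 by omega, show s + 1 - s = 1 by omega,
    symOp_one, symOp_one, mul_one, mul_one, e, smul_smul, ← mul_assoc, hc, one_mul]

/-- Both idempotents are opened next to the contraction, the antisymmetrizer at R_s and the
symmetrizer at R_{s+2}. The scalar on the left cancels their normalizations. -/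
theorem wronskiQ_middle {s k m : ℕ} (hA : CondA q μ (m + 2)) (hS : CondS q μ (m + 2))
    (hm : m = s + (k + 2)) {x y : ℂ} (hx : x = (q ^ (2 * (s + 1)))⁻¹)
    (hy : y = q ^ (2 * (k + 1))) :
    ((q - x / q) / (q - q⁻¹) * ((q * y - q⁻¹) / (q - q⁻¹))) • wronskiQ q μ R F (m + 2) (s + 1) =
    ((1 * (eta q μ + baxU q x * μ⁻¹ + baxV q μ x) + baxU q y * μ⁻¹ + baxV (-q⁻¹) μ y +
        baxU q x * baxU q y * ((q - q⁻¹) * μ⁻¹)) • wronskiAS q μ R F m (s + 1) +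
      (baxU q x * baxV (-q⁻¹) μ y + baxV q μ x * baxU q y - (q - q⁻¹) * baxU q x * baxU q y) •
        wronskiP q μ R F m s +
      (baxU q x * baxU q y + baxV q μ x * baxV (-q⁻¹) μ y) • wronskiQ q μ R F m s) *
      contr q μ R F := by
  have hc := wronski_norm_left h.good (hA.qNum_ne h.good (j := s + 2) (by omega) (by omega)) hx
  have hC := wronski_norm_right h.good ((hS (k + 2) (by omega) (by omega)).1) hy
  have hX' : antisymOp q μ R m (s + 1) * symOp q μ R m (s + 1) (k + 1) ∈ siteAlgebra R m :=
    mul_mem antisymOp_mem symOp_mem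
  have hAS := antisymOp_commute_symOp (q := q) (μ := μ) (R := R) (n := m + 2) (k := k + 1)
    (show s + 1 ≤ s + 3 by omega)
  have := h.chLin_contract (s := s) (by omega) (A := antisymOp q μ R (m + 2) (s + 1))
    (S := symOp q μ R (m + 2) (s + 3) (k + 1)) (S' := symOp q μ R (m + 2) (s + 3) (k + 1))
    (X := antisymOp q μ R (m + 2) (s + 1) * symOp q μ R (m + 2) (s + 3) (k + 1))
    (X' := antisymOp q μ R m (s + 1) * symOp q μ R m (s + 1) (k + 1)) antisymOp_mem symOp_mem hX'
    (fun l hl => antisymOp_commute_site (by omega)) (fun l hl => symOp_commute_site (by omega))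
    (symOp_commute_site (by omega)) hAS
    (by rw [hAS.symm.mul_mul_mul_comm, h.antisymOp_mul_self hA (by omega),
      h.symOp_mul_self hS (by omega)])
    (by
      rw [liftOp_mul]
      exact (h.antisymOp_semiconjBy (s := s + 1) le_rfl (by omega)).mul_right
        (h.symOp_semiconjBy (s := s + 1) le_rfl (by omega)))
    (baxU q x) (baxV q μ x) 1 (baxU q y) (baxV (-q⁻¹) μ y)
  rw [one_smul] at this
  rw [wronskiQ, show m + 2 - (s + 1 + 1) = k + 2 by omega, antisymOp_add_two, ← hx,
    h.symOp_add_two hS (by omega), ← hy, smul_mul_assoc, mul_smul_comm, smul_mul_assoc,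
    smul_mul_assoc, map_smul, map_smul, this, smul_smul, smul_smul,
    wronskiAS, wronskiP, wronskiQ, show m - (s + 1) = k + 1 by omega]
  refine (congrArg (· • _) (?_ : _ = (1 : ℂ))).trans (one_smul _ _)
  linear_combination (q * y - q⁻¹) / (q - q⁻¹) * ((q ^ (k + 1))⁻¹ / qNum q (k + 2)) * hc + hC

end IsCharTower

end Wronski


/-! ### Telescoping of the Wronski relations -/

section Wronski

variable {N : ℕ} {q μ : ℂ} {R F : Op N 2 ℂ} {n : ℕ}

theorem inv_pow_add_two (hq : q ≠ 0) (i : ℕ) :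
    q ^ 2 * (q ^ (2 * (i + 1)))⁻¹ = (q ^ (2 * i))⁻¹ := by
  rw [mul_add, pow_add, mul_inv, mul_one, mul_comm, inv_mul_cancel_right₀ (pow_ne_zero _ hq)]

theorem pow_add_two_div (hq : q ≠ 0) (i : ℕ) : q ^ (2 * (i + 1)) / q ^ 2 = q ^ (2 * i) := by
  rw [mul_add, pow_add, mul_one, mul_div_cancel_right₀ _ (pow_ne_zero _ hq)]

theorem wronskiZ_one_smul (hp : GoodParameters q μ)
    (y : ℂ) (w : QMA R F) : wronskiZ q μ 1 y • w =
      wronskiG q μ 1 y • ((q * y - q⁻¹) / (q - q⁻¹)) • w := by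
  rw [wronskiZ, one_div, div_self hp.lam_ne, one_mul, mul_comm, mul_smul]

theorem wronskiZ_smul_one (hp : GoodParameters q μ)
    (x : ℂ) (w : QMA R F) : wronskiZ q μ x 1 • w =
      wronskiG q μ x 1 • ((q - x / q) / (q - q⁻¹)) • w := by
  rw [wronskiZ, mul_one, div_self hp.lam_ne, mul_one, mul_comm, mul_smul]

/-- With X = q^{i+1} and Y = q^{k+1}, the left side is the coefficient of Q in the combination of
the two steps which eliminates P. On the right, the factor in front of Z depends only on XY = q^n
and leaves the sum over i. -/
theorem wronski_scalar_contraction (hp : GoodParameters q μ) {X Y : ℂ} (hX : X ≠ 0) (hY : Y ≠ 0)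
    (h1 : μ + q * (X ^ 2)⁻¹ ≠ 0) (h2 : q * μ - Y ^ 2 ≠ 0) :
    (Y - Y⁻¹) / (q - q⁻¹) * X * baxV q μ (X ^ 2)⁻¹ +
      (X - X⁻¹) / (q - q⁻¹) * Y⁻¹ * baxV (-q⁻¹) μ (Y ^ 2) =
      (q - q⁻¹) * μ * (q / (X * Y) + X * Y / q) *
        wronskiZ q μ (q ^ 2 * (X ^ 2)⁻¹) (Y ^ 2 / q ^ 2) := by
  have hq := hp.q_ne
  have hμ := hp.mu_ne
  have hl := hp.lam_ne
  have e1 : μ + q * (X ^ 2)⁻¹ = (μ * X ^ 2 + q) / X ^ 2 := by field_simp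
  rw [e1] at h1
  have h1' := (div_ne_zero_iff.1 h1).1
  have e2 : ((μ + q ^ 2 * (X ^ 2)⁻¹ / q) * (μ - q * (Y ^ 2 / q ^ 2))) =
      (μ * X ^ 2 + q) * (q * μ - Y ^ 2) / (X ^ 2 * q) := by field_simp
  have e3 : q - q ^ 2 * (X ^ 2)⁻¹ / q = q * (X ^ 2 - 1) / X ^ 2 := by field_simp
  have e4 : q * (Y ^ 2 / q ^ 2) - q⁻¹ = (Y ^ 2 - 1) / q := by field_simp
  have e5 : X ^ 2 * Y ^ 2 + q ^ 2 = q * (μ * X ^ 2 + q) - X ^ 2 * (q * μ - Y ^ 2) := by ring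
  have e6 : q / (X * Y) + X * Y / q =
      (q * (μ * X ^ 2 + q) - X ^ 2 * (q * μ - Y ^ 2)) / (X * Y * q) := by
    rw [← e5]; field_simp; ring
  rw [baxV_eq_div hμ, baxV_neg_inv_eq_div hq hμ, wronskiZ, wronskiG, e1, e2, e3, e4, e6]
  generalize q - q⁻¹ = l at *
  generalize μ * X ^ 2 + q = a at *
  generalize q * μ - Y ^ 2 = b at *
  field_simp
  ring

theorem qNum_one (hp : GoodParameters q μ) : qNum q 1 = 1 := by
  rw [qNum, pow_one, div_self hp.lam_ne]

/-- The sum of the contraction terms of the Wronski relations. -/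
noncomputable def wronskiSum (q μ : ℂ) (R F : Op N 2 ℂ) (n : ℕ) : QMA R F :=
  ∑ i ∈ Finset.range (n - 1), ((-1 : ℂ) ^ i * wronskiZ q μ (q ^ (2 * i))⁻¹ (q ^ (2 * (n - 2 - i)))) •
    wronskiQ q μ R F n i

namespace IsCharTower

variable (h : IsCharTower q μ R F)
include h

theorem wronski_first {m : ℕ} (hA : CondA q μ (m + 3)) (hS : CondS q μ (m + 3)) :
    wronskiZ q μ (q ^ (2 * 0))⁻¹ (q ^ (2 * (m + 1))) • wronskiQ q μ R F (m + 3) 0 =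
      wronskiE q μ (q ^ (2 * 0))⁻¹ (q ^ (2 * (m + 1))) •
        (wronskiH q μ R F (m + 1) 0 * contr q μ R F) := by
  have hp := h.good
  have hq := hp.q_ne
  have hy := hS.sub_ne hp (k := m + 1) (by omega) (by omega)
  have hy' := hS.sub_ne hp (k := m + 2) (by omega) (by omega)
  have hx' := hA.add_ne hp (j := 1) (by omega) (by omega)
  have hxy := hA.pow_sub_one_ne hp (i := m + 1) (by omega) (by omega)
  rw [mul_zero, pow_zero, inv_one, wronskiZ_one_smul hp, h.wronskiQ_first hS rfl, smul_smul,
    wronski_scalar_left hp hy, wronskiE_eq hp, one_div, div_self hp.lam_ne, mul_one]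
  · intro e
    apply hx'
    rw [← e]
    field_simp
    ring
  · intro e
    apply hy'
    rw [show 2 * (m + 2) = 2 * (m + 1) + 2 by ring, pow_add]
    linear_combination q * e
  · intro e
    apply hxy
    rw [← pow_mul']
    linear_combination -e

theorem wronski_last {s : ℕ} (hA : CondA q μ (s + 3)) (hS : CondS q μ (s + 3)) :
    wronskiZ q μ (q ^ (2 * (s + 1)))⁻¹ (q ^ (2 * 0)) • wronskiQ q μ R F (s + 3) (s + 1) =
      wronskiE q μ (q ^ (2 * s))⁻¹ (q ^ (2 * 1)) •
        (wronskiH q μ R F (s + 1) s * contr q μ R F) := by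
  have hp := h.good
  have hq := hp.q_ne
  have hx := hA.add_ne hp (j := s + 1) (by omega) (by omega)
  have hx' := hA.add_ne hp (j := s + 2) (by omega) (by omega)
  have hy' := hS.sub_ne hp (k := 1) (by omega) (by omega)
  have hxy := hA.pow_sub_one_ne hp (i := s + 1) (by omega) (by omega)
  have e1 := wronskiE_shift (x := (q ^ (2 * (s + 1)))⁻¹) (y := 1) hp ?_ ?_
  rw [inv_pow_add_two hq, mul_one, mul_one, div_self hp.lam_ne, mul_one] at e1
  · rw [mul_zero, pow_zero, wronskiZ_smul_one hp, h.wronskiQ_last hA rfl, smul_smul,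
      wronski_scalar_right hp, mul_one, e1]
    · rwa [add_comm]
    · intro e
      apply hxy
      rw [← pow_mul']
      have := inv_eq_one.1 (sub_eq_zero.1 e)
      rw [this, sub_self]
  · intro e
    apply hx'
    rw [← e, ← inv_pow_add_two hq (s + 1)]
    field_simp
    ring
  · intro e
    apply hy'
    linear_combination q * e

/-- The contracted Q is a combination of AS, P, Q of level m. The first two are absorbed into
H_{s+1} and H_s by the left and right steps, and a multiple of Q_s remains. -/
theorem wronski_middle {s k m : ℕ} (hA : CondA q μ (m + 2)) (hS : CondS q μ (m + 2))
    (hm : m = s + (k + 2)) :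
    wronskiZ q μ (q ^ (2 * (s + 1)))⁻¹ (q ^ (2 * (k + 1))) • wronskiQ q μ R F (m + 2) (s + 1) =
      (wronskiE q μ (q ^ (2 * (s + 1)))⁻¹ (q ^ (2 * (k + 1))) • wronskiH q μ R F m (s + 1) +
        wronskiE q μ (q ^ (2 * s))⁻¹ (q ^ (2 * (k + 2))) • wronskiH q μ R F m s -
        ((q ^ 2 - q ^ (2 * m) / q ^ 2) / (1 - q ^ (2 * m)) *
          wronskiZ q μ (q ^ (2 * s))⁻¹ (q ^ (2 * k))) • wronskiQ q μ R F m s) * contr q μ R F := by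
  have hp := h.good
  have hq := hp.q_ne
  have hx : μ + q * (q ^ (2 * (s + 1)))⁻¹ ≠ 0 := by
    rw [add_comm]; exact hA.add_ne hp (j := s + 1) (by omega) (by omega)
  have hx' : μ + (q ^ (2 * (s + 1)))⁻¹ / q ≠ 0 := by
    intro e
    apply hA.add_ne hp (j := s + 2) (by omega) (by omega)
    rw [← e, ← inv_pow_add_two hq (s + 1)]
    field_simp
    ring
  have hy := hS.sub_ne hp (k := k + 1) (by omega) (by omega)
  have hy' : μ - q * q ^ (2 * (k + 1)) ≠ 0 := by
    intro e
    apply hS.sub_ne hp (k := k + 2) (by omega) (by omega)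
    rw [show 2 * (k + 2) = 2 * (k + 1) + 2 by ring, pow_add]
    linear_combination q * e
  have h1 : 1 - q ^ (2 * m) ≠ 0 := by
    intro e
    apply hA.pow_sub_one_ne hp (i := m) (by omega) (by omega)
    rw [← pow_mul']
    linear_combination -e
  have hs0 : q ^ (2 * (s + 1)) ≠ 0 := pow_ne_zero _ hq
  -- The ratio y/x = q^{2m} does not depend on s, so the factor of the Q-term is common to all
  -- summands.
  have hyx : q ^ (2 * (k + 1)) = q ^ (2 * m) * (q ^ (2 * (s + 1)))⁻¹ := by
    rw [eq_mul_inv_iff_mul_eq₀ hs0, ← pow_add]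
    congr 1
    omega
  have hK : (q ^ 2 * (q ^ (2 * (s + 1)))⁻¹ - q ^ (2 * (k + 1)) / q ^ 2) /
      ((q ^ (2 * (s + 1)))⁻¹ - q ^ (2 * (k + 1))) =
      (q ^ 2 - q ^ (2 * m) / q ^ 2) / (1 - q ^ (2 * m)) := by
    rw [hyx, ← mul_div_mul_right _ (1 - q ^ (2 * m)) (inv_ne_zero hs0)]
    congr 1 <;> ring
  have hxy : (q ^ (2 * (s + 1)))⁻¹ - q ^ (2 * (k + 1)) ≠ 0 := by
    rw [hyx, ← one_sub_mul]
    exact mul_ne_zero h1 (inv_ne_zero hs0)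
  have eK := wronski_scalar_kappa hp hx hy hxy hx' hy'
  have eE := wronskiE_shift hp hx' hy'
  have e1 := wronski_scalar_one hp hx hy hxy
  have e2 := wronski_scalar_sigma hp hx hy hxy
  have eL := h.wronski_step_left (n := m) (i := s) (hA.mono (by omega)) (by omega) rfl
  have eR := h.wronski_step_right (n := m) (i := s) (k := k) (fun j h1 h2 => hS j h1 (by omega)) hm
    rfl
  rw [hK, inv_pow_add_two hq, pow_add_two_div hq] at eK
  rw [inv_pow_add_two hq, show q ^ 2 * q ^ (2 * (k + 1)) = q ^ (2 * (k + 2)) by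
    rw [← pow_add]; congr 1; ring] at eE
  rw [eE, wronskiE_eq hp hx' hy', mul_smul (_ * _), mul_smul (_ * _), eL, eR, wronskiZ,
    mul_comm _ (wronskiG _ _ _ _), mul_smul, h.wronskiQ_middle hA hS hm rfl rfl, ← smul_mul_assoc]
  congr 1
  match_scalars
  · linear_combination wronskiG q μ (q ^ (2 * (s + 1)))⁻¹ (q ^ (2 * (k + 1))) * e1
  · linear_combination wronskiG q μ (q ^ (2 * (s + 1)))⁻¹ (q ^ (2 * (k + 1))) * e2
  · linear_combination eK

theorem wronski_partial {m j : ℕ} (hA : CondA q μ (m + 2)) (hS : CondS q μ (m + 2))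
    (hj : j + 1 ≤ m) :
    ∑ i ∈ Finset.range (j + 1), ((-1 : ℂ) ^ i * wronskiZ q μ (q ^ (2 * i))⁻¹ (q ^ (2 * (m - i)))) •
      wronskiQ q μ R F (m + 2) i =
    ((-1 : ℂ) ^ j * wronskiE q μ (q ^ (2 * j))⁻¹ (q ^ (2 * (m - j)))) •
      (wronskiH q μ R F m j * contr q μ R F) +
    ((q ^ 2 - q ^ (2 * m) / q ^ 2) / (1 - q ^ (2 * m))) •
      ((∑ i ∈ Finset.range j, ((-1 : ℂ) ^ i *
        wronskiZ q μ (q ^ (2 * i))⁻¹ (q ^ (2 * (m - 2 - i)))) • wronskiQ q μ R F m i) *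
        contr q μ R F) := by
  induction j with
  | zero =>
    obtain ⟨m, rfl⟩ : ∃ k, m = k + 1 := ⟨m - 1, by omega⟩
    simpa using h.wronski_first hA hS
  | succ j ih =>
    obtain ⟨k, rfl⟩ : ∃ k, m = j + (k + 2) := ⟨m - 2 - j, by omega⟩
    have e := h.wronski_middle hA hS rfl
    rw [Finset.sum_range_succ, ih (by omega), Finset.sum_range_succ,
      show j + (k + 2) - (j + 1) = k + 1 by omega, mul_smul _ (wronskiZ _ _ _ _), e,
      show j + (k + 2) - j = k + 2 by omega, show j + (k + 2) - 2 - j = k by omega]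
    simp only [add_mul, sub_mul, smul_mul_assoc]
    match_scalars <;> ring

/-- The boundary contraction on the right cancels the one H-term left over by `wronski_partial`. -/
theorem wronskiSum_step {m : ℕ} (hm : 1 ≤ m) (hA : CondA q μ (m + 2)) (hS : CondS q μ (m + 2)) :
    wronskiSum q μ R F (m + 2) = ((q ^ 2 - q ^ (2 * m) / q ^ 2) / (1 - q ^ (2 * m))) •
      (wronskiSum q μ R F m * contr q μ R F) := by
  obtain ⟨s, rfl⟩ : ∃ k, m = k + 1 := ⟨m - 1, by omega⟩
  rw [wronskiSum, wronskiSum]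
  simp only [Nat.add_sub_cancel, show s + 1 + 2 - 1 = s + 1 + 1 by omega]
  rw [Finset.sum_range_succ, h.wronski_partial hA hS le_rfl, show s + 1 - s = 1 by omega,
    show s + 1 - (s + 1) = 0 by omega, mul_smul _ (wronskiZ _ _ _ _), h.wronski_last hA hS]
  match_scalars <;> ring

theorem wronskiSum_eq_zero (hn : 3 ≤ n) (hA : CondA q μ n) (hS : CondS q μ n) :
    wronskiSum q μ R F n = 0 := by
  induction n using Nat.strong_induction_on with
  | _ n ih =>
    obtain ⟨m, rfl⟩ : ∃ k, n = k + 2 := ⟨n - 2, by omega⟩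
    rw [h.wronskiSum_step (by omega) hA hS]
    -- For m = 1 the lower sum is empty; for m = 2 the factor q² - q^{2m}/q² is zero.
    rcases (show m = 1 ∨ m = 2 ∨ 3 ≤ m by omega) with rfl | rfl | hm
    · simp [wronskiSum]
    · have : q ^ 2 - q ^ (2 * 2) / q ^ 2 = 0 := by
        have := h.good.q_ne
        field_simp
        ring
      rw [this, zero_div, zero_smul]
    · rw [ih m (by omega) hm (hA.mono (by omega)) fun j h1 h2 => hS j h1 (by omega), zero_mul,
        smul_zero]

theorem wronskiSum_two (hA : CondA q μ 2) (hS : CondS q μ 2) :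
    ((q - q⁻¹) * μ) • wronskiSum q μ R F 2 = -contr q μ R F := by
  have hp := h.good
  have hq := hp.q_ne
  have hμ := hp.mu_ne
  have hl := hp.sq_sub_one_ne
  have h1 := hA.add_ne hp (j := 1) (by omega) (by omega)
  have h2 := hS.sub_ne hp (k := 1) (by omega) (by omega)
  have e : (q - q⁻¹) * μ * (wronskiG q μ 1 1 * eta q μ) = -1 := by
    have h3 : μ + 1 / q ≠ 0 := by
      intro e
      apply h1
      rw [← e]
      field_simp
      ring
    have h4 : μ - q ≠ 0 := by
      intro e; apply h2; linear_combination q * e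
    have h6 : eta q μ = -((μ + 1 / q) * (μ - q)) / (μ * (q - q⁻¹)) := by
      rw [eta, one_div]; congr 1; ring
    rw [wronskiG, h6, mul_one]
    have h7 := mul_ne_zero h3 h4
    have h8 := hp.lam_ne
    generalize (μ + 1 / q) * (μ - q) = g at *
    generalize q - q⁻¹ = l at *
    field_simp
  simp only [wronskiSum, Nat.reduceSub, Finset.sum_range_one, mul_zero, pow_zero, inv_one,
    Nat.sub_zero, one_mul]
  rw [wronskiZ_one_smul hp, mul_one, div_self hp.lam_ne, one_smul, h.wronskiQ_two, smul_smul,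
    smul_smul, mul_assoc ((q - q⁻¹) * μ), e, neg_one_smul]

/-- With n = i + k + 2, the left and right steps are added with weights (k+1)_q q^{i+1} and (i+1)_q
q^{-k-1}. The weights sum to n_q, and P drops out because its coefficients become -(k+1)_q(i+1)_q
and (i+1)_q(k+1)_q. -/
theorem qNum_smul_wronskiAS {i : ℕ} (hA : CondA q μ n) (hS : CondS q μ n) (hi : i + 2 ≤ n) :
    qNum q n • wronskiAS q μ R F n (i + 1) =
      (qNum q (i + 2) * qNum q (n - (i + 1))) • wronskiH q μ R F n (i + 1) +
      (qNum q (i + 1) * qNum q (n - i)) • wronskiH q μ R F n i -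
      ((q - q⁻¹) * μ * (q / q ^ n + q ^ n / q) *
        wronskiZ q μ (q ^ (2 * i))⁻¹ (q ^ (2 * (n - 2 - i)))) • wronskiQ q μ R F n i := by
  have hp := h.good
  have hq := hp.q_ne
  obtain ⟨k, rfl⟩ : ∃ k, n = i + (k + 2) := ⟨n - 2 - i, by omega⟩
  have eL := h.wronski_step_left (i := i) hA hi rfl
  have eR := h.wronski_step_right (i := i) (k := k) hS rfl rfl
  have h1 := hA.add_ne hp (j := i + 1) (by omega) (by omega)
  have h2 := hS.sub_ne hp (k := k + 1) (by omega) (by omega)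
  have hX : q ^ (i + 1) ≠ 0 := pow_ne_zero _ hq
  have hY : q ^ (k + 1) ≠ 0 := pow_ne_zero _ hq
  have hci : (q - (q ^ (2 * (i + 1)))⁻¹ / q) / (q - q⁻¹) = (q ^ (i + 1))⁻¹ * qNum q (i + 2) := by
    rw [qNum]
    field_simp
    ring
  have hCi : (q * q ^ (2 * (k + 1)) - q⁻¹) / (q - q⁻¹) = q ^ (k + 1) * qNum q (k + 2) := by
    rw [qNum]
    field_simp
    ring
  rw [hci, mul_smul] at eL
  rw [hCi, mul_smul] at eR
  rw [show i + (k + 2) - (i + 1) = k + 1 by omega, show i + (k + 2) - i = k + 2 by omega,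
    show i + (k + 2) - 2 - i = k by omega, mul_comm (qNum q (i + 2)),
    show qNum q (k + 1) * qNum q (i + 2) = qNum q (k + 1) * q ^ (i + 1) * ((q ^ (i + 1))⁻¹ *
      qNum q (i + 2)) by rw [mul_assoc, mul_inv_cancel_left₀ hX],
    show qNum q (i + 1) * qNum q (k + 2) = qNum q (i + 1) * (q ^ (k + 1))⁻¹ * (q ^ (k + 1) *
      qNum q (k + 2)) by rw [mul_assoc, inv_mul_cancel_left₀ hY], mul_smul (_ * _),
    mul_smul (qNum q (i + 1) * _), mul_smul ((q ^ (i + 1))⁻¹), mul_smul (q ^ (k + 1)), eL, eR]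
  have h0 := wronski_scalar_contraction hp hX hY (by rwa [← pow_mul', add_comm])
    (by rwa [← pow_mul'])
  rw [← pow_mul', ← pow_mul', inv_pow_add_two hq, pow_add_two_div hq, ← pow_add,
    show i + 1 + (k + 1) = i + (k + 2) by ring, ← qNum, ← qNum] at h0
  rw [← h0]
  match_scalars
  · simp only [qNum]
    field_simp
    ring
  · simp only [qNum, baxU]
    field_simp
    ring
  · ring

theorem wronski_sum_partial {j : ℕ} (hA : CondA q μ n) (hS : CondS q μ n) (hj : j + 1 ≤ n) :
    qNum q n • ∑ i ∈ Finset.range (j + 1), (-1 : ℂ) ^ i • wronskiAS q μ R F n i =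
      ((-1) ^ j * (qNum q (j + 1) * qNum q (n - j))) • wronskiH q μ R F n j +
      ((q - q⁻¹) * μ * (q / q ^ n + q ^ n / q)) • ∑ i ∈ Finset.range j,
        ((-1 : ℂ) ^ i * wronskiZ q μ (q ^ (2 * i))⁻¹ (q ^ (2 * (n - 2 - i)))) •
          wronskiQ q μ R F n i := by
  induction j with
  | zero =>
    have : wronskiAS q μ R F n 0 = wronskiH q μ R F n 0 := rfl
    simp [this, qNum_one h.good]
  | succ j ih =>
    rw [Finset.sum_range_succ, smul_add, ih (by omega), smul_comm, h.qNum_smul_wronskiAS hA hS hj,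
      Finset.sum_range_succ]
    match_scalars <;> ring

theorem wronski_sum (hn : 1 ≤ n) (hA : CondA q μ n) (hS : CondS q μ n) :
    qNum q n • ∑ i ∈ Finset.range (n + 1), (-1 : ℂ) ^ i • wronskiAS q μ R F n i =
      ((q - q⁻¹) * μ * (q / q ^ n + q ^ n / q)) • wronskiSum q μ R F n := by
  obtain ⟨m, rfl⟩ : ∃ k, n = k + 1 := ⟨n - 1, by omega⟩
  -- At the right end the symmetrizers have zero strands and one strand respectively, hence are
  -- trivial; this last term cancels the remaining H.
  have e : wronskiAS q μ R F (m + 1) (m + 1) = wronskiH q μ R F (m + 1) m := by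
    rw [wronskiAS, wronskiH, Nat.sub_self, Nat.add_sub_cancel_left]; rfl
  rw [Finset.sum_range_succ, smul_add, h.wronski_sum_partial hA hS le_rfl, e,
    Nat.add_sub_cancel_left, qNum_one h.good, wronskiSum, Nat.add_sub_cancel]
  match_scalars <;> ring

/-- The Wronski relations. -/
theorem wronski (hA : CondA q μ n) (hS : CondS q μ n) :
    ∑ i ∈ Finset.range (n + 1), (-1 : ℂ) ^ i •
      (elemSum q μ R F i * elemSum (-q⁻¹) μ R F (n - i)) =
      (if n = 0 then 1 else 0) - (if n = 2 then contr q μ R F else 0) := by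
  rcases n.eq_zero_or_pos with rfl | hn
  · simp [elemSum_zero]
  rw [Finset.sum_congr rfl fun i hi => by rw [← h.wronskiAS_eq (Finset.mem_range_succ_iff.1 hi)],
    if_neg hn.ne', zero_sub]
  have hq := h.good.q_ne
  have hl := h.good.sq_sub_one_ne
  apply smul_right_injective _ (hA.qNum_ne h.good hn le_rfl)
  dsimp only
  rw [h.wronski_sum hn hA hS]
  rcases (show n = 1 ∨ n = 2 ∨ 3 ≤ n by omega) with rfl | rfl | hn
  · simp [wronskiSum]
  · rw [if_pos rfl, ← h.wronskiSum_two hA hS, smul_smul]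
    congr 1
    rw [qNum]
    field_simp
    ring
  · rw [h.wronskiSum_eq_zero hn hA hS, if_neg (by omega)]
    simp

end IsCharTower

end Wronski


/-! ### Identification with the symmetric functions and membership in C(R,F) -/

section CharacteristicSubalgebra

variable {N : ℕ} {R F : Op N 2 ℂ} {q μ : ℂ}

theorem IsBMWType.isCharTower (hR : IsBMWType R q μ) (hs : SkewInvertible R) (hF : IsRMatrix F)
    (hRF : IsCompatible R F) : IsCharTower q μ R F :=
  ⟨hR.admissible.good, hR.admissible.eta_ne, hR.family,
    fun hY => chLin_mul_comm hR.isRMatrix hs hF hRF hY, fun hX => chLin_liftOp_mul hs hF hRF hX⟩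

theorem map_bmwRep_antisymOf (hR : IsBMWType R q μ) (q' : ℂ) (n i : ℕ) :
    bmwRep hR n (antisymOf q' μ (bmwGen q μ n) i) = antisymOp q' μ R n i := by
  rw [map_antisymOf, antisymOp]
  exact antisymOf_congr fun l _ => bmwRep_bmwGen hR n l

theorem elemA_eq (hR : IsBMWType R q μ) (i : ℕ) : elemA hR F i = elemSum q μ R F i := by
  cases i with
  | zero => exact elemSum_zero.symm
  | succ i =>
    rw [elemA, ch, antisymmetrizer_eq, map_bmwRep_antisymOf]
    rfl

theorem elemS_eq (hR : IsBMWType R q μ) (i : ℕ) : elemS hR F i = elemSum (-q⁻¹) μ R F i := by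
  cases i with
  | zero => exact elemSum_zero.symm
  | succ i =>
    rw [elemS, ch, symmetrizer_eq, map_bmwRep_antisymOf]
    rfl

theorem powerSum_eq (hR : IsBMWType R q μ) {i : ℕ} (hi : 1 ≤ i) :
    powerSum hR F i = cycleSum R F i := by
  obtain ⟨i, rfl⟩ : ∃ k, i = k + 1 := ⟨i - 1, by omega⟩
  have : bmwRep hR (i + 1) (descProd (bmwGen q μ (i + 1)) i) = cycleOp R (i + 1) 0 := by
    rw [map_descProd, cycleOp]
    congr 1
    funext l
    rw [Function.comp_apply, bmwRep_bmwGen, zero_add]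
  exact congrArg (chOp R F) this

theorem contraction_eq (hR : IsBMWType R q μ) : contraction hR F = contr q μ R F := by
  rw [contraction, ch, contractor, map_smul, map_kappaOf, bmwRep_bmwGen, contr, ← map_smul]
  rfl

/-- The BMW algebra is a quotient of the group algebra, so α is a linear combination of images of
braids. -/
theorem ch_mem_charSubspace (hR : IsBMWType R q μ) {n : ℕ} (hn : 1 ≤ n) (α : BMW q μ n) :
    ch hR F α ∈ charSubspace hR.isRMatrix F := by
  obtain ⟨x, rfl⟩ := RingQuot.mkAlgHom_surjective ℂ (BMWRel q μ n) α
  change chLin R F n (bmwRep hR n _) ∈ _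
  induction x using MonoidAlgebra.induction_on with
  | of β =>
    change chLin R F n (bmwRep hR n (ofBraid q μ n β)) ∈ _
    rw [bmwRep_ofBraid]
    exact Submodule.subset_span (Or.inr ⟨n, hn, β, rfl⟩)
  | add x y hx hy => rw [map_add, map_add, map_add]; exact add_mem hx hy
  | smul c x hx => rw [map_smul, map_smul, map_smul]; exact Submodule.smul_mem _ c hx

theorem one_mem_charSubspace (hR : IsRMatrix R) : 1 ∈ charSubspace hR F :=
  Submodule.subset_span (Or.inl rfl)

theorem elemA_mem_charSubspace (hR : IsBMWType R q μ) :
    ∀ i, elemA hR F i ∈ charSubspace hR.isRMatrix F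
  | 0 => one_mem_charSubspace _
  | _ + 1 => ch_mem_charSubspace hR (by omega) _

theorem elemS_mem_charSubspace (hR : IsBMWType R q μ) :
    ∀ i, elemS hR F i ∈ charSubspace hR.isRMatrix F
  | 0 => one_mem_charSubspace _
  | _ + 1 => ch_mem_charSubspace hR (by omega) _

theorem powerSum_mem_charSubspace (hR : IsBMWType R q μ) :
    ∀ i, powerSum hR F i ∈ charSubspace hR.isRMatrix F
  | 0 => by
    rw [powerSum, Algebra.algebraMap_eq_smul_one]
    exact Submodule.smul_mem _ _ (one_mem_charSubspace _)
  | _ + 1 => ch_mem_charSubspace hR (by omega) _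

/-- The Newton relations for the symmetric functions. -/
theorem IsCharTower.newton_symm (h : IsCharTower q μ R F) {n : ℕ} (hS : CondS q μ n) :
    ∑ i ∈ Finset.range n, (q ^ i)⁻¹ • (elemSum (-q⁻¹) μ R F i * cycleSum R F (n - i)) =
      qNum q n • elemSum (-q⁻¹) μ R F n + ∑ i ∈ Finset.Icc 1 (n / 2),
        (μ * q ^ (2 * (i : ℤ) - n) + q ^ ((n : ℤ) - 2 * i - 1)) •
          (elemSum (-q⁻¹) μ R F (n - 2 * i) * contr q μ R F ^ i) := by
  have hq := h.good.q_ne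
  have e := h.neg_inv.newton hS.condA
  rw [contr_neg_inv, qNum_neg_inv, Finset.smul_sum] at e
  convert e using 2
  · simp
  · rw [← mul_assoc, ← pow_add, Even.neg_one_pow ⟨n + 1, rfl⟩, one_mul]
  · refine Finset.sum_congr rfl fun i hi => ?_
    rw [smul_smul]
    congr 1
    -- The sign (-1)^n extracted here and in `e2` cancels the global sign of the antisymmetric
    -- relation.
    have e1 : (-q⁻¹) ^ ((n : ℤ) - 2 * i) = (-1) ^ n * q ^ (2 * (i : ℤ) - n) := by
      rw [← neg_one_mul, mul_zpow, inv_zpow', neg_sub, zpow_sub₀ (by norm_num), zpow_mul]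
      simp
    have e2 : (-q⁻¹) ^ (1 - (n : ℤ) + 2 * i) = -((-1) ^ n * q ^ ((n : ℤ) - 2 * i - 1)) := by
      rw [show 1 - (n : ℤ) + 2 * i = -((n : ℤ) - 2 * i) + 1 by ring, zpow_add_one₀ (by simpa),
        zpow_neg, e1, mul_inv, ← zpow_neg, neg_sub, zpow_sub_one₀ hq, ← inv_pow]
      norm_num
      ring
    have e3 : ((-1 : ℂ) ^ n) * (-1) ^ n = 1 := by rw [← mul_pow]; simp
    rw [e1, e2]
    linear_combination (-(μ * q ^ (2 * (i : ℤ) - n) + q ^ ((n : ℤ) - 2 * i - 1))) * e3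

end CharacteristicSubalgebra

end QuantumMatrix

open QuantumMatrix in
theorem theorem6p1 {N : ℕ} {R F : Op N 2 ℂ} {q μ : ℂ}
    (hR : IsBMWType R q μ) (hRskew : SkewInvertible R)
    (hF : IsRMatrix F) (hFskew : StrictSkewInvertible F)
    (hRF : IsCompatible R F) (n : ℕ) :
    (∀ i, powerSum hR F i ∈ charSubspace hR.isRMatrix F) ∧
    contraction hR F ∈ charSubspace hR.isRMatrix F ∧
    (CondA q μ n →
      (∀ i ≤ n, elemA hR F i ∈ charSubspace hR.isRMatrix F) ∧
      ∑ i ∈ Finset.range n, (-q) ^ i • (elemA hR F i * powerSum hR F (n - i)) =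
        ((-1) ^ (n + 1) * qNum q n) • elemA hR F n +
          (-1 : ℂ) ^ n • ∑ i ∈ Finset.Icc 1 (n / 2),
            (μ * q ^ ((n : ℤ) - 2 * i) - q ^ (1 - (n : ℤ) + 2 * i)) •
              (elemA hR F (n - 2 * i) * contraction hR F ^ i)) ∧
    (CondS q μ n →
      (∀ i ≤ n, elemS hR F i ∈ charSubspace hR.isRMatrix F) ∧
      ∑ i ∈ Finset.range n, (q ^ i)⁻¹ • (elemS hR F i * powerSum hR F (n - i)) =
        qNum q n • elemS hR F n +
          ∑ i ∈ Finset.Icc 1 (n / 2),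
            (μ * q ^ (2 * (i : ℤ) - n) + q ^ ((n : ℤ) - 2 * i - 1)) •
              (elemS hR F (n - 2 * i) * contraction hR F ^ i)) ∧
    (CondA q μ n → CondS q μ n →
      ∑ i ∈ Finset.range (n + 1), (-1 : ℂ) ^ i • (elemA hR F i * elemS hR F (n - i)) =
        (if n = 0 then 1 else 0) - (if n = 2 then contraction hR F else 0)) := by
  have h := hR.isCharTower hRskew hF hRF
  refine ⟨powerSum_mem_charSubspace hR, ch_mem_charSubspace hR (by omega) _,
    fun hA => ⟨fun i _ => elemA_mem_charSubspace hR i, ?_⟩,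
    fun hS => ⟨fun i _ => elemS_mem_charSubspace hR i, ?_⟩, fun hA hS => ?_⟩
  · have e := h.newton hA
    simp only [← elemA_eq hR, ← contraction_eq hR] at e
    rw [← e]
    -- Only p_{n-i} with i < n occurs. This matters because p_0 is Tr D_R, whereas `cycleSum` at 0
    -- is 1.
    refine Finset.sum_congr rfl fun i hi => ?_
    rw [powerSum_eq hR (Nat.sub_pos_of_lt (Finset.mem_range.1 hi))]
  · have e := h.newton_symm hS
    simp only [← elemS_eq hR, ← contraction_eq hR] at e
    rw [← e]
    refine Finset.sum_congr rfl fun i hi => ?_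
    rw [powerSum_eq hR (Nat.sub_pos_of_lt (Finset.mem_range.1 hi))]
  · have e := h.wronski hA hS
    simpa only [← elemA_eq hR, ← elemS_eq hR, ← contraction_eq hR] using e
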